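/- Conventions. Manifolds are smooth, Hausdorff and second countable; Lie groups are real. Let $G$ be a Lie group whose Lie algebra $\mathfrak g$ is semisimple. A $|k|$-grading of $\mathfrak g$ is a decomposition $\mathfrak g=\mathfrak g_{-k}\oplus\dots\oplus\mathfrak g_k$ with $[\mathfrak g_i,\mathfrak g_j]\subset\mathfrak g_{i+j}$ such that $\mathfrak g_{-k}\oplus\dots\oplus\mathfrak g_{-1}$ is generated by $\mathfrak g_{-1}$. Put $\mathfrak g^i=\bigoplus_{j\ge i}\mathfrak g_j$, $\mathfrak p=\mathfrak g^0$, $\mathfrak p_+=\mathfrak g^1$; the associated parabolic subgroup is $P=N_G(\mathfrak p)=\{g\in G:\operatorname{Ad}(g)\mathfrak p=\mathfrak p\}$, with its structure of a Lie subgroup of $G$. A parabolic geometry of type $(G,P)$ on a manifold $N$ is a principal $P$-bundle $\mathcal G\to N$ with a smooth one-form $\omega\in\Omega^1(\mathcal G,\mathfrak g)$ such that $(r^h)^*\omega=\operatorname{Ad}(h)^{-1}\circ\omega$ for $h\in P$, $\omega(\zeta_A)=A$ for the fundamental vector fields $\zeta_A$, $A\in\mathfrak p$, and every $\omega(u):T_u\mathcal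 G\to\mathfrak g$ is an isomorphism. Its curvature is $K(\xi,\eta)=d\omega(\xi,\eta)+[\omega(\xi),\omega(\eta)]$, and its curvature function is $\kappa(u)(X,Y)=K(\omega^{-1}(X),\omega^{-1}(Y))(u)$ for $u\in\mathcal G$, $X,Y\in\mathfrak g$. Since $K$ is horizontal, $\kappa(u)\in\Lambda^2(\mathfrak g/\mathfrak p)^*\otimes\mathfrak g\cong\Lambda^2\mathfrak p_+\otimes\mathfrak g$ through the Killing form. The geometry is *normal* if $\partial^*(\kappa(u))=0$ for all $u$, where $\partial^*:\Lambda^2\mathfrak p_+\otimes\mathfrak g\to\mathfrak p_+\otimes\mathfrak g$ is given by $$\partial^*(\alpha\wedge\beta\otimes s)=-\beta\otimes[\alpha,s]+\alpha\otimes[\beta,s]-[\alpha,\beta]\otimes s,$$ and *regular* if $\kappa(u)(\mathfrak g^i,\mathfrak g^j)\subset\mathfrak g^{i+j+1}$ for all $u$ and all $i,j<0$. Proposition 3.1 (normality of correspondence spaces). Let $Q\subset P\subset G$ be nested parabolic subgroups and let $(\mathcal G\to N,\omega)$ be a normal parabolic geometry of type $(G,P)$. Then the correspondence space $\mathcal CN=\mathcal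 G/Q$, with the quotient topology, carries a smooth manifold structure for which $\mathcal G\to\mathcal CN$ is a principal $Q$-bundle and $(\mathcal G\to\mathcal CN,\omega)$ is a parabolic geometry of type $(G,Q)$, and this parabolic geometry is again normal. Regularity, by contrast, is not preserved in general: there are a semisimple $G$, nested parabolic subgroups $Q\subset P\subset G$ (with no nonzero ideal of $\mathfrak g$ contained in the component $\mathfrak g_0$ of the grading that defines $P$) and a regular normal parabolic geometry $(\mathcal G\to N,\omega)$ of type $(G,P)$ such that $(\mathcal G\to\mathcal CN,\omega)$ is not regular as a geometry of type $(G,Q)$. -/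

import Mathlib

open scoped Manifold ContDiff TensorProduct

namespace ParabolicGeometry

noncomputable section

section Algebra

variable {𝔤 : Type*} [LieRing 𝔤] [LieAlgebra ℝ 𝔤]

/-- A `|k|`-grading of a real Lie algebra: `𝔤 = 𝔤₋ₖ ⊕ ⋯ ⊕ 𝔤ₖ`, compatible with the bracket, such
that `𝔤₋ = ⨁_{i < 0} 𝔤ᵢ` is generated, as a Lie algebra, by `𝔤₋₁`. -/
structure Grading (𝔤 : Type*) [LieRing 𝔤] [LieAlgebra ℝ 𝔤] where
  /-- the depth of the grading -/
  k : ℕ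
  /-- the component `𝔤ᵢ` -/
  comp : ℤ → Submodule ℝ 𝔤
  isInternal : DirectSum.IsInternal comp
  comp_eq_bot : ∀ i : ℤ, (k : ℤ) < |i| → comp i = ⊥
  lie_mem : ∀ (i j : ℤ) (x y : 𝔤), x ∈ comp i → y ∈ comp j → ⁅x, y⁆ ∈ comp (i + j)
  generated : (LieSubalgebra.lieSpan ℝ 𝔤 (comp (-1) : Set 𝔤)).toSubmodule =
    ⨆ i : ℤ, ⨆ _ : i < 0, comp i

namespace Grading

variable (gr : Grading 𝔤)

/-- The filtration component `𝔤ⁱ = 𝔤ᵢ ⊕ 𝔤ᵢ₊₁ ⊕ ⋯ ⊕ 𝔤ₖ`. -/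
def filt (i : ℤ) : Submodule ℝ 𝔤 := ⨆ j : ℤ, ⨆ _ : i ≤ j, gr.comp j

lemma comp_le_filt {i j : ℤ} (h : i ≤ j) : gr.comp j ≤ gr.filt i :=
  le_iSup₂_of_le (f := fun (j : ℤ) (_ : i ≤ j) => gr.comp j) j h le_rfl

lemma filt_anti {i j : ℤ} (h : i ≤ j) : gr.filt j ≤ gr.filt i :=
  iSup₂_le fun _ hl => gr.comp_le_filt (h.trans hl)

lemma lie_mem_filt {i j : ℤ} {x y : 𝔤} (hx : x ∈ gr.filt i) (hy : y ∈ gr.filt j) :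
    ⁅x, y⁆ ∈ gr.filt (i + j) := by
  have key : ∀ m : ℤ, i ≤ m → ∀ a ∈ gr.comp m, gr.filt j ≤
      (gr.filt (i + j)).comap (LieAlgebra.ad ℝ 𝔤 a) := fun m hm a ha =>
    iSup₂_le fun l hl b hb =>
      gr.comp_le_filt (add_le_add hm hl) (gr.lie_mem m l a b ha hb)
  have key' : gr.filt i ≤
      (gr.filt (i + j)).comap ((LieAlgebra.ad ℝ 𝔤 : 𝔤 →ₗ[ℝ] Module.End ℝ 𝔤).flip y) :=
    iSup₂_le fun m hm a ha => key m hm a ha hy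
  exact key' hx

/-- The parabolic subalgebra `𝔭 = 𝔤⁰` of a `|k|`-grading. -/
def parabolic : LieSubalgebra ℝ 𝔤 :=
  { gr.filt 0 with
    lie_mem' := fun hx hy => gr.filt_anti (by norm_num) (gr.lie_mem_filt hx hy) }

/-- The subalgebra `𝔭₊ = 𝔤¹` of a `|k|`-grading. -/
def pPlus : LieSubalgebra ℝ 𝔤 :=
  { gr.filt 1 with
    lie_mem' := fun hx hy => gr.filt_anti (by norm_num) (gr.lie_mem_filt hx hy) }

/-- No nonzero ideal of `𝔤` is contained in `𝔤₀`. (For semisimple `𝔤` this says that no simple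
ideal is contained in `𝔤₀`.) -/
def IsEffective : Prop := ∀ I : LieIdeal ℝ 𝔤, (∀ x ∈ I, x ∈ gr.comp 0) → I = ⊥

end Grading

/-- The linear map on `Λ²V` that is given on decomposable elements by `v ∧ w ↦ b v w`, for an
alternating bilinear map `b`. -/
def wedgeLift {V W : Type*} [AddCommGroup V] [Module ℝ V] [AddCommGroup W] [Module ℝ W]
    (b : V →ₗ[ℝ] V →ₗ[ℝ] W) (hb : ∀ v, b v v = 0) : ⋀[ℝ]^2 V →ₗ[ℝ] W :=
  exteriorPower.alternatingMapLinearEquiv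
    { toFun := fun v => b (v 0) (v 1)
      map_update_add' := by
        intro _ m i x y
        fin_cases i <;> simp [Function.update]
      map_update_smul' := by
        intro _ m i c x
        fin_cases i <;> simp [Function.update]
      map_eq_zero_of_eq' := by
        intro v i j h hij
        fin_cases i <;> fin_cases j
        · exact absurd rfl hij
        · have h' : v 0 = v 1 := h
          simp [h', hb]
        · have h' : v 1 = v 0 := h
          simp [h', hb]
        · exact absurd rfl hij }

lemma wedgeLift_apply {V W : Type*} [AddCommGroup V] [Module ℝ V] [AddCommGroup W] [Module ℝ W]
    (b : V →ₗ[ℝ] V →ₗ[ℝ] W) (hb : ∀ v, b v v = 0) (v w : V) :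
    wedgeLift b hb (exteriorPower.ιMulti ℝ 2 ![v, w]) = b v w := by
  simp [wedgeLift]

/-- The operator `∂* : Λ²𝔞 ⊗ 𝔤 → 𝔞 ⊗ 𝔤` of the standard complex for the Lie algebra homology of
a subalgebra `𝔞 ⊆ 𝔤` with coefficients in `𝔤`:
`∂*(α ∧ β ⊗ s) = - β ⊗ [α, s] + α ⊗ [β, s] - [α, β] ⊗ s`. -/
def codiff (𝔞 : LieSubalgebra ℝ 𝔤) : (⋀[ℝ]^2 𝔞) ⊗[ℝ] 𝔤 →ₗ[ℝ] 𝔞 ⊗[ℝ] 𝔤 :=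
  TensorProduct.lift <| wedgeLift
    (LinearMap.mk₂ ℝ
      (fun α β : 𝔞 =>
        -(TensorProduct.mk ℝ 𝔞 𝔤 β ∘ₗ (LieAlgebra.ad ℝ 𝔤 (α : 𝔤) : 𝔤 →ₗ[ℝ] 𝔤))
        + TensorProduct.mk ℝ 𝔞 𝔤 α ∘ₗ (LieAlgebra.ad ℝ 𝔤 (β : 𝔤) : 𝔤 →ₗ[ℝ] 𝔤)
        - TensorProduct.mk ℝ 𝔞 𝔤 ⁅α, β⁆)
      (by intros; ext; simp [TensorProduct.tmul_add]; abel)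
      (by intros; ext; simp [TensorProduct.smul_tmul', smul_add, smul_sub])
      (by intros; ext; simp [TensorProduct.tmul_add]; abel)
      (by intros; ext; simp [TensorProduct.smul_tmul', smul_add, smul_sub]))
    (by intro v; ext; simp)

lemma codiff_apply (𝔞 : LieSubalgebra ℝ 𝔤) (α β : 𝔞) (s : 𝔤) :
    codiff 𝔞 (exteriorPower.ιMulti ℝ 2 ![α, β] ⊗ₜ[ℝ] s) =
      - β ⊗ₜ[ℝ] ⁅(α : 𝔤), s⁆ + α ⊗ₜ[ℝ] ⁅(β : 𝔤), s⁆ - ⁅α, β⁆ ⊗ₜ[ℝ] s := by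
  simp [codiff, wedgeLift_apply]

/-- The `𝔤`-valued two-form on `𝔤` determined by an element of `Λ²𝔞 ⊗ 𝔤`, where `α ∈ 𝔞` is viewed
as the linear functional `B(α, ·)` for the Killing form `B` of `𝔤`:
`α ∧ β ⊗ s ↦ ((X, Y) ↦ (B(α, X) B(β, Y) - B(α, Y) B(β, X)) s)`. -/
def toTwoForm (𝔞 : LieSubalgebra ℝ 𝔤) : (⋀[ℝ]^2 𝔞) ⊗[ℝ] 𝔤 →ₗ[ℝ] 𝔤 →ₗ[ℝ] 𝔤 →ₗ[ℝ] 𝔤 :=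
  TensorProduct.lift <| wedgeLift
    (LinearMap.mk₂ ℝ
      (fun α β : 𝔞 =>
        (LinearMap.mk₂ ℝ
          (fun s X : 𝔤 => (LinearMap.toSpanSingleton ℝ 𝔤 s) ∘ₗ
            (killingForm ℝ 𝔤 α X • killingForm ℝ 𝔤 β - killingForm ℝ 𝔤 β X • killingForm ℝ 𝔤 α))
          (by intros; ext; simp)
          (by intros; ext; simp [smul_smul, mul_comm])
          (by intros; ext; simp [← add_smul]; congr 1; ring)
          (by intros; ext; simp [smul_smul]; congr 1; ring) : 𝔤 →ₗ[ℝ] 𝔤 →ₗ[ℝ] 𝔤 →ₗ[ℝ] 𝔤))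
      (by intros; ext; simp [← add_smul]; congr 1; ring)
      (by intros; ext; simp [smul_smul]; congr 1; ring)
      (by intros; ext; simp [← add_smul]; congr 1; ring)
      (by intros; ext; simp [smul_smul]; congr 1; ring))
    (by intro v; ext; simp)

lemma toTwoForm_apply (𝔞 : LieSubalgebra ℝ 𝔤) (α β : 𝔞) (s X Y : 𝔤) :
    toTwoForm 𝔞 (exteriorPower.ιMulti ℝ 2 ![α, β] ⊗ₜ[ℝ] s) X Y =
      (killingForm ℝ 𝔤 α X * killingForm ℝ 𝔤 β Y - killingForm ℝ 𝔤 α Y * killingForm ℝ 𝔤 β X)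
        • s := by
  simp [toTwoForm, wedgeLift_apply]
  congr 1
  ring

end Algebra

section LieGroups

variable {E : Type*} [NormedAddCommGroup E] [NormedSpace ℝ E]
  {G : Type*} [TopologicalSpace G] [ChartedSpace E G] [Group G]

/-- A smooth Lie group has the smoothness which Mathlib requires for its Lie algebra. -/
instance instLieGroupMinSmoothness [LieGroup 𝓘(ℝ, E) ∞ G] :
    LieGroup 𝓘(ℝ, E) (minSmoothness ℝ 3) G :=
  LieGroup.of_le (n := ∞) (by
    rw [minSmoothness_of_isRCLikeNormedField]
    exact ENat.LEInfty.out)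

/-- The adjoint action `Ad(g)`: the derivative at the identity of `x ↦ g x g⁻¹`. -/
def Ad (g : G) : GroupLieAlgebra 𝓘(ℝ, E) G →L[ℝ] GroupLieAlgebra 𝓘(ℝ, E) G :=
  mfderiv 𝓘(ℝ, E) 𝓘(ℝ, E) (fun x : G => g * x * g⁻¹) 1

/-- `P` is the parabolic subgroup of `G` determined by a `|k|`-grading of the Lie algebra of `G`:
it is the normalizer `N_G(𝔭) = {g | Ad(g) 𝔭 = 𝔭}`, and the manifold structure on `P` is its
structure as an embedded submanifold of `G`. -/
structure IsParabolicSubgroup [FiniteDimensional ℝ E] [LieGroup 𝓘(ℝ, E) ∞ G]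
    (gr : Grading (GroupLieAlgebra 𝓘(ℝ, E) G))
    {E' : Type*} [NormedAddCommGroup E'] [NormedSpace ℝ E']
    (P : Subgroup G) [ChartedSpace E' P] : Prop where
  mem_iff : ∀ g : G, g ∈ P ↔
    gr.parabolic.toSubmodule.map (Ad (E := E) g).toLinearMap =
      gr.parabolic.toSubmodule
  isSmoothEmbedding :
    Manifold.IsSmoothEmbedding 𝓘(ℝ, E') 𝓘(ℝ, E) ∞ (Subtype.val : P → G)

end LieGroups

section PrincipalBundles

/-- `p : B → M` is a smooth principal bundle with structure group `H`, for the principal right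
action `act : B → H → B`, `act u h = u · h`. -/
structure IsPrincipalBundle
    {EB : Type*} [NormedAddCommGroup EB] [NormedSpace ℝ EB]
    {EM : Type*} [NormedAddCommGroup EM] [NormedSpace ℝ EM]
    {EH : Type*} [NormedAddCommGroup EH] [NormedSpace ℝ EH]
    {B : Type*} [TopologicalSpace B] [ChartedSpace EB B]
    {M : Type*} [TopologicalSpace M] [ChartedSpace EM M]
    {H : Type*} [TopologicalSpace H] [ChartedSpace EH H] [Group H]
    (act : B → H → B) (p : B → M) : Prop where
  act_one : ∀ u, act u 1 = u
  act_mul : ∀ u a b, act (act u a) b = act u (a * b)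
  smooth_act : ContMDiff (𝓘(ℝ, EB).prod 𝓘(ℝ, EH)) 𝓘(ℝ, EB) ∞ (fun x : B × H => act x.1 x.2)
  proj_act : ∀ u h, p (act u h) = p u
  /-- Equivariant local trivializations `φ : p⁻¹(U) ≅ U × H`. -/
  locally_trivial : ∀ x : M, ∃ (U : Set M) (φ : OpenPartialHomeomorph B (M × H)),
    IsOpen U ∧ x ∈ U ∧ φ.source = p ⁻¹' U ∧ φ.target = U ×ˢ Set.univ ∧
    ContMDiffOn 𝓘(ℝ, EB) (𝓘(ℝ, EM).prod 𝓘(ℝ, EH)) ∞ φ φ.source ∧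
    ContMDiffOn (𝓘(ℝ, EM).prod 𝓘(ℝ, EH)) 𝓘(ℝ, EB) ∞ φ.symm φ.target ∧
    ∀ u ∈ φ.source, (φ u).1 = p u ∧ ∀ h, (φ (act u h)).2 = (φ u).2 * h

/-- The restriction to `Q ≤ P` of a right action of `P`. -/
def restrictAct {B G : Type*} [Group G] {P Q : Subgroup G} (act : B → P → B) (hQP : Q ≤ P) :
    B → Q → B := fun u q => act u (Subgroup.inclusion hQP q)

/-- The correspondence space `B / Q`: the space of orbits in `B` of the subgroup `Q ≤ P`, with the
quotient topology. -/
abbrev CorrespondenceSpace {B G : Type*} [Group G] {P Q : Subgroup G}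
    (act : B → P → B) (hQP : Q ≤ P) : Type _ :=
  Quot (fun u v : B => ∃ q : Q, v = restrictAct act hQP u q)

/-- The natural projection from `B` onto the correspondence space `B / Q`. -/
def toCorrespondenceSpace {B G : Type*} [Group G] {P Q : Subgroup G}
    (act : B → P → B) (hQP : Q ≤ P) : B → CorrespondenceSpace act hQP :=
  Quot.mk _

end PrincipalBundles

section CartanGeometries

variable {EG : Type*} [NormedAddCommGroup EG] [NormedSpace ℝ EG]
  {G : Type*} [TopologicalSpace G] [ChartedSpace EG G] [Group G]
  {EB : Type*} [NormedAddCommGroup EB] [NormedSpace ℝ EB]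
  {B : Type*} [TopologicalSpace B] [ChartedSpace EB B]

variable (EG G EB B) in
/-- `𝔤`-valued one-forms on `B`, as families of linear maps `T_u B → 𝔤`; their smoothness is
required separately. -/
abbrev OneForm : Type _ :=
  ∀ u : B, TangentSpace 𝓘(ℝ, EB) u →L[ℝ] GroupLieAlgebra 𝓘(ℝ, EG) G

/-- `(p : B → M, θ)` is a Cartan geometry of type `(G, H)`. -/
structure IsCartanGeometry
    {EH : Type*} [NormedAddCommGroup EH] [NormedSpace ℝ EH]
    {EM : Type*} [NormedAddCommGroup EM] [NormedSpace ℝ EM]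
    {H : Subgroup G} [ChartedSpace EH H] [IsManifold 𝓘(ℝ, EB) ∞ B]
    {M : Type*} [TopologicalSpace M] [ChartedSpace EM M]
    (act : B → H → B) (p : B → M) (θ : OneForm EG G EB B) : Prop where
  isPrincipalBundle : IsPrincipalBundle (EB := EB) (EM := EM) (EH := EH) act p
  /-- The form `θ` is smooth, as a function on the tangent bundle. -/
  smooth_form : ContMDiff (M' := EG) 𝓘(ℝ, EB).tangent 𝓘(ℝ, EG) ∞
    (fun v : TangentBundle 𝓘(ℝ, EB) B => θ v.1 v.2)
  /-- `(r^h)^* θ = Ad(h)⁻¹ ∘ θ`. -/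
  equivariant : ∀ (h : H) (u : B) (ξ : TangentSpace 𝓘(ℝ, EB) u),
    θ (act u h) (mfderiv 𝓘(ℝ, EB) 𝓘(ℝ, EB) (fun v => act v h) u ξ) = Ad (h : G)⁻¹ (θ u ξ)
  /-- `θ(ζ_A) = A`, where the fundamental vector field `ζ_A` is, at `u`, the image of `A` under the
  derivative at the identity of `h ↦ u · h`, and where `𝔥 = T_1 H` is viewed as a subspace of `𝔤`
  through the derivative of the inclusion `H → G`. -/
  fundamental : ∀ (u : B) (A : TangentSpace 𝓘(ℝ, EH) (1 : H)),
    θ (act u 1) (mfderiv 𝓘(ℝ, EH) 𝓘(ℝ, EB) (fun h : H => act u h) 1 A) =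
      mfderiv 𝓘(ℝ, EH) 𝓘(ℝ, EG) (Subtype.val : H → G) 1 A
  isIso : ∀ u : B, Function.Bijective (θ u)

/-- The derivative `ξ · f` of a `𝔤`-valued function in the direction of a tangent vector `ξ` at
`u`. The Lie algebra `𝔤 = T_1 G` is, as a vector space, the model space `EG` of `G`. -/
def dirDeriv (f : B → GroupLieAlgebra 𝓘(ℝ, EG) G) (u : B) (ξ : TangentSpace 𝓘(ℝ, EB) u) :
    GroupLieAlgebra 𝓘(ℝ, EG) G :=
  mfderiv (M' := EG) 𝓘(ℝ, EB) 𝓘(ℝ, EG) f u ξ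

/-- The exterior derivative `dθ(ξ, η) = ξ · θ(η) - η · θ(ξ) - θ([ξ, η])` of a `𝔤`-valued one-form,
evaluated on vector fields `ξ`, `η`. -/
def extDeriv (θ : OneForm EG G EB B) (ξ η : ∀ u : B, TangentSpace 𝓘(ℝ, EB) u) (u : B) :
    GroupLieAlgebra 𝓘(ℝ, EG) G :=
  dirDeriv (fun v => θ v (η v)) u (ξ u) - dirDeriv (fun v => θ v (ξ v)) u (η u)
    - θ u (VectorField.mlieBracket 𝓘(ℝ, EB) ξ η u)

/-- The curvature `K(ξ, η) = dθ(ξ, η) + [θ(ξ), θ(η)]`, evaluated on vector fields. -/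
def curvature (θ : OneForm EG G EB B) (ξ η : ∀ u : B, TangentSpace 𝓘(ℝ, EB) u) (u : B) :
    GroupLieAlgebra 𝓘(ℝ, EG) G :=
  extDeriv θ ξ η u + ⁅θ u (ξ u), θ u (η u)⁆

/-- The vector field `θ⁻¹(X)` on `B`, for `X ∈ 𝔤`. -/
def constantField (θ : OneForm EG G EB B) (X : GroupLieAlgebra 𝓘(ℝ, EG) G) (u : B) :
    TangentSpace 𝓘(ℝ, EB) u :=
  (θ u).inverse X

/-- The curvature function `κ(u)(X, Y) = K(θ⁻¹(X), θ⁻¹(Y))(u)`. It is the equivariant function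
on `B` which represents the curvature as a two-form on the base with values in the adjoint tractor
bundle `B ×_P 𝔤`. -/
def curvatureFunction (θ : OneForm EG G EB B) (u : B) (X Y : GroupLieAlgebra 𝓘(ℝ, EG) G) :
    GroupLieAlgebra 𝓘(ℝ, EG) G :=
  curvature θ (constantField θ X) (constantField θ Y) u

variable [FiniteDimensional ℝ EG] [LieGroup 𝓘(ℝ, EG) ∞ G]

/-- `(p : B → M, θ)` is a parabolic geometry of type `(G, P)`: a Cartan geometry of this type, where
`P` is the parabolic subgroup determined by a `|k|`-grading of the Lie algebra of `G`. -/
structure IsParabolicGeometry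
    {EP : Type*} [NormedAddCommGroup EP] [NormedSpace ℝ EP]
    {EM : Type*} [NormedAddCommGroup EM] [NormedSpace ℝ EM]
    (gr : Grading (GroupLieAlgebra 𝓘(ℝ, EG) G))
    {P : Subgroup G} [ChartedSpace EP P] [IsManifold 𝓘(ℝ, EB) ∞ B]
    {M : Type*} [TopologicalSpace M] [ChartedSpace EM M]
    (act : B → P → B) (p : B → M) (θ : OneForm EG G EB B) : Prop where
  isParabolicSubgroup : IsParabolicSubgroup (E' := EP) gr P
  isCartanGeometry : IsCartanGeometry (EM := EM) (EH := EP) act p θ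

/-- Normality: `∂*κ = 0`. At each point `u` the value `κ(u)`, a two-form on `𝔤/𝔭` with values
in `𝔤`, is regarded as an element `τ` of `Λ²𝔭₊ ⊗ 𝔤` through the duality between `𝔤/𝔭` and `𝔭₊` given
by the Killing form, and `∂*τ = 0`. (For a parabolic geometry `κ(u)` is horizontal, so for semisimple
`𝔤` the element `τ` exists and is unique.) -/
def IsNormal (gr : Grading (GroupLieAlgebra 𝓘(ℝ, EG) G)) (θ : OneForm EG G EB B) : Prop :=
  ∀ u : B, ∃ τ : (⋀[ℝ]^2 gr.pPlus) ⊗[ℝ] GroupLieAlgebra 𝓘(ℝ, EG) G,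
    (∀ X Y, curvatureFunction θ u X Y = toTwoForm gr.pPlus τ X Y) ∧ codiff gr.pPlus τ = 0

/-- Regularity: `κ(Tⁱ, Tʲ) ⊆ 𝒜ⁱ⁺ʲ⁺¹` for all `i, j < 0`, in terms of the curvature function; here
`Tⁱ` corresponds to `𝔤ⁱ/𝔭` and `𝒜ⁱ` to `𝔤ⁱ`. -/
def IsRegular (gr : Grading (GroupLieAlgebra 𝓘(ℝ, EG) G)) (θ : OneForm EG G EB B) : Prop :=
  ∀ (u : B) (i j : ℤ), i < 0 → j < 0 → ∀ X ∈ gr.filt i, ∀ Y ∈ gr.filt j,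
    curvatureFunction θ u X Y ∈ gr.filt (i + j + 1)

end CartanGeometries

end

end ParabolicGeometry

/-! Normality concerns the curvature function alone and depends on the parabolic only through its
nilradical. An inclusion Q ≤ P forces 𝔮 ⊆ 𝔭 (`IsParabolicSubgroup.filt_zero_le`): for X ∈ 𝔮 the maps
exp(t ad X) are of the form Ad(γ(t)) for small t and preserve 𝔮, so γ(t) ∈ Q ≤ P and exp(t ad X)
preserves 𝔭. Differentiating at t = 0 shows that X normalizes 𝔭, and 𝔭 is its own normalizer because
it contains the grading element. Killing orthogonals reverse the inclusion to 𝔭₊ ⊆ 𝔮₊. Since ∂* is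
natural for inclusions of subalgebras (`codiff_twoFormInclusion`), the tensor that represents κ(u)
over 𝔭₊ also represents it over 𝔮₊ and is still annihilated.

For the geometry on the orbit space, θ(ζ_A) = A makes the orbit maps of Q immersive, and local
triviality over N shows that a group element moving a point slightly is close to 1. The inverse
function theorem then yields slices (`exists_localSlice`). They serve both as charts of the quotient
and as trivializations of the principal Q-bundle. Hausdorffness holds because Q, as a normalizer, is
closed. The axioms for θ restrict from P to Q.

Regularity fails for G = SL(5, ℝ), with P the stabilizer type of blocks 2 + 3 and Q that of blocks 1
+ 1 + 3. Let V be the abelian space of strictly lower block matrices for P. On the trivial bundle V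
× P the flat connection is deformed by replacing v with v + μ₁(x) μ₂(v) z, where μ₁, μ₂ are the
entries (2,1), (3,1) and z is the matrix unit (4,0), indices starting at 0. The curvature is μ₁ ∧ μ₂
⊗ z up to conjugation (`FlatTwist.toMat_curvatureFunction`). It is normal, because the Killing duals
of μ₁ and μ₂ commute with z and with each other, and it is regular because the grading of P has
depth one. For Q, however, both arguments of the two-form lie in degree -1 while z has degree -2,
whereas regularity demands degree at least -1. -/

namespace ParabolicGeometry

noncomputable section

/-! ### Gradings of semisimple Lie algebras: grading element and Killing duality -/

namespace Grading

variable {𝔤 : Type*} [LieRing 𝔤] [LieAlgebra ℝ 𝔤] (gr : Grading 𝔤)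

lemma iSup_comp : ⨆ i, gr.comp i = ⊤ :=
  (DirectSum.isInternal_submodule_iff_iSupIndep_and_iSup_eq_top _).1 gr.isInternal |>.2

/-- The decomposition of `𝔤` as the direct sum of the components of a grading. -/
def decompEquiv : (DirectSum ℤ fun i => gr.comp i) ≃ₗ[ℝ] 𝔤 :=
  LinearEquiv.ofBijective (DirectSum.coeLinearMap gr.comp)
    (show Function.Bijective (DirectSum.coeLinearMap gr.comp) from gr.isInternal)

lemma decompEquiv_apply (a : DirectSum ℤ fun i => gr.comp i) :
    gr.decompEquiv a = DirectSum.coeLinearMap gr.comp a := rfl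

lemma decompEquiv_symm_of_mem {i : ℤ} {x : 𝔤} (hx : x ∈ gr.comp i) :
    gr.decompEquiv.symm x = DirectSum.lof ℝ ℤ (fun i => gr.comp i) i ⟨x, hx⟩ := by
  rw [LinearEquiv.symm_apply_eq, decompEquiv_apply]
  simp [DirectSum.lof_eq_of]

/-- The projection of `𝔤` onto the component `𝔤ᵢ`, as an endomorphism of `𝔤`. -/
def proj (i : ℤ) : 𝔤 →ₗ[ℝ] 𝔤 :=
  (gr.comp i).subtype ∘ₗ DirectSum.component ℝ ℤ (fun i => gr.comp i) i ∘ₗ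
    gr.decompEquiv.symm.toLinearMap

lemma proj_mem (i : ℤ) (x : 𝔤) : gr.proj i x ∈ gr.comp i := by simp [proj]

lemma proj_of_mem {i : ℤ} {x : 𝔤} (hx : x ∈ gr.comp i) : gr.proj i x = x := by
  simp [proj, gr.decompEquiv_symm_of_mem hx, DirectSum.component.lof_self]

lemma proj_of_mem_ne {i j : ℤ} {x : 𝔤} (hx : x ∈ gr.comp i) (h : i ≠ j) : gr.proj j x = 0 := by
  simp [proj, gr.decompEquiv_symm_of_mem hx, DirectSum.component.of, h]

/-- The union of the components spans `𝔤`. -/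
lemma induction_on {p : 𝔤 → Prop} (x : 𝔤) (h : ∀ i, ∀ x ∈ gr.comp i, p x) (h0 : p 0)
    (hadd : ∀ x y, p x → p y → p (x + y)) : p x :=
  Submodule.iSup_induction gr.comp (motive := p) (x := x) (by rw [gr.iSup_comp]; trivial) h h0 hadd

lemma mem_of_proj_mem {S : Submodule ℝ 𝔤} {x : 𝔤} (h : ∀ i, gr.proj i x ∈ S) : x ∈ S := by
  classical
  rw [← gr.decompEquiv.apply_symm_apply x, decompEquiv_apply,
    DirectSum.coeLinearMap_eq_dfinsuppSum, DFinsupp.sum]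
  exact S.sum_mem fun i _ => h i

lemma mem_filt_iff {i : ℤ} {x : 𝔤} : x ∈ gr.filt i ↔ ∀ j < i, gr.proj j x = 0 := by
  constructor
  · intro hx j hj
    have : gr.filt i ≤ LinearMap.ker (gr.proj j) :=
      iSup₂_le fun l hl a ha => gr.proj_of_mem_ne ha (by omega)
    exact this hx
  · intro h
    refine gr.mem_of_proj_mem fun j => ?_
    rcases lt_or_ge j i with hj | hj
    · rw [h j hj]; exact zero_mem _
    · exact gr.comp_le_filt hj (gr.proj_mem j x)

/-- The derivation of `𝔤` which is multiplication by `i` on `𝔤ᵢ`. -/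
def derivation : LieDerivation ℝ 𝔤 𝔤 :=
  let D : 𝔤 →ₗ[ℝ] 𝔤 :=
    DirectSum.toModule ℝ ℤ 𝔤 (fun i => (i : ℝ) • (gr.comp i).subtype) ∘ₗ
      gr.decompEquiv.symm.toLinearMap
  have hD : ∀ i, ∀ x ∈ gr.comp i, D x = (i : ℝ) • x := fun i x hx => by
    simp [D, gr.decompEquiv_symm_of_mem hx]
  { D with
    leibniz' := fun a b => by
      change D ⁅a, b⁆ = ⁅a, D b⁆ - ⁅b, D a⁆
      induction a using gr.induction_on with
      | h i x hx =>
        induction b using gr.induction_on with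
        | h j y hy =>
          rw [hD _ _ hx, hD _ _ hy, hD _ _ (gr.lie_mem _ _ _ _ hx hy), lie_smul, lie_smul,
            ← lie_skew x y]
          push_cast
          module
        | h0 => simp
        | hadd y z hy hz => simp only [lie_add, map_add, hy, hz, add_lie]; abel
      | h0 => simp
      | hadd y z hy hz => simp only [lie_add, map_add, hy, hz, add_lie]; abel }

lemma derivation_apply {i : ℤ} {x : 𝔤} (hx : x ∈ gr.comp i) : gr.derivation x = (i : ℝ) • x := by
  change DirectSum.toModule ℝ ℤ 𝔤 (fun i => (i : ℝ) • (gr.comp i).subtype) (gr.decompEquiv.symm x) = _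
  simp [gr.decompEquiv_symm_of_mem hx]

lemma mem_pPlus {x : 𝔤} : x ∈ gr.pPlus ↔ x ∈ gr.filt 1 := Iff.rfl

lemma proj_lie_gradingElement {E : 𝔤} (hE : ∀ i, ∀ x ∈ gr.comp i, ⁅E, x⁆ = (i : ℝ) • x)
    (j : ℤ) (x : 𝔤) : gr.proj j ⁅E, x⁆ = (j : ℝ) • gr.proj j x := by
  induction x using gr.induction_on with
  | h i x hx =>
    rw [hE i x hx, map_smul]
    by_cases h : i = j
    · rw [h]
    · simp [gr.proj_of_mem_ne hx h]
  | h0 => simp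
  | hadd y z hy hz => simp [hy, hz]

/-- Since [E, E] = 0, each component of E in degree j is annihilated by j, so only degree 0 can
contribute; the negative degrees are all that is needed here. -/
lemma gradingElement_mem {E : 𝔤} (hE : ∀ i, ∀ x ∈ gr.comp i, ⁅E, x⁆ = (i : ℝ) • x) :
    E ∈ gr.filt 0 := by
  rw [mem_filt_iff]
  intro j hj
  have := gr.proj_lie_gradingElement hE j E
  rw [lie_self, map_zero, eq_comm, smul_eq_zero] at this
  exact this.resolve_left (by exact_mod_cast hj.ne)

variable [FiniteDimensional ℝ 𝔤] [LieAlgebra.IsSemisimple ℝ 𝔤]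

/-- The existence of the grading element of a semisimple graded Lie algebra. -/
lemma exists_gradingElement : ∃ E : 𝔤, ∀ i, ∀ x ∈ gr.comp i, ⁅E, x⁆ = (i : ℝ) • x := by
  -- Nondegeneracy of the Killing form makes every derivation inner, in particular the degree
  -- derivation.
  obtain ⟨E, hE⟩ := LieDerivation.IsKilling.exists_eq_ad (R := ℝ) gr.derivation
  refine ⟨E, fun i x hx => ?_⟩
  rw [← gr.derivation_apply hx, ← hE, LieDerivation.ad_apply_apply]

/-- A parabolic subalgebra is self-normalizing. -/
lemma mem_filt_zero_of_lie_mem {x : 𝔤} (h : ∀ y ∈ gr.filt 0, ⁅x, y⁆ ∈ gr.filt 0) :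
    x ∈ gr.filt 0 := by
  obtain ⟨E, hE⟩ := gr.exists_gradingElement
  -- The hypothesis is needed only for y = E: ad E multiplies the component of degree j by j, and j
  -- is nonzero for the components to be excluded.
  have h1 : ⁅E, x⁆ ∈ gr.filt 0 := by
    rw [← lie_skew]; exact neg_mem (h E (gr.gradingElement_mem hE))
  rw [mem_filt_iff] at h1 ⊢
  intro j hj
  have := h1 j hj
  rw [gr.proj_lie_gradingElement hE, smul_eq_zero] at this
  exact this.resolve_left (by exact_mod_cast hj.ne)

/-- Invariance of the form under the grading element gives (i + j) B(x, y) = 0. -/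
lemma killingForm_eq_zero {i j : ℤ} {x y : 𝔤} (hx : x ∈ gr.comp i) (hy : y ∈ gr.comp j)
    (h : i + j ≠ 0) : killingForm ℝ 𝔤 x y = 0 := by
  obtain ⟨E, hE⟩ := gr.exists_gradingElement
  have := LieModule.traceForm_apply_lie_apply ℝ 𝔤 𝔤 x E y
  rw [hE j y hy, ← lie_skew, hE i x hx, map_smul, map_neg, LinearMap.neg_apply, map_smul,
    LinearMap.smul_apply, smul_eq_mul, smul_eq_mul] at this
  have h2 : ((i + j : ℤ) : ℝ) * killingForm ℝ 𝔤 x y = 0 := by push_cast; linarith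
  exact (mul_eq_zero.1 h2).resolve_left (by exact_mod_cast h)

lemma killingForm_proj {j : ℤ} (x : 𝔤) {y : 𝔤} (hy : y ∈ gr.comp (-j)) :
    killingForm ℝ 𝔤 (gr.proj j x) y = killingForm ℝ 𝔤 x y := by
  induction x using gr.induction_on with
  | h i x hx =>
    by_cases h : i = j
    · subst h; rw [gr.proj_of_mem hx]
    · rw [gr.proj_of_mem_ne hx h, gr.killingForm_eq_zero hx hy (by omega)]; simp
  | h0 => simp
  | hadd y z hy hz => simp [hy, hz]

/-- The annihilator of `𝔭` with respect to the Killing form is `𝔭₊`. -/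
lemma mem_filt_one_iff {x : 𝔤} :
    x ∈ gr.filt 1 ↔ ∀ y ∈ gr.filt 0, killingForm ℝ 𝔤 x y = 0 := by
  constructor
  · intro hx y hy
    have key : ∀ m : ℤ, 1 ≤ m → ∀ a ∈ gr.comp m, gr.filt 0 ≤ LinearMap.ker (killingForm ℝ 𝔤 a) :=
      fun m hm a ha => iSup₂_le fun l hl b hb => gr.killingForm_eq_zero ha hb (by omega)
    have key' : gr.filt 1 ≤ LinearMap.ker ((killingForm ℝ 𝔤).flip y) :=
      iSup₂_le fun m hm a ha => key m hm a ha hy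
    exact key' hx
  · intro h
    rw [mem_filt_iff]
    intro j hj
    -- A component of degree j ≤ 0 can only pair with degree -j ≥ 0, which lies in 𝔭; the hypothesis
    -- thus makes it orthogonal to all of 𝔤.
    refine (LieAlgebra.IsKilling.killingForm_nondegenerate ℝ 𝔤).1 _ fun y => ?_
    induction y using gr.induction_on with
    | h i y hy =>
      by_cases hij : i = -j
      · subst hij
        rw [gr.killingForm_proj x hy]
        exact h y (gr.comp_le_filt (by omega) hy)
      · exact gr.killingForm_eq_zero (gr.proj_mem j x) hy (by omega)
    | h0 => simp
    | hadd y z hy hz => simp [hy, hz]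

/-- Nilradicals are the Killing orthogonals of the parabolics, and orthogonals reverse inclusions.
-/
lemma pPlus_le_pPlus {gr gr' : Grading 𝔤} (h : gr'.filt 0 ≤ gr.filt 0) : gr.pPlus ≤ gr'.pPlus := by
  intro x hx
  rw [mem_pPlus, mem_filt_one_iff] at hx ⊢
  exact fun y hy => hx y (h hy)

end Grading

/-! ### Naturality of the codifferential in the subalgebra -/

section Naturality

variable {𝔤 : Type*} [LieRing 𝔤] [LieAlgebra ℝ 𝔤] {𝔞 𝔟 : LieSubalgebra ℝ 𝔤} (h : 𝔞 ≤ 𝔟)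

/-- The map `Λ²𝔞 ⊗ 𝔤 → Λ²𝔟 ⊗ 𝔤` induced by an inclusion `𝔞 ≤ 𝔟` of subalgebras. -/
def twoFormInclusion : (⋀[ℝ]^2 𝔞) ⊗[ℝ] 𝔤 →ₗ[ℝ] (⋀[ℝ]^2 𝔟) ⊗[ℝ] 𝔤 :=
  TensorProduct.map (exteriorPower.map 2 (Submodule.inclusion h)) LinearMap.id

/-- Decomposable elements span, so the naturality statements reduce to the explicit formulas for
`codiff` and `toTwoForm`. -/
lemma wedge_tensor_ext {V W U : Type*} [AddCommGroup V] [Module ℝ V] [AddCommGroup W] [Module ℝ W]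
    [AddCommGroup U] [Module ℝ U] {f g : (⋀[ℝ]^2 V) ⊗[ℝ] W →ₗ[ℝ] U}
    (hfg : ∀ (α β : V) (s : W), f (exteriorPower.ιMulti ℝ 2 ![α, β] ⊗ₜ s) =
      g (exteriorPower.ιMulti ℝ 2 ![α, β] ⊗ₜ s)) : f = g := by
  apply TensorProduct.ext
  apply exteriorPower.linearMap_ext
  ext v s
  have := hfg (v 0) (v 1) s
  rwa [show ![v 0, v 1] = v from by ext i; fin_cases i <;> rfl] at this

lemma twoFormInclusion_apply (α β : 𝔞) (s : 𝔤) :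
    twoFormInclusion h (exteriorPower.ιMulti ℝ 2 ![α, β] ⊗ₜ s) =
      exteriorPower.ιMulti ℝ 2 ![Submodule.inclusion h α, Submodule.inclusion h β] ⊗ₜ s := by
  simp only [twoFormInclusion, TensorProduct.map_tmul, exteriorPower.map_apply_ιMulti,
    LinearMap.id_apply]
  congr 2
  ext i; fin_cases i <;> rfl

/-- The functional B(α, ·) uses the Killing form of 𝔤, so it does not depend on the subalgebra in
which α is regarded. -/
lemma toTwoForm_twoFormInclusion (τ : (⋀[ℝ]^2 𝔞) ⊗[ℝ] 𝔤) :
    toTwoForm 𝔟 (twoFormInclusion h τ) = toTwoForm 𝔞 τ := by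
  suffices toTwoForm 𝔟 ∘ₗ twoFormInclusion h = toTwoForm 𝔞 from LinearMap.congr_fun this τ
  refine wedge_tensor_ext fun α β s => ?_
  ext X Y
  rw [LinearMap.comp_apply, twoFormInclusion_apply, toTwoForm_apply, toTwoForm_apply]
  rfl

/-- Every bracket in the formula for ∂* is a bracket of 𝔤, and a subalgebra inherits it. -/
lemma codiff_twoFormInclusion (τ : (⋀[ℝ]^2 𝔞) ⊗[ℝ] 𝔤) :
    codiff 𝔟 (twoFormInclusion h τ) =
      TensorProduct.map (Submodule.inclusion h) LinearMap.id (codiff 𝔞 τ) := by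
  suffices codiff 𝔟 ∘ₗ twoFormInclusion h =
    TensorProduct.map (Submodule.inclusion h) LinearMap.id ∘ₗ codiff 𝔞 from
    LinearMap.congr_fun this τ
  refine wedge_tensor_ext fun α β s => ?_
  rw [LinearMap.comp_apply, LinearMap.comp_apply, twoFormInclusion_apply, codiff_apply,
    codiff_apply]
  simp only [map_sub, map_add, map_neg, TensorProduct.map_tmul,
    LinearMap.id_apply]
  rfl

end Naturality

/-! ### Normality and enlargement of the nilradical -/

section Normality

variable {EG : Type*} [NormedAddCommGroup EG] [NormedSpace ℝ EG]
  {G : Type*} [TopologicalSpace G] [ChartedSpace EG G] [Group G]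
  {EB : Type*} [NormedAddCommGroup EB] [NormedSpace ℝ EB]
  {B : Type*} [TopologicalSpace B] [ChartedSpace EB B]
  [FiniteDimensional ℝ EG] [LieGroup 𝓘(ℝ, EG) ∞ G]

/-- The witness over the larger nilradical is the image of the given one: it represents the same
two-form, and its codifferential is the image of zero. -/
lemma IsNormal.of_pPlus_le {gr gr' : Grading (GroupLieAlgebra 𝓘(ℝ, EG) G)}
    {θ : OneForm EG G EB B} (hn : IsNormal gr θ) (h : gr.pPlus ≤ gr'.pPlus) : IsNormal gr' θ := by
  intro u
  obtain ⟨τ, hτ, hτ'⟩ := hn u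
  refine ⟨twoFormInclusion h τ, fun X Y => ?_, ?_⟩
  · rw [toTwoForm_twoFormInclusion, hτ]
  · rw [codiff_twoFormInclusion, hτ', map_zero]

end Normality

/-! ### The bracket of vector fields as a commutator of derivations -/

section BracketOnFunctions

open VectorField Filter
open scoped Topology

variable {E : Type*} [NormedAddCommGroup E] [NormedSpace ℝ E]
  {M : Type*} [TopologicalSpace M] [ChartedSpace E M] [IsManifold 𝓘(ℝ, E) ∞ M]
  {F : Type*} [NormedAddCommGroup F] [NormedSpace ℝ F]

/-- The derivative of a vector valued function on a manifold. -/
def mfd (f : M → F) (x : M) : TangentSpace 𝓘(ℝ, E) x →L[ℝ] F :=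
  mfderiv (M' := F) 𝓘(ℝ, E) 𝓘(ℝ, F) f x

/-- A vector field on `M` in the preferred chart at `x`. -/
def inChart (x : M) (V : ∀ y : M, TangentSpace 𝓘(ℝ, E) y) (e : E) : E :=
  mpullbackWithin 𝓘(ℝ, E) 𝓘(ℝ, E) (extChartAt 𝓘(ℝ, E) x).symm V (Set.range 𝓘(ℝ, E)) e

/-- Chain rule along the inverse chart: `inChart` applies the inverse of its differential, and the
chain rule applies the differential itself. -/
lemma mfd_eq_fderiv_comp {f : M → F} {x p : M} (hp : p ∈ (extChartAt 𝓘(ℝ, E) x).source)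
    (hf : MDifferentiableAt 𝓘(ℝ, E) 𝓘(ℝ, F) f p) (V : ∀ y : M, TangentSpace 𝓘(ℝ, E) y) :
    mfd f p (V p) = fderiv ℝ (f ∘ (extChartAt 𝓘(ℝ, E) x).symm) (extChartAt 𝓘(ℝ, E) x p)
      (inChart x V (extChartAt 𝓘(ℝ, E) x p)) := by
  set φ := extChartAt 𝓘(ℝ, E) x with hφ
  have h1 := isInvertible_mfderivWithin_extChartAt_symm (I := 𝓘(ℝ, E)) (φ.map_source hp)
  have h2 : MDifferentiableWithinAt 𝓘(ℝ, E) 𝓘(ℝ, E) φ.symm (Set.range 𝓘(ℝ, E)) (φ p) :=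
    mdifferentiableWithinAt_extChartAt_symm (φ.map_source hp)
  have hpp : φ.symm (φ p) = p := φ.left_inv hp
  have h3 : MDifferentiableAt 𝓘(ℝ, E) 𝓘(ℝ, F) f (φ.symm (φ p)) := by rwa [hpp]
  rw [← mfderiv_eq_fderiv]
  have h4 : mfderiv 𝓘(ℝ, E) 𝓘(ℝ, F) (f ∘ φ.symm) (φ p) =
      (mfderiv 𝓘(ℝ, E) 𝓘(ℝ, F) f (φ.symm (φ p))).comp
        (mfderivWithin 𝓘(ℝ, E) 𝓘(ℝ, E) φ.symm (Set.range 𝓘(ℝ, E)) (φ p)) := by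
    rw [ModelWithCorners.range_eq_univ, mfderivWithin_univ]
    rw [ModelWithCorners.range_eq_univ, mdifferentiableWithinAt_univ] at h2
    exact mfderiv_comp (φ p) h3 h2
  rw [h4]
  simp only [inChart, mpullbackWithin_apply]
  change _ = (mfderiv 𝓘(ℝ, E) 𝓘(ℝ, F) f (φ.symm (φ p))) ((mfderivWithin 𝓘(ℝ, E) 𝓘(ℝ, E) φ.symm (Set.range 𝓘(ℝ, E)) (φ p)) ((mfderivWithin 𝓘(ℝ, E) 𝓘(ℝ, E) φ.symm (Set.range 𝓘(ℝ, E)) (φ p)).inverse (V (φ.symm (φ p)))))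
  rw [ContinuousLinearMap.IsInvertible.self_apply_inverse h1, hpp]
  rfl

lemma inChart_self (x : M) (V : ∀ y : M, TangentSpace 𝓘(ℝ, E) y) :
    inChart x V (extChartAt 𝓘(ℝ, E) x x) = V x := by
  simp only [inChart, mpullbackWithin_apply]
  rw [mfderivWithin_range_extChartAt_symm, extChartAt_to_inv]
  exact congrArg (fun L : E →L[ℝ] E => L (V x)) ContinuousLinearMap.inverse_id

lemma mfd_eq_fderiv {f : M → F} {x : M} (hf : MDifferentiableAt 𝓘(ℝ, E) 𝓘(ℝ, F) f x)
    (v : TangentSpace 𝓘(ℝ, E) x) :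
    mfd f x v = fderiv ℝ (f ∘ (extChartAt 𝓘(ℝ, E) x).symm) (extChartAt 𝓘(ℝ, E) x x) v := by
  let V : ∀ y : M, TangentSpace 𝓘(ℝ, E) y := fun _ => (v : E)
  have := mfd_eq_fderiv_comp (mem_extChartAt_source x) hf V
  rwa [inChart_self x V] at this

lemma mfd_extChartAt_self (x : M) (v : TangentSpace 𝓘(ℝ, E) x) :
    mfd (extChartAt 𝓘(ℝ, E) x) x v = v := by
  rw [mfd, mfderiv_extChartAt_self]
  rfl

lemma differentiableAt_inChart [CompleteSpace E] {x : M} {V : ∀ y : M, TangentSpace 𝓘(ℝ, E) y}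
    (hV : MDifferentiableAt 𝓘(ℝ, E) 𝓘(ℝ, E).tangent
      (fun y => (V y : TangentBundle 𝓘(ℝ, E) M)) x) :
    DifferentiableAt ℝ (inChart x V) (extChartAt 𝓘(ℝ, E) x x) := by
  have : IsManifold 𝓘(ℝ, E) 2 M := .of_le (n := ∞) ENat.LEInfty.out
  have h : DifferentiableWithinAt ℝ (inChart x V)
      ((extChartAt 𝓘(ℝ, E) x).symm ⁻¹' Set.univ ∩ Set.range 𝓘(ℝ, E)) (extChartAt 𝓘(ℝ, E) x x) :=
    (mdifferentiableWithinAt_univ.2 hV).differentiableWithinAt_mpullbackWithin_vectorField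
  rwa [Set.preimage_univ, ModelWithCorners.range_eq_univ, Set.inter_univ,
    differentiableWithinAt_univ] at h

lemma mlieBracket_eq_lieBracket (V W : ∀ y : M, TangentSpace 𝓘(ℝ, E) y) (x : M) :
    mlieBracket 𝓘(ℝ, E) V W x =
      lieBracket ℝ (inChart x V) (inChart x W) (extChartAt 𝓘(ℝ, E) x x) := by
  rw [← mlieBracketWithin_univ, mlieBracketWithin_apply, mfderiv_extChartAt_self]
  have h : lieBracketWithin ℝ (inChart x V) (inChart x W)
      ((extChartAt 𝓘(ℝ, E) x).symm ⁻¹' Set.univ ∩ Set.range 𝓘(ℝ, E)) (extChartAt 𝓘(ℝ, E) x x) =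
      lieBracket ℝ (inChart x V) (inChart x W) (extChartAt 𝓘(ℝ, E) x x) := by
    rw [Set.preimage_univ, ModelWithCorners.range_eq_univ, Set.inter_univ, lieBracketWithin_univ]
  rw [← h]
  exact congrArg (fun L : E →L[ℝ] E => L (lieBracketWithin ℝ (inChart x V) (inChart x W)
    ((extChartAt 𝓘(ℝ, E) x).symm ⁻¹' Set.univ ∩ Set.range 𝓘(ℝ, E)) (extChartAt 𝓘(ℝ, E) x x))) ContinuousLinearMap.inverse_id

/-- A vector field acts on functions, and the bracket of vector fields acts as the commutator:
`[V, W] f = V (W f) - W (V f)`. -/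
theorem mfd_mlieBracket [CompleteSpace E] {f : M → F} {V W : ∀ y : M, TangentSpace 𝓘(ℝ, E) y} {x : M}
    (hf : ContMDiffAt 𝓘(ℝ, E) 𝓘(ℝ, F) 2 f x)
    (hV : MDifferentiableAt 𝓘(ℝ, E) 𝓘(ℝ, E).tangent
      (fun y => (V y : TangentBundle 𝓘(ℝ, E) M)) x)
    (hW : MDifferentiableAt 𝓘(ℝ, E) 𝓘(ℝ, E).tangent
      (fun y => (W y : TangentBundle 𝓘(ℝ, E) M)) x) :
    mfd f x (mlieBracket 𝓘(ℝ, E) V W x) =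
      mfd (fun y => mfd f y (W y)) x (V x) - mfd (fun y => mfd f y (V y)) x (W x) := by
  have : IsManifold 𝓘(ℝ, E) 2 M := .of_le (n := ∞) ENat.LEInfty.out
  set φ := extChartAt 𝓘(ℝ, E) x with hφ
  set g : E → F := f ∘ φ.symm with hg
  have hgc : ContDiffAt ℝ 2 g (φ x) := by
    rw [← contMDiffAt_iff_contDiffAt]
    have h1 : ContMDiffAt 𝓘(ℝ, E) 𝓘(ℝ, E) 2 φ.symm (φ x) :=
      (contMDiffOn_extChartAt_symm x).contMDiffAt (extChartAt_target_mem_nhds x)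
    refine ContMDiffAt.comp (φ x) ?_ h1
    rwa [hφ, extChartAt_to_inv]
  have hev : ∀ᶠ p in 𝓝 x, p ∈ φ.source ∧ MDifferentiableAt 𝓘(ℝ, E) 𝓘(ℝ, F) f p := by
    refine Filter.Eventually.and (extChartAt_source_mem_nhds x) ?_
    filter_upwards [(contMDiffAt_iff_contMDiffAt_nhds (by simp)).1 hf] with p hp using hp.mdifferentiableAt (by simp)
  have hDg : DifferentiableAt ℝ (fderiv ℝ g) (φ x) :=
    (hgc.fderiv_right (m := 1) le_rfl).differentiableAt one_ne_zero
  -- the functions `V f`, in the chart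
  have key : ∀ U : ∀ y : M, TangentSpace 𝓘(ℝ, E) y,
      MDifferentiableAt 𝓘(ℝ, E) 𝓘(ℝ, E).tangent (fun y => (U y : TangentBundle 𝓘(ℝ, E) M)) x →
      ∀ v : TangentSpace 𝓘(ℝ, E) x, mfd (fun y => mfd f y (U y)) x v =
        fderiv ℝ (fderiv ℝ g) (φ x) v (U x) + fderiv ℝ g (φ x) (fderiv ℝ (inChart x U) (φ x) v) := by
    intro U hU v
    have hUd := differentiableAt_inChart hU
    have e1 : (fun y => mfd f y (U y)) =ᶠ[𝓝 x] (fun e => fderiv ℝ g e (inChart x U e)) ∘ φ := by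
      filter_upwards [hev] with p hp using mfd_eq_fderiv_comp hp.1 hp.2 U
    have hd : HasFDerivAt (fun e => fderiv ℝ g e (inChart x U e)) _ (φ x) :=
      hDg.hasFDerivAt.clm_apply hUd.hasFDerivAt
    have hφd : HasMFDerivAt 𝓘(ℝ, E) 𝓘(ℝ, E) φ x (ContinuousLinearMap.id ℝ E) := by
      have := (mdifferentiableAt_extChartAt (I := 𝓘(ℝ, E)) (mem_chart_source E x)).hasMFDerivAt
      rwa [mfderiv_extChartAt_self] at this
    have hcomp := (HasMFDerivAt.comp x hd.hasMFDerivAt hφd).congr_of_eventuallyEq e1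
    rw [mfd, hcomp.mfderiv]
    have : inChart x U (φ x) = U x := inChart_self x U
    rw [← this]
    exact add_comm _ _
  -- In the difference of the two iterated derivatives the Hessian of g cancels by symmetry. What
  -- survives is the first derivative of g on the bracket in the chart.
  rw [key V hV, key W hW, mfd_eq_fderiv (hf.mdifferentiableAt two_ne_zero), mlieBracket_eq_lieBracket, lieBracket, inChart_self, inChart_self,
    map_sub, (hgc.isSymmSndFDerivAt (by simp)).eq (V x) (W x)]
  abel

end BracketOnFunctions

/-! ### The adjoint action of a Lie group and its differential -/

section AdjointAction

open VectorField Filter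
open scoped Topology

variable {E : Type*} [NormedAddCommGroup E] [NormedSpace ℝ E]
  {G : Type*} [TopologicalSpace G] [ChartedSpace E G] [Group G]

variable (E) in
/-- The adjoint action, on the model space of the group. -/
def AdE (g : G) : E →L[ℝ] E := Ad (E := E) g

variable (E G) in
/-- The multiplication of a Lie group in the preferred chart at the identity. -/
def chartMul (z : E × E) : E :=
  extChartAt 𝓘(ℝ, E) (1 : G)
    ((extChartAt 𝓘(ℝ, E) (1 : G)).symm z.1 * (extChartAt 𝓘(ℝ, E) (1 : G)).symm z.2)

lemma AdE_one : AdE E (1 : G) = ContinuousLinearMap.id ℝ E := by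
  have : (fun x : G => 1 * x * (1 : G)⁻¹) = id := by ext; simp
  rw [AdE, Ad, this]
  exact mfderiv_id

lemma chartMul_symm_apply {x : E} (hx : x ∈ (extChartAt 𝓘(ℝ, E) (1 : G)).target) :
    chartMul E G (x, extChartAt 𝓘(ℝ, E) (1 : G) 1) = x := by
  simp only [chartMul, extChartAt_to_inv, mul_one]
  exact (extChartAt 𝓘(ℝ, E) (1 : G)).right_inv hx

lemma mulInvariantVectorField_one (v : GroupLieAlgebra 𝓘(ℝ, E) G) :
    mulInvariantVectorField v (1 : G) = v := by
  have : (fun x : G => 1 * x) = id := by ext; simp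
  rw [mulInvariantVectorField, this, mfderiv_id]
  rfl

variable [LieGroup 𝓘(ℝ, E) ∞ G]

lemma contMDiff_conj (g : G) : ContMDiff 𝓘(ℝ, E) 𝓘(ℝ, E) ∞ (fun x : G => g * x * g⁻¹) :=
  contMDiff_mul_right.comp contMDiff_mul_left

lemma AdE_mul (g h : G) : AdE E (g * h) = (AdE E g).comp (AdE E h) := by
  have e : (fun x : G => g * h * x * (g * h)⁻¹) = (fun x => g * x * g⁻¹) ∘ fun x => h * x * h⁻¹ := by
    ext; simp [mul_assoc]
  have h1 := mfderiv_comp (1 : G)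
    (((contMDiff_conj (E := E) g).contMDiffAt (x := h * 1 * h⁻¹)).mdifferentiableAt (by simp))
    ((contMDiff_conj (E := E) h).contMDiffAt.mdifferentiableAt (by simp))
  rw [← e] at h1
  have h2 : ∀ p : G, p = 1 →
      (mfderiv 𝓘(ℝ, E) 𝓘(ℝ, E) (fun x : G => g * x * g⁻¹) p : E →L[ℝ] E) = AdE E g := by
    rintro p rfl; rfl
  have h3 := h2 (h * 1 * h⁻¹) (by simp)
  rw [← h3]
  exact h1

lemma AdE_inv_comp (g : G) : (AdE E g⁻¹).comp (AdE E g) = ContinuousLinearMap.id ℝ E := by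
  rw [← AdE_mul, inv_mul_cancel, AdE_one]

lemma AdE_apply_eq_fderiv (g : G) (v : E) :
    AdE E g v = fderiv ℝ (fun y => extChartAt 𝓘(ℝ, E) (1 : G)
      (g * (extChartAt 𝓘(ℝ, E) (1 : G)).symm y * g⁻¹)) (extChartAt 𝓘(ℝ, E) (1 : G) 1) v := by
  set φ := extChartAt 𝓘(ℝ, E) (1 : G)
  have hc : ∀ p : G, p = 1 → MDifferentiableAt 𝓘(ℝ, E) 𝓘(ℝ, E) φ p := by
    rintro p rfl; exact mdifferentiableAt_extChartAt (mem_chart_source E (1 : G))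
  have hg : MDifferentiableAt 𝓘(ℝ, E) 𝓘(ℝ, E) (fun x : G => g * x * g⁻¹) 1 :=
    (contMDiff_conj g).contMDiffAt.mdifferentiableAt (by simp)
  have h1 := mfd_eq_fderiv (F := E) ((hc (g * 1 * g⁻¹) (by simp)).comp (1 : G) hg) v
  have h2 : mfd (φ ∘ fun x : G => g * x * g⁻¹) 1 v = AdE E g v := by
    have h3 := mfderiv_comp (1 : G) (hc (g * 1 * g⁻¹) (by simp)) hg
    have h4 : ∀ p : G, p = 1 → ∀ w : E, mfd φ p w = w := by
      rintro p rfl w; exact mfd_extChartAt_self _ _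
    rw [mfd, h3]
    exact h4 _ (by simp) (AdE E g v)
  rw [← h2, h1]
  rfl

lemma contDiffAt_chartMul :
    ContDiffAt ℝ ∞ (chartMul E G)
      (extChartAt 𝓘(ℝ, E) (1 : G) 1, extChartAt 𝓘(ℝ, E) (1 : G) 1) := by
  rw [← contMDiffAt_iff_contDiffAt]
  have hs : ContMDiffAt 𝓘(ℝ, E) 𝓘(ℝ, E) ∞ (extChartAt 𝓘(ℝ, E) (1 : G)).symm
      (extChartAt 𝓘(ℝ, E) (1 : G) 1) :=
    (contMDiffOn_extChartAt_symm _).contMDiffAt (extChartAt_target_mem_nhds _)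
  have h1 : ContMDiffAt 𝓘(ℝ, E × E) 𝓘(ℝ, E) ∞
      (fun z : E × E => (extChartAt 𝓘(ℝ, E) (1 : G)).symm z.1)
      (extChartAt 𝓘(ℝ, E) (1 : G) 1, extChartAt 𝓘(ℝ, E) (1 : G) 1) :=
    hs.comp (extChartAt 𝓘(ℝ, E) (1 : G) 1, extChartAt 𝓘(ℝ, E) (1 : G) 1) contDiff_fst.contMDiff.contMDiffAt
  have h2 : ContMDiffAt 𝓘(ℝ, E × E) 𝓘(ℝ, E) ∞
      (fun z : E × E => (extChartAt 𝓘(ℝ, E) (1 : G)).symm z.2)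
      (extChartAt 𝓘(ℝ, E) (1 : G) 1, extChartAt 𝓘(ℝ, E) (1 : G) 1) :=
    hs.comp (extChartAt 𝓘(ℝ, E) (1 : G) 1, extChartAt 𝓘(ℝ, E) (1 : G) 1) contDiff_snd.contMDiff.contMDiffAt
  refine ContMDiffAt.comp (I' := 𝓘(ℝ, E)) (g := extChartAt 𝓘(ℝ, E) (1 : G)) _ ?_ (h1.mul h2)
  simp only [extChartAt_to_inv, mul_one]
  exact contMDiffAt_extChartAt

/-- The differentiability of the multiplication in the chart, close to the base point. -/
lemma eventually_contDiffAt_chartMul :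
    ∀ᶠ z in 𝓝 (extChartAt 𝓘(ℝ, E) (1 : G) 1, extChartAt 𝓘(ℝ, E) (1 : G) 1),
      DifferentiableAt ℝ (chartMul E G) z := by
  have h : ContDiffAt ℝ 1 (chartMul E G)
      (extChartAt 𝓘(ℝ, E) (1 : G) 1, extChartAt 𝓘(ℝ, E) (1 : G) 1) :=
    contDiffAt_chartMul.of_le (by simp)
  filter_upwards [h.eventually (by simp)] with z hz using hz.differentiableAt one_ne_zero

/-- Left translation by g is, in the chart, the map y ↦ `chartMul` (x, y). Invariant fields are
therefore partial derivatives of the multiplication in its second variable. -/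
lemma mfd_mulInvariantVectorField (v : E) :
    (fun g : G => mfd (extChartAt 𝓘(ℝ, E) (1 : G)) g (mulInvariantVectorField
      (v : GroupLieAlgebra 𝓘(ℝ, E) G) g)) =ᶠ[𝓝 1]
      (fun x => fderiv ℝ (chartMul E G) (x, extChartAt 𝓘(ℝ, E) (1 : G) 1) (0, v)) ∘
        extChartAt 𝓘(ℝ, E) (1 : G) := by
  set φ := extChartAt 𝓘(ℝ, E) (1 : G) with hφ
  have hev : ∀ᶠ g in 𝓝 (1 : G), DifferentiableAt ℝ (chartMul E G) (φ g, φ 1) := by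
    have h1 : Tendsto (fun g : G => (φ g, φ 1)) (𝓝 1) (𝓝 (φ 1, φ 1)) :=
      ((continuousAt_extChartAt (I := 𝓘(ℝ, E)) (1 : G)).prodMk continuousAt_const)
    exact h1.eventually eventually_contDiffAt_chartMul
  filter_upwards [hev, extChartAt_source_mem_nhds (I := 𝓘(ℝ, E)) (1 : G)] with g hg hgs
  have hc : ∀ p : G, p = g → MDifferentiableAt 𝓘(ℝ, E) 𝓘(ℝ, E) φ p := by
    rintro p rfl
    exact mdifferentiableAt_extChartAt (by rwa [extChartAt_source] at hgs)
  have hm : MDifferentiableAt 𝓘(ℝ, E) 𝓘(ℝ, E) (fun x : G => g * x) 1 :=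
    contMDiff_mul_left.contMDiffAt.mdifferentiableAt (n := ∞) (by simp)
  have h1 := mfd_eq_fderiv (F := E) ((hc (g * 1) (by simp)).comp (1 : G) hm) v
  have h2 : mfd (φ ∘ fun x : G => g * x) 1 v = mfd φ g (mulInvariantVectorField
      (v : GroupLieAlgebra 𝓘(ℝ, E) G) g) := by
    have h3 := mfderiv_comp (1 : G) (hc (g * 1) (by simp)) hm
    have h4 : ∀ p : G, p = g → ∀ w : E, mfd φ p w = mfd φ g w := by
      rintro p rfl w; rfl
    rw [mfd, h3]
    exact h4 _ (by simp) _
  rw [← h2, h1]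
  have h5 : (φ ∘ fun x : G => g * x) ∘ φ.symm = chartMul E G ∘ fun y => (φ g, y) := by
    ext y
    simp only [Function.comp_apply, chartMul, ← hφ, φ.left_inv hgs]
  have h6 : HasFDerivAt (fun y : E => (φ g, y)) (ContinuousLinearMap.inr ℝ E E) (φ 1) :=
    hasFDerivAt_prodMk_right (φ g) (φ 1)
  rw [h5, fderiv_comp _ hg h6.differentiableAt, h6.fderiv]
  simp [hφ]

/-- The relation between left and right translations and the adjoint action, in the chart. -/
lemma eventually_comp_AdE :
    ∀ᶠ x in 𝓝 (extChartAt 𝓘(ℝ, E) (1 : G) 1),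
      ((fderiv ℝ (chartMul E G) (extChartAt 𝓘(ℝ, E) (1 : G) 1, x)).comp
        (ContinuousLinearMap.inl ℝ E E)).comp (AdE E ((extChartAt 𝓘(ℝ, E) (1 : G)).symm x)) =
      (fderiv ℝ (chartMul E G) (x, extChartAt 𝓘(ℝ, E) (1 : G) 1)).comp
        (ContinuousLinearMap.inr ℝ E E) := by
  set φ := extChartAt 𝓘(ℝ, E) (1 : G) with hφ
  have h1 : Tendsto (fun x : E => (x, φ 1)) (𝓝 (φ 1)) (𝓝 (φ 1, φ 1)) :=
    (continuous_id.prodMk continuous_const).continuousAt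
  have h2 : Tendsto (fun x : E => (φ 1, x)) (𝓝 (φ 1)) (𝓝 (φ 1, φ 1)) :=
    (continuous_const.prodMk continuous_id).continuousAt
  filter_upwards [h1.eventually (eventually_contDiffAt_chartMul (G := G)),
    h2.eventually (eventually_contDiffAt_chartMul (G := G)),
    extChartAt_target_mem_nhds (I := 𝓘(ℝ, E)) (1 : G)] with x hx1 hx2 hx3
  set g := φ.symm x with hg
  set C : E → E := fun y => φ (g * φ.symm y * g⁻¹) with hC
  have hsymm : ContMDiffAt 𝓘(ℝ, E) 𝓘(ℝ, E) ∞ φ.symm (φ 1) :=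
    (contMDiffOn_extChartAt_symm _).contMDiffAt (extChartAt_target_mem_nhds _)
  have hconj : ContMDiffAt 𝓘(ℝ, E) 𝓘(ℝ, E) ∞ (fun y => g * φ.symm y * g⁻¹) (φ 1) :=
    (contMDiff_conj g).contMDiffAt.comp (φ 1) hsymm
  have hφ1 : φ.symm (φ 1) = 1 := extChartAt_to_inv 1
  have hC1 : C (φ 1) = φ 1 := by simp [hC, hφ1]
  have hCd : DifferentiableAt ℝ C (φ 1) := by
    have : ContMDiffAt 𝓘(ℝ, E) 𝓘(ℝ, E) ∞ C (φ 1) := by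
      refine ContMDiffAt.comp (I' := 𝓘(ℝ, E)) (g := φ) (φ 1) ?_ hconj
      have : g * φ.symm (φ 1) * g⁻¹ = 1 := by rw [hφ1]; simp
      rw [this]
      exact contMDiffAt_extChartAt
    exact (contMDiffAt_iff_contDiffAt.1 this).differentiableAt (by simp)
  -- This is (g y g⁻¹) g = g y; differentiating both sides in y at the identity gives dR_g ∘ Ad(g) =
  -- dL_g.
  have hev : ∀ᶠ y in 𝓝 (φ 1), chartMul E G (C y, x) = chartMul E G (x, y) := by
    have h3 : Tendsto (fun y => g * φ.symm y * g⁻¹) (𝓝 (φ 1)) (𝓝 1) := by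
      have := hconj.continuousAt
      rw [ContinuousAt, hφ1] at this
      simpa using this
    filter_upwards [h3.eventually (extChartAt_source_mem_nhds (I := 𝓘(ℝ, E)) (1 : G))] with y hy
    simp only [chartMul, ← hφ, hC, φ.left_inv hy, ← hg]
    simp
  have hd1 : HasFDerivAt (fun y => chartMul E G (C y, x))
      (((fderiv ℝ (chartMul E G) (φ 1, x)).comp (ContinuousLinearMap.inl ℝ E E)).comp
        (fderiv ℝ C (φ 1))) (φ 1) := by
    have e1 : HasFDerivAt (chartMul E G) (fderiv ℝ (chartMul E G) (φ 1, x)) (C (φ 1), x) := by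
      rw [hC1]; exact hx2.hasFDerivAt
    have e2 : HasFDerivAt (fun y => (C y, x)) ((fderiv ℝ C (φ 1)).prod (0 : E →L[ℝ] E)) (φ 1) :=
      hCd.hasFDerivAt.prodMk (hasFDerivAt_const x (φ 1))
    exact HasFDerivAt.comp (φ 1) (f := fun y => (C y, x)) e1 e2
  have hd2 : HasFDerivAt (fun y => chartMul E G (x, y))
      ((fderiv ℝ (chartMul E G) (x, φ 1)).comp (ContinuousLinearMap.inr ℝ E E)) (φ 1) :=
    HasFDerivAt.comp (φ 1) (f := fun y => (x, y)) hx1.hasFDerivAt (hasFDerivAt_prodMk_right x (φ 1))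
  have hA : AdE E g = fderiv ℝ C (φ 1) := by
    ext v
    exact AdE_apply_eq_fderiv g v
  rw [hA]
  exact hd1.unique (hd2.congr_of_eventuallyEq hev)

variable [FiniteDimensional ℝ E]

/-- The bracket of the Lie algebra of a Lie group in the preferred chart at the identity. -/
lemma lie_eq_fderiv_fderiv (v w : GroupLieAlgebra 𝓘(ℝ, E) G) :
    ⁅v, w⁆ =
      fderiv ℝ (fderiv ℝ (chartMul E G))
        (extChartAt 𝓘(ℝ, E) (1 : G) 1, extChartAt 𝓘(ℝ, E) (1 : G) 1) (v, 0) (0, w) -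
      fderiv ℝ (fderiv ℝ (chartMul E G))
        (extChartAt 𝓘(ℝ, E) (1 : G) 1, extChartAt 𝓘(ℝ, E) (1 : G) 1) (w, 0) (0, v) := by
  have : CompleteSpace E := FiniteDimensional.complete ℝ E
  set φ := extChartAt 𝓘(ℝ, E) (1 : G) with hφ
  -- The bracket is read off by letting it act on the chart itself, whose differential at 1 is the
  -- identity.
  have h1 := mfd_mlieBracket (f := φ) (x := (1 : G))
    (V := mulInvariantVectorField (v : GroupLieAlgebra 𝓘(ℝ, E) G))
    (W := mulInvariantVectorField (w : GroupLieAlgebra 𝓘(ℝ, E) G))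
    (contMDiffAt_extChartAt (n := 2)) (mdifferentiableAt_mulInvariantVectorField _)
    (mdifferentiableAt_mulInvariantVectorField _)
  rw [hφ, mfd_extChartAt_self] at h1
  refine h1.trans ?_
  have h2 : DifferentiableAt ℝ (fderiv ℝ (chartMul E G)) (φ 1, φ 1) :=
    (((contDiffAt_chartMul (E := E) (G := G)).of_le (m := 2) ENat.LEInfty.out).fderiv_right
      (m := 1) le_rfl).differentiableAt one_ne_zero
  have key : ∀ a b : E, mfd (fun g : G => mfd φ g (mulInvariantVectorField
      (b : GroupLieAlgebra 𝓘(ℝ, E) G) g)) 1 a =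
        fderiv ℝ (fderiv ℝ (chartMul E G)) (φ 1, φ 1) (a, 0) (0, b) := by
    intro a b
    have h3 : HasFDerivAt (fun x : E => (x, φ 1)) (ContinuousLinearMap.inl ℝ E E) (φ 1) :=
      hasFDerivAt_prodMk_left (φ 1) (φ 1)
    have h4 := (HasFDerivAt.comp (φ 1) (f := fun x : E => (x, φ 1)) h2.hasFDerivAt h3).clm_apply
      (hasFDerivAt_const ((0, b) : E × E) (φ 1))
    have h5 : HasMFDerivAt 𝓘(ℝ, E) 𝓘(ℝ, E) φ 1 (ContinuousLinearMap.id ℝ E) := by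
      have := (mdifferentiableAt_extChartAt (I := 𝓘(ℝ, E)) (mem_chart_source E (1 : G))).hasMFDerivAt
      rwa [mfderiv_extChartAt_self] at this
    have h6 := (HasMFDerivAt.comp (1 : G) h4.hasMFDerivAt h5).congr_of_eventuallyEq
      (mfd_mulInvariantVectorField b)
    rw [mfd, h6.mfderiv]
    change fderiv ℝ (chartMul E G) (φ 1, φ 1) 0 +
      fderiv ℝ (fderiv ℝ (chartMul E G)) (φ 1, φ 1) (a, 0) (0, b) = _
    rw [map_zero, zero_add]
  rw [← hφ]
  rw [mulInvariantVectorField_one, mulInvariantVectorField_one]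
  exact congrArg₂ (· - ·) (key v w) (key w v)

variable (E G) in
/-- The adjoint representation of the Lie algebra of a Lie group, on the model space. -/
def adE (v : GroupLieAlgebra 𝓘(ℝ, E) G) : E →L[ℝ] E :=
  LinearMap.toContinuousLinearMap
    (E := E) (F' := E) (LieAlgebra.ad ℝ (GroupLieAlgebra 𝓘(ℝ, E) G) v)

/-- The derivative at the identity of the adjoint action of a Lie group is the adjoint
representation of its Lie algebra. -/
theorem exists_hasMFDerivAt_AdE :
    ∃ L : E →L[ℝ] (E →L[ℝ] E), (∀ v : GroupLieAlgebra 𝓘(ℝ, E) G, L v = adE E G v) ∧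
      HasMFDerivAt 𝓘(ℝ, E) 𝓘(ℝ, E →L[ℝ] E) (AdE E : G → E →L[ℝ] E) 1 L := by
  have : CompleteSpace E := FiniteDimensional.complete ℝ E
  set φ := extChartAt 𝓘(ℝ, E) (1 : G) with hφ
  set D := fderiv ℝ (fderiv ℝ (chartMul E G)) (φ 1, φ 1) with hD
  have hM : ContDiffAt ℝ 2 (chartMul E G) (φ 1, φ 1) :=
    contDiffAt_chartMul.of_le ENat.LEInfty.out
  have h2 : HasFDerivAt (fderiv ℝ (chartMul E G)) D (φ 1, φ 1) :=
    ((hM.fderiv_right (m := 1) le_rfl).differentiableAt one_ne_zero).hasFDerivAt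
  set A₁ : E → E →L[ℝ] E := fun x =>
    (fderiv ℝ (chartMul E G) (φ 1, x)).comp (ContinuousLinearMap.inl ℝ E E) with hA₁
  set A₂ : E → E →L[ℝ] E := fun x =>
    (fderiv ℝ (chartMul E G) (x, φ 1)).comp (ContinuousLinearMap.inr ℝ E E) with hA₂
  have d₁ : HasFDerivAt A₁ ((((ContinuousLinearMap.compL ℝ E (E × E) E).flip
      (ContinuousLinearMap.inl ℝ E E)).comp D).comp (ContinuousLinearMap.inr ℝ E E)) (φ 1) := by
    have e := HasFDerivAt.comp (φ 1) (f := fun x : E => (φ 1, x)) h2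
      (hasFDerivAt_prodMk_right (φ 1) (φ 1))
    exact (((ContinuousLinearMap.compL ℝ E (E × E) E).flip
      (ContinuousLinearMap.inl ℝ E E)).hasFDerivAt.comp (φ 1) e)
  have d₂ : HasFDerivAt A₂ ((((ContinuousLinearMap.compL ℝ E (E × E) E).flip
      (ContinuousLinearMap.inr ℝ E E)).comp D).comp (ContinuousLinearMap.inl ℝ E E)) (φ 1) := by
    have e := HasFDerivAt.comp (φ 1) (f := fun x : E => (x, φ 1)) h2
      (hasFDerivAt_prodMk_left (φ 1) (φ 1))
    exact (((ContinuousLinearMap.compL ℝ E (E × E) E).flip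
      (ContinuousLinearMap.inr ℝ E E)).hasFDerivAt.comp (φ 1) e)
  have hid : A₁ (φ 1) = ContinuousLinearMap.id ℝ E := by
    have e1 : HasFDerivAt (fun y => chartMul E G (y, φ 1)) (A₁ (φ 1)) (φ 1) :=
      HasFDerivAt.comp (φ 1) (f := fun x : E => (x, φ 1))
        (hM.differentiableAt two_ne_zero).hasFDerivAt (hasFDerivAt_prodMk_left (φ 1) (φ 1))
    refine e1.unique ((hasFDerivAt_id (φ 1)).congr_of_eventuallyEq ?_)
    filter_upwards [extChartAt_target_mem_nhds (I := 𝓘(ℝ, E)) (1 : G)] with y hy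
    exact chartMul_symm_apply hy
  have hinv : (A₁ (φ 1)).IsInvertible := by
    rw [hid]; exact ⟨ContinuousLinearEquiv.refl ℝ E, rfl⟩
  -- Solving dR_g ∘ Ad(g) = dL_g for Ad(g) gives differentiability only. The value of the derivative
  -- is found by differentiating the unsolved equation, which avoids the derivative of an inverse.
  have hev : (fun x => AdE E (φ.symm x)) =ᶠ[𝓝 (φ 1)] fun x => (A₁ x).inverse.comp (A₂ x) := by
    have h3 : ∀ᶠ x in 𝓝 (φ 1), (A₁ x).IsInvertible := by
      have : {L : E →L[ℝ] E | L.IsInvertible} ∈ 𝓝 (A₁ (φ 1)) := by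
        obtain ⟨e, he⟩ := hinv
        rw [← he]
        exact ContinuousLinearEquiv.nhds e
      exact d₁.continuousAt.eventually this
    filter_upwards [h3, eventually_comp_AdE (E := E) (G := G)] with x hx1 hx2
    replace hx2 : (A₁ x).comp (AdE E (φ.symm x)) = A₂ x := hx2
    rw [← hx2, ← ContinuousLinearMap.comp_assoc,
      ContinuousLinearMap.IsInvertible.inverse_comp_self hx1, ContinuousLinearMap.id_comp]
  have hd : DifferentiableAt ℝ (fun x => AdE E (φ.symm x)) (φ 1) := by
    refine DifferentiableAt.congr_of_eventuallyEq ?_ hev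
    refine DifferentiableAt.clm_comp ?_ d₂.differentiableAt
    have h4 := (hinv.contDiffAt_map_inverse (n := 1)).differentiableAt one_ne_zero
    exact h4.comp (φ 1) d₁.differentiableAt
  set L := fderiv ℝ (fun x => AdE E (φ.symm x)) (φ 1) with hL
  refine ⟨L, fun v => ?_, ?_⟩
  · have h5 := (d₁.clm_comp hd.hasFDerivAt).unique
      (d₂.congr_of_eventuallyEq (eventually_comp_AdE (E := E) (G := G)))
    have h6 : AdE E (φ.symm (φ 1)) = ContinuousLinearMap.id ℝ E := by
      rw [hφ, extChartAt_to_inv, AdE_one]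
    ext w
    have h7 := congrArg (fun T : E →L[ℝ] E →L[ℝ] E => T v w) h5
    simp only [h6, hid] at h7
    have h8 : L v w + D (0, v) (w, 0) = D (v, 0) (0, w) := h7
    have h9 : D ((0, v) : E × E) ((w, 0) : E × E) = D ((w, 0) : E × E) ((0, v) : E × E) :=
      (hM.isSymmSndFDerivAt (by simp)).eq _ _
    have h10 : L v w = D (v, 0) (0, w) - D (w, 0) (0, v) := by rw [← h9, ← h8, add_sub_cancel_right]
    exact h10.trans (lie_eq_fderiv_fderiv (G := G) v w).symm
  · have h5 : HasMFDerivAt 𝓘(ℝ, E) 𝓘(ℝ, E) φ 1 (ContinuousLinearMap.id ℝ E) := by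
      have := (mdifferentiableAt_extChartAt (I := 𝓘(ℝ, E)) (mem_chart_source E (1 : G))).hasMFDerivAt
      rwa [mfderiv_extChartAt_self] at this
    refine (HasMFDerivAt.comp (1 : G) hd.hasFDerivAt.hasMFDerivAt h5).congr_of_eventuallyEq ?_
    filter_upwards [extChartAt_source_mem_nhds (I := 𝓘(ℝ, E)) (1 : G)] with g hg
    simp only [Function.comp_apply, hφ, (extChartAt 𝓘(ℝ, E) (1 : G)).left_inv hg]

end AdjointAction

/-! ### Parabolic subgroups: closedness and their Lie algebras -/

section ParabolicSubgroups

open VectorField Filter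
open scoped Topology

variable {E : Type*} [NormedAddCommGroup E] [NormedSpace ℝ E] [FiniteDimensional ℝ E]
  {G : Type*} [TopologicalSpace G] [ChartedSpace E G] [Group G] [LieGroup 𝓘(ℝ, E) ∞ G]

/-- Writing Ad(γ(s)) = Ad(γ(t)) Ad(γ(t)⁻¹ γ(s)) moves the derivative at t to the identity of the
group, where it is ad. -/
lemma hasDerivAt_AdE_of_hasMFDerivAt {γ : ℝ → G} {t : ℝ} (X : GroupLieAlgebra 𝓘(ℝ, E) G)
    (h : HasMFDerivAt 𝓘(ℝ, ℝ) 𝓘(ℝ, E) γ t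
      ((1 : ℝ →L[ℝ] ℝ).smulRight (mulInvariantVectorField X (γ t)))) :
    HasDerivAt (fun s => AdE E (γ s)) ((AdE E (γ t)).comp (adE E G X)) t := by
  obtain ⟨L, hL, hAd⟩ := exists_hasMFDerivAt_AdE (E := E) (G := G)
  set g := γ t with hg
  have h1 : HasMFDerivAt 𝓘(ℝ, E) 𝓘(ℝ, E) (fun x : G => g⁻¹ * x) g
      (mfderiv 𝓘(ℝ, E) 𝓘(ℝ, E) (fun x : G => g⁻¹ * x) g) :=
    (contMDiff_mul_left.contMDiffAt.mdifferentiableAt (n := ∞) (by simp)).hasMFDerivAt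
  have h2 : ∀ p : G, p = 1 → HasMFDerivAt 𝓘(ℝ, E) 𝓘(ℝ, E →L[ℝ] E) (AdE E : G → E →L[ℝ] E) p L := by
    rintro p rfl; exact hAd
  have h3 := HasMFDerivAt.comp t (h2 (g⁻¹ * γ t) (by simp [hg])) (HasMFDerivAt.comp t h1 h)
  have h4 : mfderiv 𝓘(ℝ, E) 𝓘(ℝ, E) (fun x : G => g⁻¹ * x) g (mulInvariantVectorField X g) = X := by
    have e : (fun x : G => g⁻¹ * x) ∘ (fun x => g * x) = id := by ext; simp
    have e2 : ∀ p : G, p = g → MDifferentiableAt 𝓘(ℝ, E) 𝓘(ℝ, E) (fun x : G => g⁻¹ * x) p := by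
      rintro p rfl; exact h1.mdifferentiableAt
    have e1 := mfderiv_comp (1 : G) (e2 (g * 1) (by simp))
      (contMDiff_mul_left (a := g).contMDiffAt.mdifferentiableAt (I := 𝓘(ℝ, E)) (n := ∞) (by simp))
    rw [e, mfderiv_id] at e1
    have e3 : ∀ p : G, p = g → ∀ w : E, (mfderiv 𝓘(ℝ, E) 𝓘(ℝ, E) (fun x : G => g⁻¹ * x) p w : E) =
        mfderiv 𝓘(ℝ, E) 𝓘(ℝ, E) (fun x : G => g⁻¹ * x) g w := by
      rintro p rfl w; rfl
    have e4 := congrArg (fun T : E →L[ℝ] E => T X) e1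
    exact ((e3 (g * 1) (by simp) _).symm.trans e4.symm)
  have h5 : HasDerivAt (fun s => AdE E (g⁻¹ * γ s)) (adE E G X) t := by
    let T : ℝ →L[ℝ] E := (mfderiv 𝓘(ℝ, E) 𝓘(ℝ, E) (fun x : G => g⁻¹ * x) g).comp
      ((1 : ℝ →L[ℝ] ℝ).smulRight (mulInvariantVectorField X g))
    have h6 : HasFDerivAt (fun s => AdE E (g⁻¹ * γ s)) (L.comp T) t :=
      hasMFDerivAt_iff_hasFDerivAt.1 h3
    refine h6.hasDerivAt.congr_deriv ?_
    rw [← hL X]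
    refine congrArg L ?_
    change mfderiv 𝓘(ℝ, E) 𝓘(ℝ, E) (fun x : G => g⁻¹ * x) g
      ((1 : ℝ) • mulInvariantVectorField X g) = X
    rw [one_smul]
    exact h4
  have h8 : (fun s => AdE E (γ s)) = fun s => (AdE E g).comp (AdE E (g⁻¹ * γ s)) := by
    ext1 s
    rw [← AdE_mul, mul_inv_cancel_left]
  rw [h8]
  exact ((ContinuousLinearMap.compL ℝ E E E (AdE E g)).hasFDerivAt.comp_hasDerivAt t h5)

/-- Locally, one-parameter subgroups act by exponentials of the adjoint representation. -/
lemma exists_AdE_eq_exp (X : GroupLieAlgebra 𝓘(ℝ, E) G) :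
    ∃ γ : ℝ → G, ∀ᶠ t in 𝓝 (0 : ℝ), AdE E (γ t) = NormedSpace.exp (t • adE E G X) := by
  have : CompleteSpace E := FiniteDimensional.complete ℝ E
  have : IsManifold 𝓘(ℝ, E) 1 G := .of_le (n := ∞) ENat.LEInfty.out
  have hv : ContMDiffAt 𝓘(ℝ, E) 𝓘(ℝ, E).tangent 1
      (fun g => (⟨g, mulInvariantVectorField X g⟩ : TangentBundle 𝓘(ℝ, E) G)) 1 :=
    (contMDiffAt_mulInvariantVectorField X).of_le (by simp)
  -- A local integral curve of the left invariant field is enough, since γ will only be used near t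
  -- = 0.
  obtain ⟨γ, h0, hγ⟩ := exists_isMIntegralCurveAt_of_contMDiffAt_boundaryless (t₀ := 0) hv
  refine ⟨γ, ?_⟩
  obtain ⟨ε, hε, hball⟩ := Metric.eventually_nhds_iff_ball.1 hγ
  refine Metric.eventually_nhds_iff_ball.2 ⟨ε, hε, fun t ht => ?_⟩
  -- The derivative of this product is Ad(γ) (ad X - ad X) exp(-s ad X) = 0, so it keeps its value
  -- at 0, the identity.
  set f : ℝ → E →L[ℝ] E := fun s => (AdE E (γ s)).comp (NormedSpace.exp (-s • adE E G X)) with hf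
  have hd : ∀ s ∈ Metric.ball (0 : ℝ) ε, HasDerivAt f 0 s := by
    intro s hs
    have h1 := hasDerivAt_AdE_of_hasMFDerivAt X (hball s hs)
    have h2 : HasDerivAt (fun s : ℝ => NormedSpace.exp (-s • adE E G X))
        (-(adE E G X * NormedSpace.exp (-s • adE E G X))) s := by
      have := (hasDerivAt_exp_smul_const' (𝕂 := ℝ) (adE E G X) (-s)).scomp s (hasDerivAt_neg s)
      simpa [Function.comp_def] using this
    have h3 := h1.mul h2
    refine h3.congr_deriv ?_
    change (AdE E (γ s) * adE E G X) * _ + _ = _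
    rw [mul_neg, mul_assoc, add_neg_cancel]
  have hconst : f t = f 0 := by
    refine (convex_ball (0 : ℝ) ε).is_const_of_fderivWithin_eq_zero (𝕜 := ℝ)
      (fun s hs => (hd s hs).differentiableAt.differentiableWithinAt) (fun s hs => ?_) ht
      (Metric.mem_ball_self hε)
    rw [fderivWithin_of_isOpen Metric.isOpen_ball hs]
    have := (hd s hs).hasFDerivAt.fderiv
    simpa using this
  have hf0 : f 0 = ContinuousLinearMap.id ℝ E := by
    simp only [hf, h0, AdE_one, neg_zero, zero_smul, NormedSpace.exp_zero]
    rfl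
  rw [hf0] at hconst
  have h4 : NormedSpace.exp (-t • adE E G X) * NormedSpace.exp (t • adE E G X) = 1 := by
    let _ : NormedAlgebra ℚ (E →L[ℝ] E) := NormedAlgebra.restrictScalars ℚ ℝ _
    have h5 := NormedSpace.exp_add_of_commute (𝔸 := E →L[ℝ] E)
      ((Commute.refl (t • adE E G X)).neg_left)
    rw [neg_smul, ← h5, neg_add_cancel, NormedSpace.exp_zero]
  calc AdE E (γ t) = AdE E (γ t) * (NormedSpace.exp (-t • adE E G X) *
        NormedSpace.exp (t • adE E G X)) := by rw [h4, mul_one]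
    _ = f t * NormedSpace.exp (t • adE E G X) := by rw [← mul_assoc]; rfl
    _ = _ := by rw [hconst]; exact one_mul _

lemma hasDerivAt_exp_smul_apply (L : E →L[ℝ] E) (w : E) :
    HasDerivAt (fun t : ℝ => NormedSpace.exp (t • L) w) (L w) 0 := by
  have : CompleteSpace E := FiniteDimensional.complete ℝ E
  refine ((ContinuousLinearMap.apply ℝ E w).hasFDerivAt.comp_hasDerivAt (0 : ℝ)
    (hasDerivAt_exp_smul_const (𝕂 := ℝ) L (0 : ℝ))).congr_deriv ?_
  rw [zero_smul, NormedSpace.exp_zero, one_mul]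
  rfl

/-- The partial sums of the exponential series stay in W, and W is closed by finite dimensionality.
-/
lemma exp_mem_of_mapsTo {W : Submodule ℝ E} {L : E →L[ℝ] E} (h : ∀ w ∈ W, L w ∈ W) {w : E}
    (hw : w ∈ W) : NormedSpace.exp L w ∈ W := by
  have : CompleteSpace E := FiniteDimensional.complete ℝ E
  have h1 := NormedSpace.exp_series_hasSum_exp' (𝕂 := ℝ) L
  have h2 := (ContinuousLinearMap.apply ℝ E w).hasSum h1
  have hn : ∀ n : ℕ, (L ^ n) w ∈ W := by
    intro n
    induction n with
    | zero => simpa using hw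
    | succ n ih => rw [pow_succ']; exact h _ ih
  refine W.closed_of_finiteDimensional.mem_of_tendsto h2 (Eventually.of_forall fun s => ?_)
  exact W.sum_mem fun n _ => W.smul_mem _ (hn n)

/-- Ad(g) is injective, so the image of W has the dimension of W and an inclusion is already an
equality. -/
lemma map_AdE_eq_iff {W : Submodule ℝ E} {g : G} :
    W.map (AdE E g).toLinearMap = W ↔ ∀ w ∈ W, AdE E g w ∈ W := by
  constructor
  · intro h w hw
    rw [← h]
    exact Submodule.mem_map_of_mem hw
  · intro h
    have hle : W.map (AdE E g).toLinearMap ≤ W := by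
      rintro _ ⟨w, hw, rfl⟩; exact h w hw
    have hinj : Function.Injective (AdE E g).toLinearMap := by
      intro a b hab
      have := congrArg (AdE E g⁻¹) hab
      have hc := AdE_inv_comp (E := E) g
      have ha := congrArg (fun T : E →L[ℝ] E => T a) hc
      have hb := congrArg (fun T : E →L[ℝ] E => T b) hc
      exact ha.symm.trans (this.trans hb)
    exact Submodule.eq_of_le_of_finrank_eq hle
      (Submodule.equivMapOfInjective _ hinj W).finrank_eq.symm

/-- The filtration of the Lie algebra, in the model space. -/
def Grading.filtE (gr : Grading (GroupLieAlgebra 𝓘(ℝ, E) G)) (i : ℤ) : Submodule ℝ E := gr.filt i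

variable {gr gr' : Grading (GroupLieAlgebra 𝓘(ℝ, E) G)} {P Q : Subgroup G}
  {E₁ E₂ : Type*} [NormedAddCommGroup E₁] [NormedSpace ℝ E₁] [NormedAddCommGroup E₂]
  [NormedSpace ℝ E₂] [ChartedSpace E₁ P] [ChartedSpace E₂ Q]

lemma IsParabolicSubgroup.mem_iff_AdE (h : IsParabolicSubgroup (E' := E₁) gr P) (g : G) :
    g ∈ P ↔ ∀ w ∈ gr.filtE 0, AdE E g w ∈ gr.filtE 0 :=
  (h.mem_iff g).trans (map_AdE_eq_iff (W := gr.filtE 0))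

/-- An inclusion of parabolic subgroups yields an inclusion of the parabolic subalgebras. -/
theorem IsParabolicSubgroup.filt_zero_le
    [LieAlgebra.IsSemisimple ℝ (GroupLieAlgebra 𝓘(ℝ, E) G)]
    (hP : IsParabolicSubgroup (E' := E₁) gr P) (hQ : IsParabolicSubgroup (E' := E₂) gr' Q)
    (hQP : Q ≤ P) : gr'.filt 0 ≤ gr.filt 0 := by
  have : CompleteSpace E := FiniteDimensional.complete ℝ E
  have : FiniteDimensional ℝ (GroupLieAlgebra 𝓘(ℝ, E) G) := inferInstanceAs (FiniteDimensional ℝ E)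
  intro X hX
  obtain ⟨γ, hγ⟩ := exists_AdE_eq_exp X
  -- The smaller parabolic subalgebra is stable under ad X, hence under the exponential Ad(γ(t)).
  -- This puts γ(t) in Q and so in P, whose elements preserve the larger one.
  have h1 : ∀ᶠ t in 𝓝 (0 : ℝ), ∀ w ∈ gr.filtE 0,
      NormedSpace.exp (t • adE E G X) w ∈ gr.filtE 0 := by
    filter_upwards [hγ] with t ht
    rw [← ht]
    refine (hP.mem_iff_AdE _).1 (hQP ((hQ.mem_iff_AdE _).2 fun w hw => ?_))
    rw [ht]
    refine exp_mem_of_mapsTo (W := gr'.filtE 0) (fun v hv => ?_) hw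
    exact Submodule.smul_mem _ _ (gr'.parabolic.lie_mem hX hv)
  -- By self-normalization it suffices that [X, y] ∈ 𝔭. It is the limit of difference quotients of
  -- exp(t ad X) y, all of which lie in the closed subspace 𝔭 for small t.
  refine gr.mem_filt_zero_of_lie_mem fun y hy => ?_
  have h2 := hasDerivAt_exp_smul_apply (adE E G X) y
  have h3 := hasDerivAt_iff_tendsto_slope.1 h2
  have hcl : IsClosed ((gr.filtE 0 : Submodule ℝ E) : Set E) :=
    Submodule.closed_of_finiteDimensional _
  refine hcl.mem_of_tendsto h3 ?_
  filter_upwards [nhdsWithin_le_nhds h1] with t ht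
  rw [slope_def_module]
  refine Submodule.smul_mem _ _ (Submodule.sub_mem _ (ht y hy) ?_)
  rw [zero_smul, NormedSpace.exp_zero]
  exact hy

/-- Differentiability at the identity gives continuity there, and multiplicativity transports it to
every point. -/
lemma continuous_AdE : Continuous (AdE E : G → E →L[ℝ] E) := by
  obtain ⟨L, -, hL⟩ := exists_hasMFDerivAt_AdE (E := E) (G := G)
  have : IsTopologicalGroup G := topologicalGroup_of_lieGroup 𝓘(ℝ, E) ∞
  rw [continuous_iff_continuousAt]
  intro g
  have h8 : (AdE E : G → E →L[ℝ] E) = fun s => (AdE E g).comp (AdE E (g⁻¹ * s)) := by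
    ext1 s
    rw [← AdE_mul, mul_inv_cancel_left]
  rw [h8]
  have h1 : ContinuousAt (fun s : G => AdE E (g⁻¹ * s)) g := by
    refine ContinuousAt.comp (g := AdE E) (f := fun s : G => g⁻¹ * s) ?_
      (continuous_const.mul continuous_id).continuousAt
    rw [inv_mul_cancel]
    exact hL.continuousAt
  exact (ContinuousLinearMap.compL ℝ E E E (AdE E g)).continuous.continuousAt.comp h1

/-- The defining condition is an intersection of closed conditions on g. It is used, for Q, to
separate orbits. -/
lemma IsParabolicSubgroup.isClosed (h : IsParabolicSubgroup (E' := E₁) gr P) :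
    IsClosed (P : Set G) := by
  have : (P : Set G) = ⋂ w ∈ gr.filtE 0, {g : G | AdE E g w ∈ gr.filtE 0} := by
    ext g
    simp [h.mem_iff_AdE]
  rw [this]
  refine isClosed_biInter fun w _ => ?_
  have hcl : IsClosed ((gr.filtE 0 : Submodule ℝ E) : Set E) :=
    Submodule.closed_of_finiteDimensional _
  exact hcl.preimage ((ContinuousLinearMap.apply ℝ E (w : E)).continuous.comp continuous_AdE)

end ParabolicSubgroups

/-! ### Smooth local inverses, complements and immersions -/

section InverseFunction

open Filter Set
open scoped Topology

/-- Smoothness of the inverse is needed at all points near f x with one and the same g. It follows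
after shrinking to the open set where the derivative of f remains invertible. -/
lemma exists_smooth_local_inverse {E F : Type*} [NormedAddCommGroup E] [NormedSpace ℝ E]
    [CompleteSpace E] [NormedAddCommGroup F] [NormedSpace ℝ F] {f : E → F} {U : Set E}
    (hU : IsOpen U) (hf : ContDiffOn ℝ ∞ f U) {x : E} (hx : x ∈ U) (f' : E ≃L[ℝ] F)
    (hf' : HasFDerivAt f (f' : E →L[ℝ] F) x) :
    ∃ (O : Set E) (g : F → E), IsOpen O ∧ O ⊆ U ∧ x ∈ O ∧
      ∀ y ∈ O, ContDiffAt ℝ ∞ g (f y) ∧ g (f y) = y ∧ ∀ᶠ z in 𝓝 (f y), f (g z) = z := by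
  have hfx : ContDiffAt ℝ ∞ f x := hf.contDiffAt (hU.mem_nhds hx)
  set e := hfx.toOpenPartialHomeomorph f hf' (by simp) with he
  have hef : ∀ y, e y = f y := fun y => by
    rw [he, ContDiffAt.toOpenPartialHomeomorph_coe]
  have hcont : ContinuousAt (fderiv ℝ f) x :=
    (hfx.fderiv_right (m := 0) (by simp)).continuousAt
  have hD : {y | fderiv ℝ f y ∈ range ((↑) : (E ≃L[ℝ] F) → E →L[ℝ] F)} ∈ 𝓝 x := by
    refine hcont ?_
    rw [hf'.fderiv]
    exact ContinuousLinearEquiv.nhds f'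
  refine ⟨interior {y | fderiv ℝ f y ∈ range ((↑) : (E ≃L[ℝ] F) → E →L[ℝ] F)} ∩ (e.source ∩ U),
    e.symm, isOpen_interior.inter (e.open_source.inter hU), fun y hy => hy.2.2,
    ⟨mem_interior_iff_mem_nhds.2 hD, hfx.mem_toOpenPartialHomeomorph_source hf' (by simp), hx⟩, ?_⟩
  rintro y ⟨h1, h2, h3⟩
  obtain ⟨A, hA⟩ := interior_subset h1
  have hy : e.symm (f y) = y := by rw [← hef, e.left_inv h2]
  have ht : f y ∈ e.target := by rw [← hef]; exact e.map_source h2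
  refine ⟨?_, hy, ?_⟩
  · have hfy : ContDiffAt ℝ ∞ f y := hf.contDiffAt (hU.mem_nhds h3)
    have hfe : (e : E → F) = f := funext hef
    refine e.contDiffAt_symm (f₀' := A) ht ?_ ?_
    · rw [hy, hA, hfe]
      exact (hfy.differentiableAt (by simp)).hasFDerivAt
    · rw [hy, hfe]; exact hfy
  · filter_upwards [e.open_target.mem_nhds ht] with z hz
    rw [← hef, e.right_inv hz]

/-- The complement of the range of L is parametrized by a prescribed space R, so that all slices can
share one parameter space and become charts with the same model. -/
lemma exists_complement_map {E F R : Type*} [NormedAddCommGroup E] [NormedSpace ℝ E]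
    [FiniteDimensional ℝ E] [NormedAddCommGroup F] [NormedSpace ℝ F] [FiniteDimensional ℝ F]
    [NormedAddCommGroup R] [NormedSpace ℝ R] [FiniteDimensional ℝ R]
    (L : E →L[ℝ] F) (hL : Function.Injective L)
    (hR : Module.finrank ℝ R + Module.finrank ℝ E = Module.finrank ℝ F) :
    ∃ j : R →L[ℝ] F, Function.Bijective (fun x : R × E => j x.1 + L x.2) := by
  obtain ⟨C, hC⟩ := Submodule.exists_isCompl (LinearMap.range L.toLinearMap)
  have h1 := Submodule.finrank_add_eq_of_isCompl hC
  have h2 : Module.finrank ℝ (LinearMap.range L.toLinearMap) = Module.finrank ℝ E :=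
    LinearMap.finrank_range_of_inj hL
  let e : R ≃ₗ[ℝ] C := LinearEquiv.ofFinrankEq R C (by omega)
  let j : R →ₗ[ℝ] F := C.subtype ∘ₗ e.toLinearMap
  refine ⟨LinearMap.toContinuousLinearMap j, ?_⟩
  let T : R × E →ₗ[ℝ] F := j.coprod L.toLinearMap
  have hT : Function.Injective T := by
    rw [← LinearMap.ker_eq_bot, LinearMap.ker_eq_bot']
    rintro ⟨r, x⟩ h
    have h3 : (e r : F) + L x = 0 := h
    have h4 : (e r : F) = -L x := eq_neg_of_add_eq_zero_left h3
    have h5 : (e r : F) ∈ LinearMap.range L.toLinearMap := by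
      rw [h4]; exact Submodule.neg_mem _ ⟨x, rfl⟩
    have h6 : (e r : F) = 0 := by
      have := hC.disjoint.le_bot (x := (e r : F)) ⟨h5, (e r).2⟩
      simpa using this
    have h7 : r = 0 := by
      have : e r = 0 := Subtype.ext h6
      simpa using this
    have h8 : L x = 0 := by rw [h6] at h4; exact neg_eq_zero.1 h4.symm
    have h9 : x = 0 := hL (by simpa using h8)
    rw [h7, h9]; rfl
  have hfin : Module.finrank ℝ (R × E) = Module.finrank ℝ F := by
    rw [Module.finrank_prod]; exact hR
  exact ⟨hT, (LinearMap.injective_iff_surjective_of_finrank_eq_finrank hfin).1 hT⟩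

variable {E F M N : Type*} [NormedAddCommGroup E] [NormedSpace ℝ E]
  [NormedAddCommGroup F] [NormedSpace ℝ F]
  [TopologicalSpace M] [ChartedSpace E M]
  [TopologicalSpace N] [ChartedSpace F N]

/-- The local normal form of an immersion provides a left inverse r near x that is differentiable at
f x; the chain rule for r ∘ f = id gives injectivity. -/
lemma mfderiv_injective_of_isImmersion {f : M → N}
    (hf : Manifold.IsImmersion 𝓘(ℝ, E) 𝓘(ℝ, F) ∞ f) (x : M) :
    Function.Injective (mfderiv 𝓘(ℝ, E) 𝓘(ℝ, F) f x) := by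
  have h := hf.isImmersionAt x
  let r : N → M := fun y => (h.domChart).symm ((h.equiv.symm (h.codChart y)).1)
  have hr : r ∘ f =ᶠ[𝓝 x] id := by
    filter_upwards [h.domChart.open_source.mem_nhds h.mem_domChart_source] with y hy
    have h1 := h.writtenInCharts
    have h2 : h.domChart y ∈ (h.domChart.extend 𝓘(ℝ, E)).target := by
      simpa using h.domChart.map_source hy
    have h3 := h1 h2
    simp only [Function.comp_apply, OpenPartialHomeomorph.extend_coe, modelWithCornersSelf_coe,
      id_eq, OpenPartialHomeomorph.extend_coe_symm, modelWithCornersSelf_coe_symm] at h3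
    rw [h.domChart.left_inv hy] at h3
    simp only [Function.comp_apply, r, h3, ContinuousLinearEquiv.symm_apply_apply, id]
    exact h.domChart.left_inv hy
  have hrd : MDifferentiableAt 𝓘(ℝ, F) 𝓘(ℝ, E) r (f x) := by
    have hx := h.mem_codChart_source
    have h1 : MDifferentiableAt 𝓘(ℝ, F) 𝓘(ℝ, F) h.codChart (f x) :=
      (contMDiffAt_of_mem_maximalAtlas h.codChart_mem_maximalAtlas hx).mdifferentiableAt (by simp)
    have h2 : MDifferentiableAt 𝓘(ℝ, F) 𝓘(ℝ, E) (fun z => (h.equiv.symm z).1) (h.codChart (f x)) :=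
      ((ContinuousLinearMap.fst ℝ E h.complement).comp
        h.equiv.symm.toContinuousLinearMap).differentiableAt.mdifferentiableAt
    have h4 : (h.equiv.symm (h.codChart (f x))).1 = h.domChart x := by
      have h2 : h.domChart x ∈ (h.domChart.extend 𝓘(ℝ, E)).target := by
        simpa using h.domChart.map_source h.mem_domChart_source
      have h3 := h.writtenInCharts h2
      simp only [Function.comp_apply, OpenPartialHomeomorph.extend_coe, modelWithCornersSelf_coe,
        id_eq, OpenPartialHomeomorph.extend_coe_symm, modelWithCornersSelf_coe_symm] at h3
      rw [h.domChart.left_inv h.mem_domChart_source] at h3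
      rw [h3, ContinuousLinearEquiv.symm_apply_apply]
    have h3 : MDifferentiableAt 𝓘(ℝ, E) 𝓘(ℝ, E) h.domChart.symm
        ((h.equiv.symm (h.codChart (f x))).1) := by
      rw [h4]
      exact (contMDiffAt_symm_of_mem_maximalAtlas h.domChart_mem_maximalAtlas
        (h.domChart.map_source h.mem_domChart_source)).mdifferentiableAt (by simp)
    exact h3.comp (f x) (h2.comp (f x) h1)
  have hfd : MDifferentiableAt 𝓘(ℝ, E) 𝓘(ℝ, F) f x :=
    h.contMDiffAt.mdifferentiableAt (by simp)
  have hc := mfderiv_comp x hrd hfd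
  have hid : mfderiv 𝓘(ℝ, E) 𝓘(ℝ, E) (r ∘ f) x = mfderiv 𝓘(ℝ, E) 𝓘(ℝ, E) id x :=
    hr.mfderiv_eq
  have hid' : ∀ v : E, (mfderiv 𝓘(ℝ, E) 𝓘(ℝ, E) (r ∘ f) x v : E) = v := fun v => by
    have := congrArg (fun T : E →L[ℝ] E => T v) (hid.trans mfderiv_id)
    exact this
  intro v w hvw
  have h1 : (mfderiv 𝓘(ℝ, E) 𝓘(ℝ, E) (r ∘ f) x v : E) = mfderiv 𝓘(ℝ, E) 𝓘(ℝ, E) (r ∘ f) x w := by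
    rw [hc]
    exact congrArg (mfderiv 𝓘(ℝ, F) 𝓘(ℝ, E) r (f x)) hvw
  exact (hid' v).symm.trans (h1.trans (hid' w))

end InverseFunction

/-! ### Existence of local slices -/

section Slices

open Filter Set
open scoped Topology

/-- A slice through the orbits of a right action: a saturated open set `U` on which every point
is uniquely of the form `σ(s) · h`. -/
structure LocalSlice (E EH R : Type*) [NormedAddCommGroup E] [NormedSpace ℝ E]
    [NormedAddCommGroup EH] [NormedSpace ℝ EH] [NormedAddCommGroup R] [NormedSpace ℝ R]
    {B H : Type*} [TopologicalSpace B] [ChartedSpace E B] [TopologicalSpace H] [ChartedSpace EH H]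
    [Group H] (act : B → H → B) where
  /-- the saturated open set -/
  U : Set B
  /-- the parameter domain -/
  S : Set R
  /-- the parameter of the orbit -/
  ρ : B → R
  /-- the position in the orbit -/
  τ : B → H
  /-- the slice -/
  σ : R → B
  isOpen_U : IsOpen U
  isOpen_S : IsOpen S
  act_mem : ∀ b ∈ U, ∀ h, act b h ∈ U
  ρ_mem : ∀ b ∈ U, ρ b ∈ S
  σ_mem : ∀ s ∈ S, σ s ∈ U
  act_σ : ∀ b ∈ U, act (σ (ρ b)) (τ b) = b
  ρ_act : ∀ b ∈ U, ∀ h, ρ (act b h) = ρ b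
  τ_act : ∀ b ∈ U, ∀ h, τ (act b h) = τ b * h
  ρ_σ : ∀ s ∈ S, ρ (σ s) = s
  τ_σ : ∀ s ∈ S, τ (σ s) = 1
  smooth_ρ : ContMDiffOn 𝓘(ℝ, E) 𝓘(ℝ, R) ∞ ρ U
  smooth_τ : ContMDiffOn 𝓘(ℝ, E) 𝓘(ℝ, EH) ∞ τ U
  smooth_σ : ContMDiffOn 𝓘(ℝ, R) 𝓘(ℝ, E) ∞ σ S

variable {E EH R : Type*} [NormedAddCommGroup E] [NormedSpace ℝ E] [FiniteDimensional ℝ E]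
  [NormedAddCommGroup EH] [NormedSpace ℝ EH] [FiniteDimensional ℝ EH]
  [NormedAddCommGroup R] [NormedSpace ℝ R] [FiniteDimensional ℝ R]
  {B H : Type*} [TopologicalSpace B] [ChartedSpace E B] [IsManifold 𝓘(ℝ, E) ∞ B]
  [TopologicalSpace H] [ChartedSpace EH H] [Group H] [LieGroup 𝓘(ℝ, EH) ∞ H]
  {act : B → H → B}

/-- The slice σ is an affine piece, in a chart at u, transversal to the orbit. The map (s, h) ↦ σ(s)
h then has bijective derivative at the base point. The inverse function theorem handles h near 1;
`hprop` excludes returns to the slice by distant h; translation by the group covers the rest of each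
orbit. -/
theorem exists_localSlice (act_one : ∀ u, act u 1 = u)
    (act_mul : ∀ u a b, act (act u a) b = act u (a * b))
    (smooth_act : ContMDiff (𝓘(ℝ, E).prod 𝓘(ℝ, EH)) 𝓘(ℝ, E) ∞ (fun x : B × H => act x.1 x.2))
    (u : B) (hfree : Function.Injective (mfderiv 𝓘(ℝ, EH) 𝓘(ℝ, E) (fun h => act u h) 1))
    (hprop : ∀ V ∈ 𝓝 (1 : H), ∃ W ∈ 𝓝 u, ∀ w ∈ W, ∀ h, act w h ∈ W → h ∈ V)
    (hR : Module.finrank ℝ R + Module.finrank ℝ EH = Module.finrank ℝ E) :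
    ∃ s : LocalSlice E EH R act, u ∈ s.U := by
  classical
  have : CompleteSpace E := FiniteDimensional.complete ℝ E
  have : CompleteSpace (R × EH) := FiniteDimensional.complete ℝ _
  set c := extChartAt 𝓘(ℝ, E) u with hc
  set d := extChartAt 𝓘(ℝ, EH) (1 : H) with hd
  let L : EH →L[ℝ] E := mfderiv 𝓘(ℝ, EH) 𝓘(ℝ, E) (fun h => act u h) 1
  obtain ⟨j, hj⟩ := exists_complement_map (R := R) L hfree hR
  set σ : R → B := fun s => c.symm (c u + j s) with hσ
  have hcu : u ∈ c.source := mem_extChartAt_source u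
  have hd1 : (1 : H) ∈ d.source := mem_extChartAt_source 1
  have hTo : IsOpen ((fun s : R => c u + j s) ⁻¹' c.target) :=
    (isOpen_extChartAt_target u).preimage (by fun_prop)
  set T : Set R := (fun s : R => c u + j s) ⁻¹' c.target with hT
  have h0T : (0 : R) ∈ T := by simp [hT, c.map_source hcu]
  have hσ0 : σ 0 = u := by simp [hσ, c.left_inv hcu]
  have hσs : ContMDiffOn 𝓘(ℝ, R) 𝓘(ℝ, E) ∞ σ T := by
    refine (contMDiffOn_extChartAt_symm u).comp
      (t := c.target) (f := fun s : R => c u + j s) ?_ (fun s hs => hs)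
    exact (contMDiff_iff_contDiff.2 (by fun_prop)).contMDiffOn
  have hTd : IsOpen (T ×ˢ d.target) := hTo.prod (isOpen_extChartAt_target _)
  set Fm : R × EH → B := fun x => act (σ x.1) (d.symm x.2) with hFm
  have hFs : ContMDiffOn 𝓘(ℝ, R × EH) 𝓘(ℝ, E) ∞ Fm (T ×ˢ d.target) := by
    refine smooth_act.comp_contMDiffOn (f := fun x : R × EH => (σ x.1, d.symm x.2)) ?_
    refine ContMDiffOn.prodMk ?_ ?_
    · exact hσs.comp contDiff_fst.contMDiff.contMDiffOn (fun x hx => hx.1)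
    · exact (contMDiffOn_extChartAt_symm (1 : H)).comp contDiff_snd.contMDiff.contMDiffOn
        (fun x hx => hx.2)
  set D : Set (R × EH) := T ×ˢ d.target ∩ Fm ⁻¹' c.source with hD
  have hDo : IsOpen D := hFs.continuousOn.isOpen_inter_preimage hTd (isOpen_extChartAt_source u)
  set f : R × EH → E := fun x => c (Fm x) with hf
  have hfs : ContDiffOn ℝ ∞ f D := by
    rw [← contMDiffOn_iff_contDiffOn]
    exact contMDiffOn_extChartAt.comp (hFs.mono inter_subset_left)
      (fun x hx => by simpa [hc, extChartAt_source] using hx.2)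
  have hF0 : Fm (0, d 1) = u := by simp only [hFm, hσ0, d.left_inv hd1, act_one]
  have hx0 : ((0 : R), d 1) ∈ D := ⟨⟨h0T, d.map_source hd1⟩, by rw [mem_preimage, hF0]; exact hcu⟩
  have hfd : HasFDerivAt f (fderiv ℝ f (0, d 1)) (0, d 1) :=
    ((hfs.contDiffAt (hDo.mem_nhds hx0)).differentiableAt (by simp)).hasFDerivAt
  have hdj : (fderiv ℝ f (0, d 1)).comp (ContinuousLinearMap.inl ℝ R EH) = j := by
    have h1 : HasFDerivAt (fun s : R => (s, d 1)) (ContinuousLinearMap.inl ℝ R EH) 0 :=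
      hasFDerivAt_prodMk_left _ _
    refine (HasFDerivAt.comp (0 : R) hfd h1).unique ?_
    have h2 : HasFDerivAt (fun s : R => c u + j s) j 0 := j.hasFDerivAt.const_add _
    refine h2.congr_of_eventuallyEq ?_
    filter_upwards [hTo.mem_nhds h0T] with s hs
    simp only [Function.comp_apply, hf, hFm, d.left_inv hd1, act_one]
    exact c.right_inv hs
  have hdL : (fderiv ℝ f (0, d 1)).comp (ContinuousLinearMap.inr ℝ R EH) = L := by
    have h1 : HasFDerivAt (fun y : EH => ((0 : R), y)) (ContinuousLinearMap.inr ℝ R EH) (d 1) :=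
      hasFDerivAt_prodMk_right _ _
    refine (HasFDerivAt.comp (d 1) hfd h1).unique ?_
    have h2 : MDifferentiableAt 𝓘(ℝ, EH) 𝓘(ℝ, E) (fun h => act u h) 1 :=
      (smooth_act.comp (contMDiff_const.prodMk contMDiff_id)).contMDiffAt.mdifferentiableAt
        (n := ∞) (by simp)
    have h3 : HasFDerivAt (fun y => c (act u (d.symm y))) L (d 1) := by
      have h4 := h2.hasMFDerivAt.2
      simp only [writtenInExtChartAt, act_one, modelWithCornersSelf_coe, range_id] at h4
      exact hasFDerivWithinAt_univ.1 h4
    refine h3.congr_of_eventuallyEq (Eventually.of_forall fun y => ?_)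
    simp only [Function.comp_apply, hf, hFm, hσ0]
  have hfder : ∀ x : R × EH, fderiv ℝ f (0, d 1) x = j x.1 + L x.2 := by
    intro x
    rw [← hdj, ← hdL, ContinuousLinearMap.comp_apply, ContinuousLinearMap.comp_apply, ← map_add]
    simp
  have hbij : Function.Bijective (fderiv ℝ f (0, d 1)) := by
    have : (fderiv ℝ f (0, d 1) : R × EH → E) = fun x => j x.1 + L x.2 := funext hfder
    rw [this]; exact hj
  let f' : (R × EH) ≃L[ℝ] E :=
    (LinearEquiv.ofBijective (fderiv ℝ f (0, d 1)).toLinearMap hbij).toContinuousLinearEquiv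
  obtain ⟨O, g, hOo, hOD, hO0, hg⟩ := exists_smooth_local_inverse hDo hfs hx0 f'
    (hfd.congr_fderiv (ContinuousLinearMap.ext fun _ => rfl))
  obtain ⟨S₁, V', hS₁o, h0S₁, hV'o, hV', hSV⟩ := mem_nhds_prod_iff'.1 (hOo.mem_nhds hO0)
  set V : Set H := d.source ∩ d ⁻¹' V' with hV
  have hVn : V ∈ 𝓝 (1 : H) := inter_mem (extChartAt_source_mem_nhds _)
    ((continuousAt_extChartAt _).preimage_mem_nhds (hV'o.mem_nhds hV'))
  obtain ⟨W, hW, hWV⟩ := hprop V hVn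
  set S : Set R := S₁ ∩ (T ∩ σ ⁻¹' interior W) with hS
  have hSo : IsOpen S := hS₁o.inter (hσs.continuousOn.isOpen_inter_preimage hTo isOpen_interior)
  have h0S : (0 : R) ∈ S := ⟨h0S₁, h0T, by rw [mem_preimage, hσ0]; exact mem_interior_iff_mem_nhds.2 hW⟩
  have hSO : ∀ s ∈ S, ∀ h ∈ V, (s, d h) ∈ O := fun s hs h hh => hSV ⟨hs.1, hh.2⟩
  have h1V : (1 : H) ∈ V := mem_of_mem_nhds hVn
  have hFmd : ∀ s, ∀ h ∈ V, Fm (s, d h) = act (σ s) h := fun s h hh => by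
    simp only [hFm, d.left_inv hh.1]
  -- The element h h'⁻¹ carries σ(s) to σ(s'), both in W, so it lies in V, where injectivity of the
  -- local inverse applies.
  have hinj : ∀ s ∈ S, ∀ s' ∈ S, ∀ h h', act (σ s) h = act (σ s') h' → s = s' ∧ h = h' := by
    intro s hs s' hs' h h' heq
    have h1 : act (σ s) (h * h'⁻¹) = σ s' := by
      rw [← act_mul, heq, act_mul, mul_inv_cancel, act_one]
    have h2 : h * h'⁻¹ ∈ V := by
      refine hWV _ (interior_subset hs.2.2) _ ?_
      rw [h1]; exact interior_subset hs'.2.2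
    have h3 : f (s, d (h * h'⁻¹)) = f (s', d 1) := by
      simp only [hf, hFmd _ _ h2, hFmd _ _ h1V, h1, act_one]
    have h4 : (s, d (h * h'⁻¹)) = (s', d 1) := by
      rw [← (hg _ (hSO s hs _ h2)).2.1, h3, (hg _ (hSO s' hs' _ h1V)).2.1]
    have h5 := congrArg Prod.fst h4
    have h6 : h * h'⁻¹ = 1 := d.injOn h2.1 hd1 (congrArg Prod.snd h4)
    exact ⟨h5, mul_inv_eq_one.1 h6⟩
  -- Near σ(s) h₀, translating back by h₀⁻¹ brings the point to the domain of the local inverse g;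
  -- the group coordinate is then multiplied by h₀ again.
  have hloc : ∀ s ∈ S, ∀ h₀ : H, ∃ G₁ : B → R, ∃ G₂ : B → H,
      ContMDiffAt 𝓘(ℝ, E) 𝓘(ℝ, R) ∞ G₁ (act (σ s) h₀) ∧
      ContMDiffAt 𝓘(ℝ, E) 𝓘(ℝ, EH) ∞ G₂ (act (σ s) h₀) ∧
      ∀ᶠ b in 𝓝 (act (σ s) h₀), G₁ b ∈ S ∧ act (σ (G₁ b)) (G₂ b) = b := by
    intro s hs h₀
    have hsO := hSO s hs 1 h1V
    obtain ⟨hg1, hg2, hg3⟩ := hg _ hsO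
    have hfs' : f (s, d 1) = c (σ s) := by simp only [hf, hFmd _ _ h1V, act_one]
    have hσc : σ s ∈ c.source := c.map_target hs.2.1
    rw [hfs'] at hg1 hg2 hg3
    set b₀ := act (σ s) h₀ with hb₀
    have hb : act b₀ h₀⁻¹ = σ s := by rw [hb₀, act_mul, mul_inv_cancel, act_one]
    have hk : ContMDiff 𝓘(ℝ, E) 𝓘(ℝ, E) ∞ (fun b => act b h₀⁻¹) :=
      smooth_act.comp (contMDiff_id.prodMk contMDiff_const)
    set k : B → R × EH := fun b => g (c (act b h₀⁻¹)) with hkdef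
    have hk1 : ContMDiffAt 𝓘(ℝ, E) 𝓘(ℝ, E) ∞ (fun b => c (act b h₀⁻¹)) b₀ := by
      have : ContMDiffAt 𝓘(ℝ, E) 𝓘(ℝ, E) ∞ c (act b₀ h₀⁻¹) := by
        rw [hb]; exact contMDiffAt_extChartAt' (by simpa [hc] using hσc)
      exact this.comp b₀ hk.contMDiffAt
    have hks : ContMDiffAt 𝓘(ℝ, E) 𝓘(ℝ, R × EH) ∞ k b₀ := by
      have : ContMDiffAt 𝓘(ℝ, E) 𝓘(ℝ, R × EH) ∞ g (c (act b₀ h₀⁻¹)) := by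
        rw [hb]; exact hg1.contMDiffAt
      exact this.comp b₀ hk1
    have hkb : k b₀ = (s, d 1) := by simp only [hkdef, hb, hg2]
    refine ⟨fun b => (k b).1, fun b => d.symm (k b).2 * h₀, ?_, ?_, ?_⟩
    · exact contDiff_fst.contMDiff.contMDiffAt.comp b₀ hks
    · refine ContMDiffAt.mul ?_ contMDiffAt_const
      have h1 : ContMDiffAt 𝓘(ℝ, EH) 𝓘(ℝ, EH) ∞ d.symm (k b₀).2 := by
        rw [hkb]
        exact (contMDiffOn_extChartAt_symm (1 : H)).contMDiffAt
          (extChartAt_target_mem_nhds (I := 𝓘(ℝ, EH)) (1 : H))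
      exact h1.comp b₀ (contDiff_snd.contMDiff.contMDiffAt.comp b₀ hks)
    · have e1 : ∀ᶠ b in 𝓝 b₀, k b ∈ O ∩ S ×ˢ univ := by
        refine hks.continuousAt ?_
        rw [hkb]
        exact (hOo.inter (hSo.prod isOpen_univ)).mem_nhds ⟨hsO, hs, trivial⟩
      have e2 : ∀ᶠ b in 𝓝 b₀, act b h₀⁻¹ ∈ c.source := by
        refine hk.continuous.continuousAt ?_
        rw [hb]
        exact (isOpen_extChartAt_source u).mem_nhds hσc
      have e3 : ∀ᶠ b in 𝓝 b₀, f (k b) = c (act b h₀⁻¹) := by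
        have e4 : ∀ᶠ z in 𝓝 (c (act b₀ h₀⁻¹)), f (g z) = z := by rw [hb]; exact hg3
        exact hk1.continuousAt.eventually e4
      filter_upwards [e1, e2, e3] with b hb1 hb2 hb3
      refine ⟨hb1.2.1, ?_⟩
      have h1 : Fm (k b) = act b h₀⁻¹ := c.injOn (hOD hb1.1).2 hb2 hb3
      have h2 : act (σ (k b).1) (d.symm (k b).2) = act b h₀⁻¹ := h1
      rw [← act_mul, h2, act_mul, inv_mul_cancel, act_one]
  set U : Set B := {b | ∃ s ∈ S, ∃ h, act (σ s) h = b} with hU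
  have hUo : IsOpen U := by
    rw [isOpen_iff_mem_nhds]
    rintro _ ⟨s, hs, h, rfl⟩
    obtain ⟨G₁, G₂, -, -, h3⟩ := hloc s hs h
    filter_upwards [h3] with b hb
    exact ⟨_, hb.1, _, hb.2⟩
  -- The coordinates are chosen pointwise. Their smoothness comes from uniqueness, which identifies
  -- them locally with the smooth functions of `hloc`.
  set ρ : B → R := fun b => if hb : b ∈ U then hb.choose else 0 with hρ
  set τ : B → H := fun b => if hb : b ∈ U then hb.choose_spec.2.choose else 1 with hτ
  have hspec : ∀ b ∈ U, ρ b ∈ S ∧ act (σ (ρ b)) (τ b) = b := by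
    intro b hb
    simp only [hρ, hτ, dif_pos hb]
    exact ⟨hb.choose_spec.1, hb.choose_spec.2.choose_spec⟩
  have huniq : ∀ s ∈ S, ∀ h, ρ (act (σ s) h) = s ∧ τ (act (σ s) h) = h := by
    intro s hs h
    have := hspec (act (σ s) h) ⟨s, hs, h, rfl⟩
    exact hinj _ this.1 _ hs _ _ this.2
  have hUa : ∀ b ∈ U, ∀ h, act b h ∈ U := by
    rintro _ ⟨s, hs, h', rfl⟩ h
    exact ⟨s, hs, h' * h, by rw [act_mul]⟩
  have hσU : ∀ s ∈ S, σ s ∈ U := fun s hs => ⟨s, hs, 1, act_one _⟩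
  refine ⟨{ U := U, S := S, ρ := ρ, τ := τ, σ := σ, isOpen_U := hUo, isOpen_S := hSo
            act_mem := hUa
            ρ_mem := fun b hb => (hspec b hb).1
            σ_mem := hσU
            act_σ := fun b hb => (hspec b hb).2
            ρ_act := ?_, τ_act := ?_, ρ_σ := ?_, τ_σ := ?_, smooth_ρ := ?_, smooth_τ := ?_
            smooth_σ := hσs.mono fun s hs => hs.2.1 }, ⟨0, h0S, 1, by rw [hσ0, act_one]⟩⟩
  · rintro _ ⟨s, hs, h', rfl⟩ h
    rw [act_mul, (huniq s hs _).1, (huniq s hs _).1]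
  · rintro _ ⟨s, hs, h', rfl⟩ h
    rw [act_mul, (huniq s hs _).2, (huniq s hs _).2]
  · intro s hs
    have := (huniq s hs 1).1
    rwa [act_one] at this
  · intro s hs
    have := (huniq s hs 1).2
    rwa [act_one] at this
  · rintro _ ⟨s, hs, h, rfl⟩
    obtain ⟨G₁, G₂, h1, -, h3⟩ := hloc s hs h
    refine (h1.congr_of_eventuallyEq ?_).contMDiffWithinAt
    filter_upwards [h3] with b hb
    rw [← (huniq _ hb.1 (G₂ b)).1, hb.2]
  · rintro _ ⟨s, hs, h, rfl⟩
    obtain ⟨G₁, G₂, -, h2, h3⟩ := hloc s hs h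
    refine (h2.congr_of_eventuallyEq ?_).contMDiffWithinAt
    filter_upwards [h3] with b hb
    rw [← (huniq _ hb.1 (G₂ b)).2, hb.2]

end Slices

/-! ### The orbit space as a manifold and as the base of a principal bundle -/

section Quotients

open Filter Set
open scoped Topology

variable {E EH R : Type*} [NormedAddCommGroup E] [NormedSpace ℝ E]
  [NormedAddCommGroup EH] [NormedSpace ℝ EH] [NormedAddCommGroup R] [NormedSpace ℝ R]
  {B H : Type*} {X : Type*} [TopologicalSpace B] [ChartedSpace E B]
  [TopologicalSpace H] [ChartedSpace EH H] [Group H]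
  {act : B → H → B} {π : B → X}

namespace LocalSlice

lemma mem_U_of_mem_image (s : LocalSlice E EH R act) (hfib : ∀ u v, π u = π v ↔ ∃ h, v = act u h)
    {b : B} (hb : π b ∈ π '' s.U) : b ∈ s.U := by
  obtain ⟨u, hu, hub⟩ := hb
  obtain ⟨h, rfl⟩ := (hfib u b).1 hub
  exact s.act_mem u hu h

lemma proj_σ_ρ (s : LocalSlice E EH R act) (hfib : ∀ u v, π u = π v ↔ ∃ h, v = act u h)
    {b : B} (hb : b ∈ s.U) : π (s.σ (s.ρ b)) = π b :=
  (hfib _ _).2 ⟨s.τ b, (s.act_σ b hb).symm⟩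

variable [TopologicalSpace X]

/-- The coordinate ρ is constant on orbits, so the representative chosen by `Function.surjInv` is
immaterial. -/
lemma ρ_surjInv (s : LocalSlice E EH R act) (hπ : IsOpenQuotientMap π)
    (hfib : ∀ u v, π u = π v ↔ ∃ h, v = act u h) {b : B} (hb : b ∈ s.U) :
    s.ρ (Function.surjInv hπ.surjective (π b)) = s.ρ b := by
  obtain ⟨h, hh⟩ := (hfib b _).1 (Function.surjInv_eq hπ.surjective (π b)).symm
  rw [hh, s.ρ_act b hb]

/-- The chart of the orbit space that is given by a slice. -/
def chart (s : LocalSlice E EH R act) (hπ : IsOpenQuotientMap π)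
    (hfib : ∀ u v, π u = π v ↔ ∃ h, v = act u h) : OpenPartialHomeomorph X R where
  toFun x := s.ρ (Function.surjInv hπ.surjective x)
  invFun r := π (s.σ r)
  source := π '' s.U
  target := s.S
  map_source' := by
    rintro _ ⟨b, hb, rfl⟩
    rw [s.ρ_surjInv hπ hfib hb]
    exact s.ρ_mem b hb
  map_target' r hr := ⟨_, s.σ_mem r hr, rfl⟩
  left_inv' := by
    rintro _ ⟨b, hb, rfl⟩
    rw [s.ρ_surjInv hπ hfib hb, s.proj_σ_ρ hfib hb]
  right_inv' r hr := by
    rw [s.ρ_surjInv hπ hfib (s.σ_mem r hr), s.ρ_σ r hr]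
  open_source := hπ.isOpenMap _ s.isOpen_U
  open_target := s.isOpen_S
  continuousOn_toFun := by
    rintro _ ⟨b, hb, rfl⟩
    refine ContinuousAt.continuousWithinAt ?_
    rw [← hπ.continuousAt_comp_iff]
    refine ((s.smooth_ρ.continuousOn.continuousAt (s.isOpen_U.mem_nhds hb))).congr ?_
    filter_upwards [s.isOpen_U.mem_nhds hb] with b' hb'
    exact (s.ρ_surjInv hπ hfib hb').symm
  continuousOn_invFun := hπ.continuous.comp_continuousOn s.smooth_σ.continuousOn

lemma chart_proj (s : LocalSlice E EH R act) (hπ : IsOpenQuotientMap π)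
    (hfib : ∀ u v, π u = π v ↔ ∃ h, v = act u h) {b : B} (hb : b ∈ s.U) :
    s.chart hπ hfib (π b) = s.ρ b :=
  s.ρ_surjInv hπ hfib hb

end LocalSlice

variable [TopologicalSpace X]

/-- The atlas of an orbit space that is given by slices. -/
abbrev orbitChartedSpace (hπ : IsOpenQuotientMap π) (hfib : ∀ u v, π u = π v ↔ ∃ h, v = act u h)
    (hs : ∀ u : B, ∃ s : LocalSlice E EH R act, u ∈ s.U) : ChartedSpace R X where
  atlas := range fun s : LocalSlice E EH R act => s.chart hπ hfib
  chartAt x := (hs (Function.surjInv hπ.surjective x)).choose.chart hπ hfib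
  mem_chart_source x := ⟨_, (hs (Function.surjInv hπ.surjective x)).choose_spec,
    Function.surjInv_eq hπ.surjective x⟩
  chart_mem_atlas _ := ⟨_, rfl⟩

/-- The transition between the charts of two slices s and s' is the smooth map `s'.ρ ∘ s.σ`. -/
theorem isManifold_orbitChartedSpace (hπ : IsOpenQuotientMap π)
    (hfib : ∀ u v, π u = π v ↔ ∃ h, v = act u h)
    (hs : ∀ u : B, ∃ s : LocalSlice E EH R act, u ∈ s.U) :
    @IsManifold ℝ _ R _ _ R _ 𝓘(ℝ, R) ∞ X _ (orbitChartedSpace hπ hfib hs) := by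
  let _ := orbitChartedSpace hπ hfib hs
  refine isManifold_of_contDiffOn 𝓘(ℝ, R) ∞ X ?_
  rintro _ _ ⟨s, rfl⟩ ⟨s', rfl⟩
  simp only [modelWithCornersSelf_coe, modelWithCornersSelf_coe_symm, Function.comp_id,
    Function.id_comp, preimage_id, range_id, inter_univ]
  rintro r ⟨hr, hr'⟩
  have hσ : s.σ r ∈ s'.U := s'.mem_U_of_mem_image hfib hr'
  have hrS : s.S ∈ 𝓝 r := s.isOpen_S.mem_nhds hr
  have h1 : ContMDiffAt 𝓘(ℝ, R) 𝓘(ℝ, E) ∞ s.σ r := s.smooth_σ.contMDiffAt hrS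
  have h2 : ContMDiffAt 𝓘(ℝ, E) 𝓘(ℝ, R) ∞ s'.ρ (s.σ r) :=
    s'.smooth_ρ.contMDiffAt (s'.isOpen_U.mem_nhds hσ)
  have h3 : ContMDiffAt 𝓘(ℝ, R) 𝓘(ℝ, R) ∞ (s'.ρ ∘ s.σ) r := h2.comp r h1
  refine (h3.contDiffAt.congr_of_eventuallyEq ?_).contDiffWithinAt
  filter_upwards [h1.continuousAt (s'.isOpen_U.mem_nhds hσ)] with t ht
  exact s'.chart_proj hπ hfib ht

/-- A slice is a local section in disguise: b ↦ (π b, τ b) is an equivariant trivialization, with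
inverse (x, h) ↦ σ(e x) h for the chart e. -/
theorem isPrincipalBundle_orbitChartedSpace (act_one : ∀ u, act u 1 = u)
    (act_mul : ∀ u a b, act (act u a) b = act u (a * b))
    (smooth_act : ContMDiff (𝓘(ℝ, E).prod 𝓘(ℝ, EH)) 𝓘(ℝ, E) ∞ (fun x : B × H => act x.1 x.2))
    (hπ : IsOpenQuotientMap π) (hfib : ∀ u v, π u = π v ↔ ∃ h, v = act u h)
    (hs : ∀ u : B, ∃ s : LocalSlice E EH R act, u ∈ s.U) :
    @IsPrincipalBundle E _ _ R _ _ EH _ _ B _ _ X _ (orbitChartedSpace hπ hfib hs) H _ _ _ act π := by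
  let _ := orbitChartedSpace hπ hfib hs
  have := isManifold_orbitChartedSpace hπ hfib hs
  have hπs : ContMDiff 𝓘(ℝ, E) 𝓘(ℝ, R) ∞ π := by
    intro b
    rw [contMDiffAt_iff_target]
    refine ⟨hπ.continuous.continuousAt, ?_⟩
    set s := (hs (Function.surjInv hπ.surjective (π b))).choose with hsdef
    have hb : b ∈ s.U := s.mem_U_of_mem_image hfib (mem_chart_source R (π b))
    refine (s.smooth_ρ.contMDiffAt (s.isOpen_U.mem_nhds hb)).congr_of_eventuallyEq ?_
    filter_upwards [s.isOpen_U.mem_nhds hb] with b' hb'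
    exact s.chart_proj hπ hfib hb'
  refine ⟨act_one, act_mul, smooth_act, fun u h => ((hfib _ _).2 ⟨h, rfl⟩).symm, fun x => ?_⟩
  obtain ⟨u, rfl⟩ := hπ.surjective x
  obtain ⟨s, hu⟩ := hs u
  set e := s.chart hπ hfib with he
  have hees : e.source = π '' s.U := rfl
  have hemax : e ∈ IsManifold.maximalAtlas 𝓘(ℝ, R) ∞ X :=
    IsManifold.subset_maximalAtlas ⟨s, rfl⟩
  have hpre : π ⁻¹' (π '' s.U) = s.U :=
    Subset.antisymm (fun b hb => s.mem_U_of_mem_image hfib hb) (subset_preimage_image _ _)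
  have hinvs : ContMDiffOn (𝓘(ℝ, R).prod 𝓘(ℝ, EH)) 𝓘(ℝ, E) ∞
      (fun y : X × H => act (s.σ (e y.1)) y.2) ((π '' s.U) ×ˢ univ) := by
    refine smooth_act.comp_contMDiffOn (f := fun y : X × H => (s.σ (e y.1), y.2)) ?_
    refine ContMDiffOn.prodMk ?_ contMDiff_snd.contMDiffOn
    refine s.smooth_σ.comp (t := s.S) (f := fun y : X × H => e y.1) ?_
      (fun y hy => e.map_source hy.1)
    exact (contMDiffOn_of_mem_maximalAtlas hemax).comp contMDiff_fst.contMDiffOn (fun y hy => hy.1)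
  have hfors : ContMDiffOn 𝓘(ℝ, E) (𝓘(ℝ, R).prod 𝓘(ℝ, EH)) ∞ (fun b => (π b, s.τ b)) s.U :=
    hπs.contMDiffOn.prodMk s.smooth_τ
  refine ⟨π '' s.U,
    { toFun := fun b => (π b, s.τ b)
      invFun := fun y => act (s.σ (e y.1)) y.2
      source := s.U
      target := (π '' s.U) ×ˢ univ
      map_source' := fun b hb => ⟨⟨b, hb, rfl⟩, trivial⟩
      map_target' := fun y hy => s.act_mem _ (s.σ_mem _ (e.map_source hy.1)) _
      left_inv' := fun b hb => by
        dsimp only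
        rw [he, s.chart_proj hπ hfib hb, s.act_σ b hb]
      right_inv' := fun y hy => by
        have h1 : e y.1 ∈ s.S := e.map_source hy.1
        refine Prod.ext ?_ ?_
        · change π (act (s.σ (e y.1)) y.2) = y.1
          rw [← (hfib _ _).2 ⟨y.2, rfl⟩]
          exact e.left_inv hy.1
        · change s.τ (act (s.σ (e y.1)) y.2) = y.2
          rw [s.τ_act _ (s.σ_mem _ h1), s.τ_σ _ h1, one_mul]
      open_source := s.isOpen_U
      open_target := e.open_source.prod isOpen_univ
      continuousOn_toFun := hfors.continuousOn
      continuousOn_invFun := hinvs.continuousOn },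
    e.open_source, ⟨u, hu, rfl⟩, hpre.symm, rfl, hfors, hinvs, fun b hb => ⟨rfl, s.τ_act b hb⟩⟩

end Quotients

/-! ### Consequences of local triviality -/

section PrincipalBundle

open Filter Set
open scoped Topology

variable {EB EM EH : Type*} [NormedAddCommGroup EB] [NormedSpace ℝ EB]
  [NormedAddCommGroup EM] [NormedSpace ℝ EM] [NormedAddCommGroup EH] [NormedSpace ℝ EH]
  {B M H : Type*} [TopologicalSpace B] [ChartedSpace EB B]
  [TopologicalSpace M] [ChartedSpace EM M] [TopologicalSpace H] [ChartedSpace EH H] [Group H]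
  {act : B → H → B} {p : B → M}

lemma IsPrincipalBundle.continuous_proj
    (h : IsPrincipalBundle (EB := EB) (EM := EM) (EH := EH) act p) : Continuous p := by
  rw [continuous_iff_continuousAt]
  intro b
  obtain ⟨U, φ, hU, hbU, hs, -, -, -, hφ⟩ := h.locally_trivial (p b)
  have hb : b ∈ φ.source := by rw [hs]; exact hbU
  refine (continuous_fst.continuousAt.comp (φ.continuousAt hb)).congr ?_
  filter_upwards [φ.open_source.mem_nhds hb] with c hc
  exact (hφ c hc).1

/-- In a trivialization the acting element is the quotient of the fibre coordinates of w and of its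
image, which is close to 1 when both are close to u. This is the properness hypothesis of the slice
theorem. -/
lemma IsPrincipalBundle.exists_nhds_of_act_mem [IsTopologicalGroup H]
    (h : IsPrincipalBundle (EB := EB) (EM := EM) (EH := EH) act p) (u : B) {V : Set H}
    (hV : V ∈ 𝓝 (1 : H)) : ∃ W ∈ 𝓝 u, ∀ w ∈ W, ∀ a, act w a ∈ W → a ∈ V := by
  obtain ⟨U, φ, hU, hbU, hs, -, -, -, hφ⟩ := h.locally_trivial (p u)
  have hu : u ∈ φ.source := by rw [hs]; exact hbU
  have h1 : Tendsto (fun x : H × H => x.1⁻¹ * x.2) (𝓝 ((φ u).2, (φ u).2)) (𝓝 1) := by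
    have : Continuous (fun x : H × H => x.1⁻¹ * x.2) := by fun_prop
    have h2 := this.tendsto ((φ u).2, (φ u).2)
    rwa [inv_mul_cancel] at h2
  obtain ⟨O₁, O₂, hO₁, hu₁, hO₂, hu₂, hO⟩ := mem_nhds_prod_iff'.1 (h1 hV)
  refine ⟨φ.source ∩ (fun b => (φ b).2) ⁻¹' (O₁ ∩ O₂),
    inter_mem (φ.open_source.mem_nhds hu) ((continuous_snd.continuousAt.comp
      (φ.continuousAt hu)).preimage_mem_nhds ((hO₁.inter hO₂).mem_nhds ⟨hu₁, hu₂⟩)), ?_⟩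
  rintro w ⟨hw, hw₁, -⟩ a ⟨-, -, ha⟩
  have h2 := hO (show ((φ w).2, (φ (act w a)).2) ∈ O₁ ×ˢ O₂ from ⟨hw₁, ha⟩)
  simpa [(hφ w hw).2 a] using h2

/-- Two points of one fibre differ by the quotient of their fibre coordinates; this turns membership
in a Q-orbit into a condition on a continuous P-valued function. -/
lemma IsPrincipalBundle.act_eq_of_snd_eq
    (h : IsPrincipalBundle (EB := EB) (EM := EM) (EH := EH) act p)
    {U : Set M} {φ : OpenPartialHomeomorph B (M × H)} (hs : φ.source = p ⁻¹' U)
    (hφ : ∀ u ∈ φ.source, (φ u).1 = p u ∧ ∀ h, (φ (act u h)).2 = (φ u).2 * h)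
    {u v : B} (hu : u ∈ φ.source) (hv : v ∈ φ.source) (huv : p u = p v) :
    act u ((φ u).2⁻¹ * (φ v).2) = v := by
  have h1 : act u ((φ u).2⁻¹ * (φ v).2) ∈ φ.source := by
    rw [hs, mem_preimage, h.proj_act]
    rw [hs] at hu; exact hu
  refine φ.injOn h1 hv (Prod.ext ?_ ?_)
  · rw [(hφ _ h1).1, (hφ _ hv).1, h.proj_act, huv]
  · rw [(hφ _ hu).2, mul_inv_cancel_left]

end PrincipalBundle

/-! ### The correspondence space of a parabolic geometry -/

section CorrespondenceSpace

open Filter Set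
open scoped Topology

section Group

variable {G B : Type*} [Group G] {P Q : Subgroup G} {act : B → P → B} {hQP : Q ≤ P}

lemma toCorrespondenceSpace_eq_iff (act_one : ∀ u, act u 1 = u)
    (act_mul : ∀ u a b, act (act u a) b = act u (a * b)) (u v : B) :
    toCorrespondenceSpace act hQP u = toCorrespondenceSpace act hQP v ↔
      ∃ q : Q, v = restrictAct act hQP u q := by
  have hr : Equivalence (fun u v : B => ∃ q : Q, v = restrictAct act hQP u q) := by
    refine ⟨fun u => ⟨1, ?_⟩, ?_, ?_⟩
    · simp [restrictAct, act_one]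
    · rintro u _ ⟨q, rfl⟩
      exact ⟨q⁻¹, by simp [restrictAct, act_mul, act_one]⟩
    · rintro u _ _ ⟨q, rfl⟩ ⟨q', rfl⟩
      exact ⟨q * q', by simp [restrictAct, act_mul]⟩
  exact Quot.eq.trans hr.eqvGen_iff

/-- The saturation of an open set is the union of its translates under Q. -/
lemma isOpenQuotientMap_toCorrespondenceSpace [TopologicalSpace B] (act_one : ∀ u, act u 1 = u)
    (act_mul : ∀ u a b, act (act u a) b = act u (a * b))
    (hcont : ∀ a, Continuous fun u => act u a) :
    IsOpenQuotientMap (toCorrespondenceSpace act hQP) := by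
  refine ⟨Quot.mk_surjective, continuous_quot_mk, fun U hU => ?_⟩
  have : toCorrespondenceSpace act hQP ⁻¹' (toCorrespondenceSpace act hQP '' U) =
      ⋃ q : Q, (fun u => restrictAct act hQP u q) ⁻¹' U := by
    ext u
    simp only [mem_preimage, mem_image, mem_iUnion]
    constructor
    · rintro ⟨v, hv, hvu⟩
      obtain ⟨q, rfl⟩ := (toCorrespondenceSpace_eq_iff act_one act_mul u v).1 hvu.symm
      exact ⟨q, hv⟩
    · rintro ⟨q, hq⟩
      exact ⟨_, hq, ((toCorrespondenceSpace_eq_iff act_one act_mul _ _).2 ⟨q, rfl⟩).symm⟩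
  refine isOpen_coinduced.2 ?_
  change IsOpen (toCorrespondenceSpace act hQP ⁻¹' (toCorrespondenceSpace act hQP '' U))
  rw [this]
  exact isOpen_iUnion fun q => hU.preimage (hcont _)

end Group

variable {EG EP EQ EB EN : Type*}
  [NormedAddCommGroup EG] [NormedSpace ℝ EG] [FiniteDimensional ℝ EG]
  [NormedAddCommGroup EP] [NormedSpace ℝ EP]
  [NormedAddCommGroup EQ] [NormedSpace ℝ EQ]
  [NormedAddCommGroup EB] [NormedSpace ℝ EB] [NormedAddCommGroup EN] [NormedSpace ℝ EN]
  {G : Type*} [TopologicalSpace G] [ChartedSpace EG G] [Group G] [LieGroup 𝓘(ℝ, EG) ∞ G]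
  {grP grQ : Grading (GroupLieAlgebra 𝓘(ℝ, EG) G)} {P Q : Subgroup G}
  [ChartedSpace EP P] [ChartedSpace EQ Q]
  {B : Type*} [TopologicalSpace B] [ChartedSpace EB B]
  {N : Type*} [TopologicalSpace N] [ChartedSpace EN N]
  {act : B → P → B} {p : B → N} {θ : OneForm EG G EB B}

/-- Points in different fibres over N are separated there. In one fibre, the quotient of the fibre
coordinates lies outside the closed subgroup Q, and this persists nearby. -/
theorem t2Space_correspondenceSpace [T2Space N] (hQ : IsParabolicSubgroup (E' := EQ) grQ Q)
    (hQP : Q ≤ P) (h : IsPrincipalBundle (EB := EB) (EM := EN) (EH := EP) act p) :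
    T2Space (CorrespondenceSpace act hQP) := by
  have : IsTopologicalGroup G := topologicalGroup_of_lieGroup 𝓘(ℝ, EG) ∞
  have hcont : ∀ a, Continuous fun u => act u a := fun a =>
    h.smooth_act.continuous.comp (continuous_id.prodMk continuous_const)
  rw [t2Space_iff_of_isOpenQuotientMap
    (isOpenQuotientMap_toCorrespondenceSpace (hQP := hQP) h.act_one h.act_mul hcont),
    ← isOpen_compl_iff, isOpen_iff_mem_nhds]
  rintro ⟨u, v⟩ huv
  simp only [mem_compl_iff, mem_ofPred_eq, toCorrespondenceSpace_eq_iff h.act_one h.act_mul] at huv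
  by_cases hp : p u = p v
  · obtain ⟨U, φ, hU, hbU, hs, -, -, -, hφ⟩ := h.locally_trivial (p u)
    have hu : u ∈ φ.source := by rw [hs]; exact hbU
    have hv : v ∈ φ.source := by rw [hs, mem_preimage, ← hp]; exact hbU
    have hcl : IsOpen {x : P | (x : G) ∉ Q} := (hQ.isClosed.preimage continuous_subtype_val).isOpen_compl
    have hc : ContinuousAt (fun x : B × B => (φ x.1).2⁻¹ * (φ x.2).2) (u, v) := by
      refine ContinuousAt.mul (ContinuousAt.inv ?_) ?_
      · exact continuous_snd.continuousAt.comp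
          (ContinuousAt.comp (φ.continuousAt hu) continuous_fst.continuousAt)
      · exact continuous_snd.continuousAt.comp
          (ContinuousAt.comp (φ.continuousAt hv) continuous_snd.continuousAt)
    have hnot : ((φ u).2⁻¹ * (φ v).2) ∈ {x : P | (x : G) ∉ Q} := by
      intro hmem
      refine huv ⟨⟨_, hmem⟩, ?_⟩
      exact (h.act_eq_of_snd_eq hs hφ hu hv hp).symm
    filter_upwards [hc.preimage_mem_nhds (hcl.mem_nhds hnot),
      (φ.open_source.prod φ.open_source).mem_nhds (show (u, v) ∈ _ from ⟨hu, hv⟩)]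
    rintro ⟨a, b⟩ hab ⟨ha, -⟩ heq
    obtain ⟨q, hq⟩ := (toCorrespondenceSpace_eq_iff h.act_one h.act_mul _ _).1 heq
    dsimp only at hq ha
    subst hq
    refine hab ?_
    change (((φ a).2⁻¹ * (φ (act a (Subgroup.inclusion hQP q))).2 : P) : G) ∈ Q
    rw [(hφ a ha).2, inv_mul_cancel_left]
    exact q.2
  · have hpc := h.continuous_proj
    have hop : IsOpen {x : B × B | p x.1 ≠ p x.2} :=
      (isClosed_eq (hpc.comp continuous_fst) (hpc.comp continuous_snd)).isOpen_compl
    filter_upwards [hop.mem_nhds hp]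
    rintro ⟨a, b⟩ hab heq
    obtain ⟨q, hq⟩ := (toCorrespondenceSpace_eq_iff h.act_one h.act_mul _ _).1 heq
    dsimp only at hq
    subst hq
    exact hab (h.proj_act _ _).symm

/-- Smoothness into P can be tested in G because P is immersed, and in G the map is the smooth
inclusion of Q. -/
lemma contMDiff_inclusion [LieGroup 𝓘(ℝ, EP) ∞ P] [LieGroup 𝓘(ℝ, EQ) ∞ Q]
    (hP : IsParabolicSubgroup (E' := EP) grP P) (hQ : IsParabolicSubgroup (E' := EQ) grQ Q)
    (hQP : Q ≤ P) : ContMDiff 𝓘(ℝ, EQ) 𝓘(ℝ, EP) ∞ (Subgroup.inclusion hQP) :=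
  (ContMDiff.iff_comp_isImmersion hP.isSmoothEmbedding.isImmersion).2
    ⟨continuous_inclusion hQP, hQ.isSmoothEmbedding.contMDiff⟩

lemma fundamental_restrictAct [IsManifold 𝓘(ℝ, EB) ∞ B] [LieGroup 𝓘(ℝ, EP) ∞ P]
    [LieGroup 𝓘(ℝ, EQ) ∞ Q]
    (hP : IsParabolicSubgroup (E' := EP) grP P) (hQ : IsParabolicSubgroup (E' := EQ) grQ Q)
    (hQP : Q ≤ P) (h : IsCartanGeometry (EM := EN) (EH := EP) act p θ)
    (u : B) (A : TangentSpace 𝓘(ℝ, EQ) (1 : Q)) :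
    θ (restrictAct act hQP u 1) (mfderiv 𝓘(ℝ, EQ) 𝓘(ℝ, EB)
        (fun q : Q => restrictAct act hQP u q) 1 A) =
      mfderiv 𝓘(ℝ, EQ) 𝓘(ℝ, EG) (Subtype.val : Q → G) 1 A := by
  have hi : MDifferentiableAt 𝓘(ℝ, EQ) 𝓘(ℝ, EP) (Subgroup.inclusion hQP) 1 :=
    (contMDiff_inclusion hP hQ hQP).contMDiffAt.mdifferentiableAt (by simp)
  have ho : MDifferentiableAt 𝓘(ℝ, EP) 𝓘(ℝ, EB) (fun a : P => act u a)
      (Subgroup.inclusion hQP 1) :=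
    (h.isPrincipalBundle.smooth_act.comp
      (contMDiff_const.prodMk contMDiff_id)).contMDiffAt.mdifferentiableAt (n := ∞) (by simp)
  have hv : MDifferentiableAt 𝓘(ℝ, EP) 𝓘(ℝ, EG) (Subtype.val : P → G)
      (Subgroup.inclusion hQP 1) :=
    hP.isSmoothEmbedding.contMDiff.contMDiffAt.mdifferentiableAt (by simp)
  have h1 := mfderiv_comp (1 : Q) ho hi
  have h2 := mfderiv_comp (1 : Q) hv hi
  have h3 := h.fundamental u (mfderiv 𝓘(ℝ, EQ) 𝓘(ℝ, EP) (Subgroup.inclusion hQP) 1 A)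
  have h1' := congrArg (fun T : EQ →L[ℝ] EB => T A) h1
  have h2' := congrArg (fun T : EQ →L[ℝ] EG => T A) h2
  exact (congrArg (θ (act u 1)) h1').trans (h3.trans h2'.symm)

variable [IsManifold 𝓘(ℝ, EB) ∞ B] [LieGroup 𝓘(ℝ, EP) ∞ P] [LieGroup 𝓘(ℝ, EQ) ∞ Q]

/-- Applying θ to the derivative of the orbit map returns the generator A as an element of 𝔤, and Q
→ G is an immersion. -/
lemma injective_mfderiv_orbit
    (hP : IsParabolicSubgroup (E' := EP) grP P) (hQ : IsParabolicSubgroup (E' := EQ) grQ Q)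
    (hQP : Q ≤ P) (h : IsCartanGeometry (EM := EN) (EH := EP) act p θ) (u : B) :
    Function.Injective (mfderiv 𝓘(ℝ, EQ) 𝓘(ℝ, EB)
      (fun q : Q => restrictAct act hQP u q) 1) := by
  intro A A' hAA
  refine mfderiv_injective_of_isImmersion hQ.isSmoothEmbedding.isImmersion 1 ?_
  rw [← fundamental_restrictAct hP hQ hQP h u A, ← fundamental_restrictAct hP hQ hQP h u A', hAA]

variable [FiniteDimensional ℝ EQ] [FiniteDimensional ℝ EB]

/-- The correspondence space of a parabolic geometry is the base of a parabolic geometry. -/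
theorem exists_isParabolicGeometry_correspondenceSpace [T2Space N] [SecondCountableTopology B]
    (hQ : IsParabolicSubgroup (E' := EQ) grQ Q) (hQP : Q ≤ P)
    (hg : IsParabolicGeometry (EP := EP) (EM := EN) grP act p θ) :
    ∃ (n : ℕ) (_ : ChartedSpace (EuclideanSpace ℝ (Fin n)) (CorrespondenceSpace act hQP)),
      IsManifold 𝓘(ℝ, EuclideanSpace ℝ (Fin n)) ∞ (CorrespondenceSpace act hQP) ∧
      T2Space (CorrespondenceSpace act hQP) ∧
      SecondCountableTopology (CorrespondenceSpace act hQP) ∧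
      IsParabolicGeometry (EP := EQ) (EM := EuclideanSpace ℝ (Fin n)) grQ
        (restrictAct act hQP) (toCorrespondenceSpace act hQP) θ := by
  have : IsTopologicalGroup G := topologicalGroup_of_lieGroup 𝓘(ℝ, EG) ∞
  have hP := hg.isParabolicSubgroup
  have h := hg.isCartanGeometry
  have hb := h.isPrincipalBundle
  have hcont : ∀ a, Continuous fun u => act u a := fun a =>
    hb.smooth_act.continuous.comp (continuous_id.prodMk continuous_const)
  have hπ := isOpenQuotientMap_toCorrespondenceSpace (hQP := hQP) hb.act_one hb.act_mul hcont
  have hfib := toCorrespondenceSpace_eq_iff (hQP := hQP) hb.act_one hb.act_mul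
  have act_one : ∀ u, restrictAct act hQP u 1 = u := fun u => by simp [restrictAct, hb.act_one]
  have act_mul : ∀ u a b, restrictAct act hQP (restrictAct act hQP u a) b =
      restrictAct act hQP u (a * b) := fun u a b => by simp [restrictAct, hb.act_mul]
  have smooth_act : ContMDiff (𝓘(ℝ, EB).prod 𝓘(ℝ, EQ)) 𝓘(ℝ, EB) ∞
      (fun x : B × Q => restrictAct act hQP x.1 x.2) :=
    hb.smooth_act.comp (contMDiff_fst.prodMk
      ((contMDiff_inclusion hP hQ hQP).comp contMDiff_snd))
  have hs : ∀ u : B, ∃ s : LocalSlice EB EQ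
      (EuclideanSpace ℝ (Fin (Module.finrank ℝ EB - Module.finrank ℝ EQ)))
      (restrictAct act hQP), u ∈ s.U := by
    intro u
    have hinj := injective_mfderiv_orbit hP hQ hQP h u
    refine exists_localSlice act_one act_mul smooth_act u hinj (fun V hV => ?_) ?_
    -- Q carries the topology induced from G, so the properness estimate for P restricts to Q.
    · obtain ⟨V', hV', hVV⟩ := mem_nhds_subtype _ _ _ |>.1 hV
      obtain ⟨W, hW, hWV⟩ := hb.exists_nhds_of_act_mem u
        (V := ((↑) : P → G) ⁻¹' V') (continuous_subtype_val.continuousAt.preimage_mem_nhds hV')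
      exact ⟨W, hW, fun w hw q hq => hVV (hWV w hw _ hq)⟩
    · rw [finrank_euclideanSpace_fin]
      refine Nat.sub_add_cancel ?_
      let L : EQ →L[ℝ] EB := mfderiv 𝓘(ℝ, EQ) 𝓘(ℝ, EB)
        (fun q : Q => restrictAct act hQP u q) 1
      exact LinearMap.finrank_le_finrank_of_injective (f := L.toLinearMap) hinj
  refine ⟨_, orbitChartedSpace hπ hfib hs, isManifold_orbitChartedSpace hπ hfib hs,
    t2Space_correspondenceSpace hQ hQP hb,
    hπ.isQuotientMap.secondCountableTopology hπ.isOpenMap, ?_⟩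
  let _ := orbitChartedSpace hπ hfib hs
  -- Smoothness and bijectivity of θ do not involve the structure group; equivariance and the
  -- condition on fundamental fields restrict to Q.
  exact ⟨hQ, isPrincipalBundle_orbitChartedSpace act_one act_mul smooth_act hπ hfib hs,
    h.smooth_form, fun q u ξ => h.equivariant (Subgroup.inclusion hQP q) u ξ,
    fundamental_restrictAct hP hQ hQP h, h.isIso⟩

end CorrespondenceSpace

/-! ### Normality for nested parabolic subgroups -/

section Normality

variable {EG EP EQ EB : Type*}
  [NormedAddCommGroup EG] [NormedSpace ℝ EG] [FiniteDimensional ℝ EG]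
  [NormedAddCommGroup EP] [NormedSpace ℝ EP] [NormedAddCommGroup EQ] [NormedSpace ℝ EQ]
  [NormedAddCommGroup EB] [NormedSpace ℝ EB]
  {G : Type*} [TopologicalSpace G] [ChartedSpace EG G] [Group G] [LieGroup 𝓘(ℝ, EG) ∞ G]
  [LieAlgebra.IsSemisimple ℝ (GroupLieAlgebra 𝓘(ℝ, EG) G)]
  {grP grQ : Grading (GroupLieAlgebra 𝓘(ℝ, EG) G)} {P Q : Subgroup G}
  [ChartedSpace EP P] [ChartedSpace EQ Q] {B : Type*} [TopologicalSpace B] [ChartedSpace EB B]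
  {θ : OneForm EG G EB B}

/-- Normality is inherited by smaller parabolic subgroups. -/
theorem IsNormal.of_subgroup_le (hP : IsParabolicSubgroup (E' := EP) grP P)
    (hQ : IsParabolicSubgroup (E' := EQ) grQ Q) (hQP : Q ≤ P) (h : IsNormal grP θ) :
    IsNormal grQ θ := by
  have : FiniteDimensional ℝ (GroupLieAlgebra 𝓘(ℝ, EG) G) :=
    inferInstanceAs (FiniteDimensional ℝ EG)
  exact h.of_pPlus_le (Grading.pPlus_le_pPlus (hP.filt_zero_le hQ hQP))

end Normality

/-! ### Manifolds presented by a map into a vector space -/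

section EmbeddedManifolds

open Filter Set
open scoped Topology

/-- The distinguished charts of `M` are smooth, and have smooth inverses, as seen through the map
`ι` into a vector space. -/
structure IsEmbeddedAtlas {E F M : Type*} [NormedAddCommGroup E] [NormedSpace ℝ E]
    [NormedAddCommGroup F] [NormedSpace ℝ F] [TopologicalSpace M] [ChartedSpace E M]
    (ι : M → F) : Prop where
  exists_retract : ∀ x : M, ∃ ρ : F → E, ∀ y ∈ (chartAt E x).source,
    chartAt E x y = ρ (ι y) ∧ ContDiffAt ℝ ∞ ρ (ι y)
  smooth_symm : ∀ x : M, ContDiffOn ℝ ∞ (fun v => ι ((chartAt E x).symm v)) (chartAt E x).target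
  exists_eq_chartAt : ∀ e ∈ atlas E M, ∃ x, e = chartAt E x

namespace IsEmbeddedAtlas

variable {E F M : Type*} [NormedAddCommGroup E] [NormedSpace ℝ E]
  [NormedAddCommGroup F] [NormedSpace ℝ F] [TopologicalSpace M] [ChartedSpace E M] {ι : M → F}

/-- A transition map is a chart in the form ρ ∘ ι composed with an inverse chart, and both ρ and ι ∘
(inverse chart) are smooth. -/
theorem isManifold (h : IsEmbeddedAtlas (E := E) ι) : IsManifold 𝓘(ℝ, E) ∞ M := by
  refine isManifold_of_contDiffOn 𝓘(ℝ, E) ∞ M fun e e' he he' => ?_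
  obtain ⟨x, rfl⟩ := h.exists_eq_chartAt e he
  obtain ⟨x', rfl⟩ := h.exists_eq_chartAt e' he'
  simp only [modelWithCornersSelf_coe, modelWithCornersSelf_coe_symm, Function.comp_id,
    Function.id_comp, preimage_id, range_id, inter_univ]
  obtain ⟨ρ, hρ⟩ := h.exists_retract x'
  rintro v ⟨hv, hv'⟩
  have h1 : ContDiffAt ℝ ∞ (fun v => ι ((chartAt E x).symm v)) v :=
    (h.smooth_symm x).contDiffAt ((chartAt E x).open_target.mem_nhds hv)
  have h2 : ContDiffAt ℝ ∞ (ρ ∘ fun v => ι ((chartAt E x).symm v)) v :=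
    ContDiffAt.comp v (hρ _ hv').2 h1
  refine (h2.congr_of_eventuallyEq ?_).contDiffWithinAt
  filter_upwards [((chartAt E x).symm.trans (chartAt E x')).open_source.mem_nhds ⟨hv, hv'⟩] with w hw
  exact (hρ _ hw.2).1

theorem contMDiff (h : IsEmbeddedAtlas (E := E) ι) : ContMDiff 𝓘(ℝ, E) 𝓘(ℝ, F) ∞ ι := by
  have := h.isManifold
  intro x
  have h1 := (h.smooth_symm x).contDiffAt
    ((chartAt E x).open_target.mem_nhds (mem_chart_target E x))
  have h2 : ContMDiffAt 𝓘(ℝ, E) 𝓘(ℝ, F) ∞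
      ((fun v => ι ((chartAt E x).symm v)) ∘ chartAt E x) x :=
    h1.contMDiffAt.comp x (contMDiffAt_of_mem_maximalAtlas
      (IsManifold.chart_mem_maximalAtlas x) (mem_chart_source E x))
  refine h2.congr_of_eventuallyEq ?_
  filter_upwards [(chartAt E x).open_source.mem_nhds (mem_chart_source E x)] with y hy
  simp only [Function.comp_apply, (chartAt E x).left_inv hy]

/-- The charts are restrictions of smooth maps of the ambient space, so a continuous map into M is
smooth once its image in the ambient space moves smoothly. -/
theorem contMDiffAt_of_comp (h : IsEmbeddedAtlas (E := E) ι) {E' H' X : Type*}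
    [NormedAddCommGroup E'] [NormedSpace ℝ E'] [TopologicalSpace H'] {I : ModelWithCorners ℝ E' H'}
    [TopologicalSpace X] [ChartedSpace H' X] {f : X → M} {x : X} (hf : ContinuousAt f x)
    (hιf : ContMDiffAt I 𝓘(ℝ, F) ∞ (fun y => ι (f y)) x) : ContMDiffAt I 𝓘(ℝ, E) ∞ f x := by
  rw [contMDiffAt_iff_target]
  refine ⟨hf, ?_⟩
  obtain ⟨ρ, hρ⟩ := h.exists_retract (f x)
  have h1 : ContMDiffAt I 𝓘(ℝ, E) ∞ (ρ ∘ fun y => ι (f y)) x :=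
    (hρ (f x) (mem_chart_source E _)).2.contMDiffAt.comp x hιf
  refine h1.congr_of_eventuallyEq ?_
  filter_upwards [hf.preimage_mem_nhds
    ((chartAt E (f x)).open_source.mem_nhds (mem_chart_source E _))] with y hy
  exact (hρ _ hy).1

theorem contMDiff_of_comp (h : IsEmbeddedAtlas (E := E) ι) {E' H' X : Type*}
    [NormedAddCommGroup E'] [NormedSpace ℝ E'] [TopologicalSpace H'] {I : ModelWithCorners ℝ E' H'}
    [TopologicalSpace X] [ChartedSpace H' X] {f : X → M} (hf : Continuous f)
    (hιf : ContMDiff I 𝓘(ℝ, F) ∞ (fun y => ι (f y))) : ContMDiff I 𝓘(ℝ, E) ∞ f :=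
  fun x => h.contMDiffAt_of_comp hf.continuousAt (hιf x)

theorem mfd_eq (h : IsEmbeddedAtlas (E := E) ι) (x : M) (v : E) :
    (mfderiv 𝓘(ℝ, E) 𝓘(ℝ, F) ι x v : F) =
      fderiv ℝ (fun w => ι ((chartAt E x).symm w)) (chartAt E x x) v := by
  have := h.isManifold
  have h1 := (h.contMDiff x).mdifferentiableAt (by simp)
  exact mfd_eq_fderiv (f := ι) h1 v

end IsEmbeddedAtlas

variable {E A M : Type*} [NormedAddCommGroup E] [NormedSpace ℝ E]
  [Group M] [TopologicalSpace M] [IsTopologicalGroup M]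

/-- The atlas of a topological group consisting of the left translates of a chart at `1`. -/
abbrev leftTranslateChartedSpace (e : OpenPartialHomeomorph M E) (he : 1 ∈ e.source) :
    ChartedSpace E M where
  atlas := range fun g : M => (Homeomorph.mulLeft g⁻¹).transOpenPartialHomeomorph e
  chartAt g := (Homeomorph.mulLeft g⁻¹).transOpenPartialHomeomorph e
  mem_chart_source g := by simpa using he
  chart_mem_atlas g := ⟨g, rfl⟩

variable [NormedRing A] [NormedAlgebra ℝ A] {ι : M →* A} {e : OpenPartialHomeomorph M E}

/-- Left translation by g becomes multiplication by ι g, a linear map of the ambient algebra, so one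
good chart at 1 suffices. -/
theorem isEmbeddedAtlas_leftTranslate (he : 1 ∈ e.source) {ρ : A → E}
    (hρ : ∀ y ∈ e.source, e y = ρ (ι y) ∧ ContDiffAt ℝ ∞ ρ (ι y))
    (hs : ContDiffOn ℝ ∞ (fun v => ι (e.symm v)) e.target) :
    @IsEmbeddedAtlas E A M _ _ _ _ _ (leftTranslateChartedSpace e he) ι := by
  let _ := leftTranslateChartedSpace e he
  refine ⟨fun g => ⟨fun a => ρ (ι g⁻¹ * a), fun y hy => ?_⟩, fun g => ?_, ?_⟩
  · have h1 := hρ (g⁻¹ * y) hy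
    rw [map_mul] at h1
    refine ⟨h1.1, ?_⟩
    exact ContDiffAt.comp (ι y) (f := fun a => ι g⁻¹ * a) h1.2 (by fun_prop)
  · have : (fun v => ι ((chartAt E g).symm v)) = fun v => ι g * ι (e.symm v) := by
      ext v
      rw [← map_mul]
      refine congrArg ι ?_
      change g⁻¹⁻¹ * e.symm v = _
      rw [inv_inv]
    rw [this]
    exact contDiffOn_const.mul hs
  · rintro _ ⟨g, rfl⟩
    exact ⟨g, rfl⟩

variable [CompleteSpace A] [ChartedSpace E M]

/-- Seen in A, the group operations are restrictions of multiplication and of `Ring.inverse`, which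
is smooth at units. -/
theorem lieGroup_of_isEmbeddedAtlas (h : IsEmbeddedAtlas (E := E) ι) :
    LieGroup 𝓘(ℝ, E) ∞ M := by
  have := h.isManifold
  have hι := h.contMDiff
  refine { contMDiff_mul := ?_, contMDiff_inv := ?_ }
  · refine h.contMDiff_of_comp continuous_mul ?_
    simp only [map_mul]
    exact (contDiff_fst.mul contDiff_snd).contMDiff.comp
      ((hι.comp contMDiff_fst).prodMk_space (hι.comp contMDiff_snd))
  · refine h.contMDiff_of_comp continuous_inv fun x => ?_
    let u : M → Aˣ := fun y => Units.map ι (toUnits y)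
    have h1 : (fun y => ι y⁻¹) = fun y => Ring.inverse (ι y) := by
      ext y
      exact (Ring.inverse_unit (u y)).symm
    rw [h1]
    have h2 : ContDiffAt ℝ ∞ Ring.inverse (ι x) := contDiffAt_ringInverse ℝ (u x)
    exact h2.contMDiffAt.comp x (hι x)

end EmbeddedManifolds

/-! ### A common chart for SL and its block triangular subgroups -/

section UnimodularGroups

open Filter Set
open scoped Topology

variable {n : Type*} [Fintype n] [DecidableEq n] {A : Type*} [NormedRing A]
  [NormedAlgebra ℝ A] (m : A ≃ₐ[ℝ] Matrix n n ℝ) (b : n → ℤ)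

/-- The block triangular matrices of trace zero, in a matrix algebra `A`. -/
def slb : Submodule ℝ A where
  carrier := {a | (m a).trace = 0 ∧ (m a).BlockTriangular b}
  add_mem' h h' := ⟨by rw [map_add, Matrix.trace_add, h.1, h'.1, add_zero],
    by rw [map_add]; exact h.2.add h'.2⟩
  zero_mem' := ⟨by simp, by rw [map_zero]; exact Matrix.blockTriangular_zero⟩
  smul_mem' c a h := ⟨by rw [map_smul, Matrix.trace_smul, h.1, smul_zero],
    by intro i j hij; rw [map_smul, Matrix.smul_apply, h.2 hij, smul_zero]⟩

lemma mem_slb {a : A} : a ∈ slb m b ↔ (m a).trace = 0 ∧ (m a).BlockTriangular b := Iff.rfl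

/-- The scalar that turns a matrix of positive determinant into a unimodular one. -/
def unimodularScale (a : A) : ℝ := (m a).det ^ (-(Fintype.card n : ℝ)⁻¹)

lemma unimodularScale_pos {a : A} (h : 0 < (m a).det) : 0 < unimodularScale m a :=
  Real.rpow_pos_of_pos h _

/-- Only one positive multiple of a matrix has determinant 1, so the normalizing scalar recovers c.
-/
lemma unimodularScale_eq {a : A} {c : ℝ} [Nonempty n] (hc : 0 < c) (h : (m (c • a)).det = 1) :
    0 < (m a).det ∧ unimodularScale m a = c := by
  rw [map_smul, Matrix.det_smul] at h
  have h1 : (m a).det = (c⁻¹) ^ Fintype.card n := by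
    rw [inv_pow]; exact eq_inv_of_mul_eq_one_right h
  refine ⟨by rw [h1]; positivity, ?_⟩
  rw [unimodularScale, Real.rpow_neg (by rw [h1]; positivity), h1,
    Real.pow_rpow_inv_natCast (by positivity) Fintype.card_ne_zero, inv_inv]

lemma det_unimodularScale_smul [Nonempty n] {a : A} (h : 0 < (m a).det) :
    (m (unimodularScale m a • a)).det = 1 := by
  rw [map_smul, Matrix.det_smul, unimodularScale, Real.rpow_neg h.le, inv_pow,
    Real.rpow_inv_natCast_pow h.le Fintype.card_ne_zero, inv_mul_cancel₀ h.ne']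

/-- `ι` identifies `M` with the group of unimodular block triangular matrices. -/
structure IsUnimodularGroup {M : Type*} [Group M] [TopologicalSpace M] (ι : M →* A) : Prop where
  isEmbedding : Topology.IsEmbedding ι
  mem_range_iff : ∀ a, a ∈ range ι ↔ (m a).det = 1 ∧ (m a).BlockTriangular b

variable {m b} in
lemma IsUnimodularGroup.det_eq_one {M : Type*} [Group M] [TopologicalSpace M] {ι : M →* A}
    (h : IsUnimodularGroup m b ι) (g : M) : (m (ι g)).det = 1 :=
  ((h.mem_range_iff _).1 ⟨g, rfl⟩).1

variable {m b} in
lemma IsUnimodularGroup.blockTriangular {M : Type*} [Group M] [TopologicalSpace M]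
    {ι : M →* A} (h : IsUnimodularGroup m b ι) (g : M) : (m (ι g)).BlockTriangular b :=
  ((h.mem_range_iff _).1 ⟨g, rfl⟩).2

/-- The inverse of the chart of a unimodular group at the identity. -/
def unimodularParam (X : slb m b) : A := unimodularScale m (1 + X) • (1 + X)

variable {m b} in
lemma IsUnimodularGroup.exists_eq_unimodularParam [Nonempty n] {M : Type*} [Group M]
    [TopologicalSpace M] {ι : M →* A} (h : IsUnimodularGroup m b ι) {X : slb m b}
    (hX : 0 < (m (1 + X)).det) : ∃ g : M, ι g = unimodularParam m b X := by
  refine (h.mem_range_iff _).2 ⟨det_unimodularScale_smul m hX, fun i j hij => ?_⟩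
  have h1 : (m (1 + X)).BlockTriangular b := by
    rw [map_add, map_one]; exact Matrix.blockTriangular_one.add X.2.2
  rw [unimodularParam, map_smul, Matrix.smul_apply, h1 hij, smul_zero]

variable [FiniteDimensional ℝ A]

lemma contDiff_entry (i j : n) : ContDiff ℝ ∞ fun a => m a i j :=
  (LinearMap.toContinuousLinearMap
    (Matrix.entryLinearMap ℝ ℝ i j ∘ₗ m.toLinearMap)).contDiff

lemma contDiff_det : ContDiff ℝ ∞ fun a => (m a).det := by
  simp only [Matrix.det_apply']
  exact ContDiff.sum fun σ _ => contDiff_const.mul (contDiff_prod fun i _ => contDiff_entry m _ _)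

lemma contDiff_trace : ContDiff ℝ ∞ fun a => (m a).trace :=
  (LinearMap.toContinuousLinearMap
    (Matrix.traceLinearMap n ℝ ℝ ∘ₗ m.toLinearMap)).contDiff

lemma contDiffAt_unimodularScale {a : A} (h : 0 < (m a).det) :
    ContDiffAt ℝ ∞ (unimodularScale m) a :=
  (contDiff_det m).contDiffAt.rpow_const_of_ne h.ne'

/-- The derivative of det at 1 is the trace, so the scale is stationary in traceless directions and
`unimodularParam` is tangent to the inclusion at 0. -/
lemma hasFDerivAt_unimodularScale_one : HasFDerivAt (unimodularScale m)
    (fderiv ℝ (unimodularScale m) 1) 1 ∧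
    ∀ a, (m a).trace = 0 → fderiv ℝ (unimodularScale m) 1 a = 0 := by
  have h0 : 0 < (m 1).det := by simp
  have hd : HasFDerivAt (unimodularScale m) (fderiv ℝ (unimodularScale m) 1) 1 :=
    ((contDiffAt_unimodularScale m h0).differentiableAt (by simp)).hasFDerivAt
  have hdet : HasFDerivAt (fun a => (m a).det) (fderiv ℝ (fun a => (m a).det) 1) 1 :=
    ((contDiff_det m).contDiffAt.differentiableAt (by simp)).hasFDerivAt
  refine ⟨hd, fun a ha => ?_⟩
  have h1 : fderiv ℝ (fun a => (m a).det) 1 a = 0 := by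
    have hl : HasDerivAt (fun t : ℝ => 1 + t • a) a 0 := by
      simpa using ((hasDerivAt_id (0 : ℝ)).smul_const a).const_add 1
    have hc : HasDerivAt (fun t : ℝ => (m (1 + t • a)).det) (fderiv ℝ (fun a => (m a).det) 1 a) 0 :=
      HasFDerivAt.comp_hasDerivAt_of_eq (0 : ℝ) hdet hl (by simp)
    -- The polynomial p is the second order remainder: det(1 + t a) = 1 + t tr(a) + p(t) t², with
    -- tr(a) = 0.
    set p := (1 + Polynomial.X (R := ℝ) • (m a).map Polynomial.C).det.divX.divX with hp
    have hc' : HasDerivAt (fun t : ℝ => 1 + p.eval t * t ^ 2) 0 0 := by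
      have := ((p.hasDerivAt 0).mul ((hasDerivAt_id (0 : ℝ)).pow 2)).const_add 1
      simpa using this
    refine hc.unique (hc'.congr_of_eventuallyEq (Eventually.of_forall fun t => ?_))
    dsimp only
    rw [map_add, map_one, map_smul, Matrix.det_one_add_smul, ha, zero_mul, add_zero]
  have h2 := hdet.rpow_const (p := -(Fintype.card n : ℝ)⁻¹) (Or.inl h0.ne')
  have h3 : fderiv ℝ (unimodularScale m) 1 = _ := h2.fderiv
  rw [h3]
  simp [h1]

/-- A linear projection onto a finite dimensional subspace. -/
def linearRetraction (S : Submodule ℝ A) : A →L[ℝ] S :=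
  LinearMap.toContinuousLinearMap
    (LinearMap.exists_leftInverse_of_injective S.subtype S.ker_subtype).choose

lemma linearRetraction_coe {S : Submodule ℝ A} (x : S) : linearRetraction S x = x :=
  LinearMap.congr_fun
    (LinearMap.exists_leftInverse_of_injective S.subtype S.ker_subtype).choose_spec x

lemma coe_linearRetraction {S : Submodule ℝ A} {a : A} (h : a ∈ S) :
    (linearRetraction S a : A) = a :=
  congrArg Subtype.val (linearRetraction_coe (⟨a, h⟩ : S))

/-- The rational part of the chart of a unimodular group at the identity. -/
def unimodularRetract (a : A) : slb m b :=
  linearRetraction (slb m b) ((Fintype.card n / (m a).trace) • a - 1)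

lemma coe_unimodularRetract {a : A} (ha : 0 < (m a).trace) (h : (m a).BlockTriangular b) :
    (unimodularRetract m b a : A) = (Fintype.card n / (m a).trace) • a - 1 := by
  refine coe_linearRetraction ⟨?_, ?_⟩
  · rw [map_sub, map_one, map_smul, Matrix.trace_sub, Matrix.trace_smul, Matrix.trace_one,
      smul_eq_mul, div_mul_cancel₀ _ ha.ne', sub_self]
  · rw [map_sub, map_one, map_smul]
    refine Matrix.BlockTriangular.sub (fun i j hij => ?_) Matrix.blockTriangular_one
    rw [Matrix.smul_apply, h hij, smul_zero]

lemma contDiffAt_unimodularRetract {a : A} (ha : 0 < (m a).trace) :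
    ContDiffAt ℝ ∞ (unimodularRetract m b) a := by
  refine (linearRetraction (slb m b)).contDiff.contDiffAt.comp a ?_
  exact (((contDiffAt_const.div (contDiff_trace m).contDiffAt ha.ne').smul contDiffAt_id).sub
    contDiffAt_const)

lemma contDiffAt_unimodularParam {X : slb m b} (h : 0 < (m (1 + X)).det) :
    ContDiffAt ℝ ∞ (unimodularParam m b) X := by
  have h1 : ContDiffAt ℝ ∞ (fun X : slb m b => (1 + X : A)) X :=
    contDiffAt_const.add (slb m b).subtypeL.contDiff.contDiffAt
  exact ((contDiffAt_unimodularScale m h).comp X h1).smul h1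

lemma hasFDerivAt_unimodularParam_zero :
    HasFDerivAt (unimodularParam m b) (slb m b).subtypeL 0 := by
  obtain ⟨hd, h0⟩ := hasFDerivAt_unimodularScale_one m
  have h1 : HasFDerivAt (fun X : slb m b => (1 + X : A)) (slb m b).subtypeL 0 :=
    (slb m b).subtypeL.hasFDerivAt.const_add 1
  have hd' : HasFDerivAt (unimodularScale m) (fderiv ℝ (unimodularScale m) 1)
      (1 + ((0 : slb m b) : A)) := by simpa using hd
  have h2 := (HasFDerivAt.comp (0 : slb m b) (f := fun X : slb m b => (1 + X : A)) hd' h1).smul h1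
  refine h2.congr_fderiv (ContinuousLinearMap.ext fun X => ?_)
  have h3 : unimodularScale m 1 = 1 := by simp [unimodularScale]
  have h4 := h0 X X.2.1
  simp [h3, h4]

variable {m b} {M : Type*} [Group M] [TopologicalSpace M] {ι : M →* A}

namespace IsUnimodularGroup

lemma one_add_unimodularRetract (h : IsUnimodularGroup m b ι) {g : M}
    (hg : 0 < (m (ι g)).trace) :
    (1 + unimodularRetract m b (ι g) : A) = (Fintype.card n / (m (ι g)).trace) • ι g := by
  rw [coe_unimodularRetract m b hg (h.blockTriangular g), add_sub_cancel]

variable [Nonempty n]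

/-- The retraction g ↦ (n / tr g) g - 1 loses only a positive factor, and det = 1 determines it
again. -/
lemma det_one_add_unimodularRetract (h : IsUnimodularGroup m b ι) {g : M}
    (hg : 0 < (m (ι g)).trace) : 0 < (m (1 + unimodularRetract m b (ι g))).det ∧
      unimodularParam m b (unimodularRetract m b (ι g)) = ι g := by
  have hc : 0 < (m (ι g)).trace / Fintype.card n := by
    have := Fintype.card_pos (α := n)
    positivity
  have h2 : ((m (ι g)).trace / Fintype.card n) •
      (1 + unimodularRetract m b (ι g) : A) = ι g := by
    rw [h.one_add_unimodularRetract hg, smul_smul, div_mul_div_cancel₀ (by simp),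
      div_self hg.ne', one_smul]
  have h1 := unimodularScale_eq m (a := (1 + unimodularRetract m b (ι g) : A)) hc (by
    rw [h2]; exact h.det_eq_one g)
  refine ⟨h1.1, ?_⟩
  rw [unimodularParam, h1.2, h2]

/-- Since X is traceless, the trace of the rescaled 1 + X is n times the scale, which the retraction
divides out. -/
lemma trace_unimodularParam {X : slb m b} (hX : 0 < (m (1 + X)).det) :
    0 < (m (unimodularParam m b X)).trace ∧
      unimodularRetract m b (unimodularParam m b X) = X := by
  have hc := unimodularScale_pos m hX
  have hcard : (0 : ℝ) < Fintype.card n := by exact_mod_cast Fintype.card_pos (α := n)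
  have h1 : (m (unimodularParam m b X)).trace = unimodularScale m (1 + X) * Fintype.card n := by
    rw [unimodularParam, map_smul, Matrix.trace_smul, map_add, map_one, Matrix.trace_add, X.2.1,
      Matrix.trace_one, add_zero, smul_eq_mul]
  refine ⟨by rw [h1]; positivity, ?_⟩
  rw [unimodularRetract, h1, unimodularParam, smul_smul,
    show (Fintype.card n : ℝ) / (unimodularScale m (1 + X) * Fintype.card n) *
      unimodularScale m (1 + X) = 1 by field_simp, one_smul, add_sub_cancel_left]
  exact linearRetraction_coe X

/-- The chart of a unimodular group at the identity. -/
def chart (h : IsUnimodularGroup m b ι) : OpenPartialHomeomorph M (slb m b) where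
  toFun g := unimodularRetract m b (ι g)
  invFun X := open Classical in
    if hX : 0 < (m (1 + X)).det then (h.exists_eq_unimodularParam hX).choose else 1
  source := {g | 0 < (m (ι g)).trace}
  target := {X | 0 < (m (1 + X)).det}
  map_source' g hg := (h.det_one_add_unimodularRetract hg).1
  map_target' X hX := by
    have hX' : 0 < (m (1 + X)).det := hX
    simp only [mem_ofPred_eq, dif_pos hX', (h.exists_eq_unimodularParam hX').choose_spec]
    exact (trace_unimodularParam hX').1
  left_inv' g hg := by
    have hX' := h.det_one_add_unimodularRetract hg
    simp only [dif_pos hX'.1]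
    apply h.isEmbedding.injective
    rw [(h.exists_eq_unimodularParam hX'.1).choose_spec, hX'.2]
  right_inv' X hX := by
    have hX' : 0 < (m (1 + X)).det := hX
    simp only [dif_pos hX', (h.exists_eq_unimodularParam hX').choose_spec]
    exact (trace_unimodularParam hX').2
  open_source := isOpen_lt continuous_const
    ((contDiff_trace m).continuous.comp h.isEmbedding.continuous)
  open_target := isOpen_lt continuous_const
    ((contDiff_det m).continuous.comp (continuous_const.add continuous_subtype_val))
  continuousOn_toFun := fun g hg => ((contDiffAt_unimodularRetract m b hg).continuousAt.comp
    h.isEmbedding.continuous.continuousAt).continuousWithinAt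
  continuousOn_invFun := by
    rw [h.isEmbedding.isInducing.continuousOn_iff]
    intro X hX
    have hX' : 0 < (m (1 + X)).det := hX
    refine ((contDiffAt_unimodularParam m b hX').continuousAt.continuousWithinAt).congr
      (fun Y hY => ?_) ?_
    · have hY' : 0 < (m (1 + Y)).det := hY
      simp only [Function.comp_apply, dif_pos hY', (h.exists_eq_unimodularParam hY').choose_spec]
    · simp only [Function.comp_apply, dif_pos hX', (h.exists_eq_unimodularParam hX').choose_spec]

lemma one_mem_chart_source (h : IsUnimodularGroup m b ι) : 1 ∈ h.chart.source := by
  change 0 < (m (ι 1)).trace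
  rw [map_one, map_one, Matrix.trace_one]
  exact_mod_cast Fintype.card_pos (α := n)

lemma chart_one (h : IsUnimodularGroup m b ι) : h.chart 1 = 0 := by
  refine Subtype.ext ?_
  change (unimodularRetract m b (ι 1) : A) = 0
  rw [coe_unimodularRetract m b h.one_mem_chart_source (h.blockTriangular 1), map_one, map_one,
    Matrix.trace_one, div_self (by simp), one_smul, sub_self]

lemma map_chart_symm (h : IsUnimodularGroup m b ι) {X : slb m b} (hX : X ∈ h.chart.target) :
    ι (h.chart.symm X) = unimodularParam m b X := by
  have hX' : 0 < (m (1 + X)).det := hX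
  change ι (dite _ _ _) = _
  rw [dif_pos hX', (h.exists_eq_unimodularParam hX').choose_spec]

/-- The charted space structure of a unimodular group. -/
abbrev chartedSpace [IsTopologicalGroup M] (h : IsUnimodularGroup m b ι) :
    ChartedSpace (slb m b) M :=
  leftTranslateChartedSpace h.chart h.one_mem_chart_source

theorem isEmbeddedAtlas [IsTopologicalGroup M] (h : IsUnimodularGroup m b ι) :
    @IsEmbeddedAtlas (slb m b) A M _ _ _ _ _ h.chartedSpace ι :=
  isEmbeddedAtlas_leftTranslate h.one_mem_chart_source (ρ := unimodularRetract m b)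
    (fun _ hg => ⟨rfl, contDiffAt_unimodularRetract m b hg⟩)
    (fun _ hX => ((contDiffAt_unimodularParam m b hX).contDiffWithinAt).congr
      (fun _ hY => h.map_chart_symm hY) (h.map_chart_symm hX))

/-- The chart at g is the left translate of the chart at 1, whose inverse has the inclusion as
derivative at 0. Tangent vectors thus appear in the left trivialization, at every point. -/
theorem mfd_eq [IsTopologicalGroup M] (h : IsUnimodularGroup m b ι) (g : M) (X : slb m b) :
    letI := h.chartedSpace
    (mfderiv 𝓘(ℝ, slb m b) 𝓘(ℝ, A) ι g X : A) = ι g * (X : A) := by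
  let _ := h.chartedSpace
  refine (h.isEmbeddedAtlas.mfd_eq g X).trans ?_
  have h1 : chartAt (slb m b) g g = 0 := by
    change h.chart (g⁻¹ * g) = 0
    rw [inv_mul_cancel, h.chart_one]
  have h0 : (0 : slb m b) ∈ h.chart.target := by
    have := h.chart.map_source h.one_mem_chart_source
    rwa [h.chart_one] at this
  have h3 : (fun w => ι ((chartAt (slb m b) g).symm w)) =ᶠ[𝓝 0]
      fun w => ι g * unimodularParam m b w := by
    filter_upwards [h.chart.open_target.mem_nhds h0] with w hw
    rw [← h.map_chart_symm hw, ← map_mul]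
    refine congrArg ι ?_
    change g⁻¹⁻¹ * h.chart.symm w = _
    rw [inv_inv]
  rw [h1, h3.fderiv_eq, ((hasFDerivAt_unimodularParam_zero m b).const_mul (ι g)).fderiv]
  rfl

end IsUnimodularGroup

end UnimodularGroups

/-! ### Special linear groups and block triangular subgroups as Lie groups -/

section MatrixGroups

open Filter Set VectorField
open scoped Topology

variable {n : Type*} [Fintype n] [DecidableEq n] {A : Type*} [NormedRing A]
  [NormedAlgebra ℝ A] (m : A ≃ₐ[ℝ] Matrix n n ℝ) (b : n → ℤ)

/-- The special linear group of a matrix algebra. -/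
def SL : Subgroup Aˣ where
  carrier := {u | (m u).det = 1}
  mul_mem' {u v} hu hv := by
    have hu' : (m u).det = 1 := hu
    have hv' : (m v).det = 1 := hv
    change (m (u * v)).det = 1
    rw [map_mul, Matrix.det_mul, hu', hv', one_mul]
  one_mem' := by simp
  inv_mem' {u} hu := by
    have hu' : (m u).det = 1 := hu
    have h1 : (m ↑u⁻¹).det * (m u).det = 1 := by
      rw [← Matrix.det_mul, ← map_mul, Units.inv_mul, map_one, Matrix.det_one]
    rwa [hu', mul_one] at h1

/-- The inclusion of the special linear group. -/
def SL.val : SL m →* A := (Units.coeHom A).comp (SL m).subtype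

lemma SL.val_mul_inv (g : SL m) : SL.val m g * SL.val m g⁻¹ = 1 := by
  rw [← map_mul, mul_inv_cancel, map_one]

lemma SL.val_inv_mul (g : SL m) : SL.val m g⁻¹ * SL.val m g = 1 := by
  rw [← map_mul, inv_mul_cancel, map_one]

lemma SL.blockTriangular_inv {g : SL m} (hg : (m (SL.val m g)).BlockTriangular b) :
    (m (SL.val m g⁻¹)).BlockTriangular b := by
  have h1 : m (SL.val m g) * m (SL.val m g⁻¹) = 1 := by
    rw [← map_mul, SL.val_mul_inv, map_one]
  have : Invertible (m (SL.val m g)) :=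
    ⟨m (SL.val m g⁻¹), by rw [← map_mul, SL.val_inv_mul, map_one], h1⟩
  rw [← Matrix.inv_eq_right_inv h1]
  exact Matrix.blockTriangular_inv_of_blockTriangular hg

/-- The block triangular subgroup of the special linear group. -/
def blockSubgroup : Subgroup (SL m) where
  carrier := {g | (m (SL.val m g)).BlockTriangular b}
  mul_mem' {g h} hg hh := by
    change (m (SL.val m (g * h))).BlockTriangular b
    rw [map_mul, map_mul]
    exact Matrix.BlockTriangular.mul hg hh
  one_mem' := by
    change (m (SL.val m 1)).BlockTriangular b
    rw [map_one, map_one]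
    exact Matrix.blockTriangular_one
  inv_mem' hg := SL.blockTriangular_inv m b hg

variable {b} in
lemma blockSubgroup_le {b' : n → ℤ} (h : ∀ i j, b j < b i → b' j < b' i) :
    blockSubgroup m b' ≤ blockSubgroup m b := fun _ hg i j hij => hg (h i j hij)

/-- The inclusion of the block triangular subgroup into the matrix algebra. -/
def blockVal : blockSubgroup m b →* A := (SL.val m).comp (blockSubgroup m b).subtype

lemma SL.isEmbedding_val [CompleteSpace A] : Topology.IsEmbedding (SL.val m) :=
  Units.isOpenEmbedding_val.isEmbedding.comp Topology.IsEmbedding.subtypeVal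

/-- The constant function b = 0 imposes no block condition, so SL is an instance of the same
construction as its subgroups. -/
theorem SL.isUnimodularGroup [CompleteSpace A] : IsUnimodularGroup m 0 (SL.val m) where
  isEmbedding := SL.isEmbedding_val m
  mem_range_iff a := by
    constructor
    · rintro ⟨g, rfl⟩
      exact ⟨g.2, fun i j hij => absurd hij (lt_irrefl _)⟩
    · rintro ⟨ha, -⟩
      have h1 : IsUnit (m a) := (Matrix.isUnit_iff_isUnit_det _).2 (by rw [ha]; exact isUnit_one)
      have h2 : IsUnit a := (isUnit_map_iff m a).1 h1
      obtain ⟨u, rfl⟩ := h2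
      exact ⟨⟨u, ha⟩, rfl⟩

theorem isUnimodularGroup_blockVal [CompleteSpace A] : IsUnimodularGroup m b (blockVal m b) where
  isEmbedding := (SL.isEmbedding_val m).comp Topology.IsEmbedding.subtypeVal
  mem_range_iff a := by
    constructor
    · rintro ⟨g, rfl⟩
      exact ⟨g.1.2, g.2⟩
    · rintro ⟨ha, hb⟩
      obtain ⟨g, rfl⟩ := ((SL.isUnimodularGroup m).mem_range_iff a).2
        ⟨ha, fun i j hij => absurd hij (lt_irrefl _)⟩
      exact ⟨⟨g, hb⟩, rfl⟩

lemma slb_le : slb m b ≤ slb m 0 := fun _ ha => ⟨ha.1, fun _ _ hij => absurd hij (lt_irrefl _)⟩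

/-- The inclusion of Lie algebras. -/
def slbInclusion : slb m b →ₗ[ℝ] slb m 0 := Submodule.inclusion (slb_le m b)

variable [CompleteSpace A] [FiniteDimensional ℝ A] [Nonempty n]

instance SL.instChartedSpace : ChartedSpace (slb m 0) (SL m) :=
  (SL.isUnimodularGroup m).chartedSpace

instance blockSubgroup.instChartedSpace : ChartedSpace (slb m b) (blockSubgroup m b) :=
  (isUnimodularGroup_blockVal m b).chartedSpace

theorem SL.isEmbeddedAtlas : IsEmbeddedAtlas (E := slb m 0) (SL.val m) :=
  (SL.isUnimodularGroup m).isEmbeddedAtlas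

theorem isEmbeddedAtlas_blockVal : IsEmbeddedAtlas (E := slb m b) (blockVal m b) :=
  (isUnimodularGroup_blockVal m b).isEmbeddedAtlas

instance SL.instLieGroup : LieGroup 𝓘(ℝ, slb m 0) ∞ (SL m) :=
  lieGroup_of_isEmbeddedAtlas (SL.isEmbeddedAtlas m)

instance blockSubgroup.instLieGroup : LieGroup 𝓘(ℝ, slb m b) ∞ (blockSubgroup m b) :=
  lieGroup_of_isEmbeddedAtlas (isEmbeddedAtlas_blockVal m b)

instance SL.instSecondCountableTopology : SecondCountableTopology (SL m) := by
  have : ProperSpace A := FiniteDimensional.proper ℝ A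
  exact (SL.isEmbedding_val m).secondCountableTopology

instance SL.instT2Space : T2Space (SL m) := (SL.isEmbedding_val m).t2Space

lemma SL.mfd_val (g : SL m) (X : slb m 0) :
    (mfd (E := slb m 0) (SL.val m) g X : A) = SL.val m g * (X : A) :=
  (SL.isUnimodularGroup m).mfd_eq g X

lemma mfd_blockVal (g : blockSubgroup m b) (X : slb m b) :
    (mfd (E := slb m b) (blockVal m b) g X : A) = blockVal m b g * (X : A) :=
  (isUnimodularGroup_blockVal m b).mfd_eq g X

/-- The charts of group and subgroup at p are given by the same formula, so in them the inclusion is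
the linear inclusion of Lie algebras; any linear complement C gives the normal form of an immersion.
-/
theorem isSmoothEmbedding_blockSubgroup : Manifold.IsSmoothEmbedding 𝓘(ℝ, slb m b) 𝓘(ℝ, slb m 0) ∞
    (Subtype.val : blockSubgroup m b → SL m) := by
  refine ⟨?_, Topology.IsEmbedding.subtypeVal⟩
  obtain ⟨C, hC⟩ := Submodule.exists_isCompl (LinearMap.range (slbInclusion m b))
  have hinj : Function.Injective (slbInclusion m b) := Submodule.inclusion_injective _
  let e : (slb m b × C) ≃ₗ[ℝ] slb m 0 :=
    ((LinearEquiv.ofInjective (slbInclusion m b) hinj).prodCongr (LinearEquiv.refl ℝ C)).trans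
      (Submodule.prodEquivOfIsCompl _ _ hC)
  refine Manifold.IsImmersionOfComplement.isImmersion (F := C) fun p => ?_
  refine Manifold.IsImmersionAtOfComplement.mk_of_continuousAt continuous_subtype_val.continuousAt
    e.toContinuousLinearEquiv (chartAt (slb m b) p) (chartAt (slb m 0) (p : SL m))
    (mem_chart_source _ p) (mem_chart_source _ _) (IsManifold.chart_mem_maximalAtlas p)
    (IsManifold.chart_mem_maximalAtlas _) ?_
  intro X hX
  have hX₀ : X ∈ (chartAt (slb m b) p).target := by simpa using hX
  have hX' : X ∈ (isUnimodularGroup_blockVal m b).chart.target := hX₀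
  have h1 : e (X, 0) = slbInclusion m b X := by
    simp [e, Submodule.coe_prodEquivOfIsCompl']
  change unimodularRetract m 0 (SL.val m ((p : SL m)⁻¹ *
    ((p⁻¹⁻¹ * (isUnimodularGroup_blockVal m b).chart.symm X : blockSubgroup m b) : SL m))) = e (X, 0)
  rw [h1, inv_inv, Subgroup.coe_mul, inv_mul_cancel_left]
  change unimodularRetract m 0 (blockVal m b ((isUnimodularGroup_blockVal m b).chart.symm X)) = _
  rw [(isUnimodularGroup_blockVal m b).map_chart_symm hX']
  exact (IsUnimodularGroup.trace_unimodularParam (X := slbInclusion m b X) hX').2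

/-- The Lie algebra of the special linear group. -/
abbrev slAlgebra : Type _ := GroupLieAlgebra 𝓘(ℝ, slb m 0) (SL m)

/-- The elements of the Lie algebra as matrices. -/
def toMat : slAlgebra m →ₗ[ℝ] A := (slb m 0).subtype

lemma toMat_injective : Function.Injective (toMat m) := (slb m 0).injective_subtype

lemma toMat_eq_mfd (X : slAlgebra m) :
    toMat m X = mfd (E := slb m 0) (SL.val m) (1 : SL m) X := by
  refine Eq.trans ?_ (SL.mfd_val m 1 X).symm
  rw [map_one, one_mul]
  rfl

lemma mem_range_toMat {a : A} : a ∈ LinearMap.range (toMat m) ↔ (m a).trace = 0 := by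
  have : LinearMap.range (toMat m) = slb m 0 := Submodule.range_subtype _
  rw [this, mem_slb]
  exact ⟨fun h => h.1, fun h => ⟨h, fun _ _ hij => absurd hij (lt_irrefl _)⟩⟩

/-- Differentiating val(g x) = val(g) val(x) at x = 1; it makes a left invariant field act on the
matrix function `SL.val` by right multiplication. -/
lemma SL.mfd_val_mulInvariantVectorField (X : slAlgebra m) (g : SL m) :
    mfd (E := slb m 0) (SL.val m) g (mulInvariantVectorField X g) = SL.val m g * toMat m X := by
  have h1 : (SL.val m) ∘ (fun x => g * x) = (fun a => SL.val m g * a) ∘ SL.val m := by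
    ext x; simp
  have hv : ∀ x, MDifferentiableAt 𝓘(ℝ, slb m 0) 𝓘(ℝ, A) (SL.val m) x := fun x =>
    ((SL.isEmbeddedAtlas m).contMDiff x).mdifferentiableAt (by simp)
  have hm : MDifferentiableAt 𝓘(ℝ, slb m 0) 𝓘(ℝ, slb m 0) (fun x => g * x) 1 :=
    (contMDiff_mul_left (a := g) (n := ∞) (I := 𝓘(ℝ, slb m 0))).contMDiffAt.mdifferentiableAt (by simp)
  have h2 := mfderiv_comp (1 : SL m) (hv (g * 1)) hm
  have hl : HasFDerivAt (fun a => SL.val m g * a) (ContinuousLinearMap.mul ℝ A (SL.val m g))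
      (SL.val m 1) := (ContinuousLinearMap.mul ℝ A (SL.val m g)).hasFDerivAt
  have h3 := (hl.hasMFDerivAt.comp (1 : SL m) (hv 1).hasMFDerivAt).mfderiv
  rw [← h1, h2] at h3
  have h4 := congrArg (fun T : slb m 0 →L[ℝ] A => T X) h3
  have h5 : ∀ p : SL m, p = g → ∀ w : slb m 0,
      (mfd (E := slb m 0) (SL.val m) g w : A) = mfderiv 𝓘(ℝ, slb m 0) 𝓘(ℝ, A) (SL.val m) p w := by
    rintro p rfl w; rfl
  refine (h5 (g * 1) (mul_one g) _).trans (h4.trans ?_)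
  exact congrArg (SL.val m g * ·) (toMat_eq_mfd m X).symm

/-- The bracket is tested on `SL.val`: applying the fields of Y and then X multiplies on the right
by both matrices, which at 1 gives the product XY. -/
theorem toMat_lie (X Y : slAlgebra m) :
    toMat m ⁅X, Y⁆ = toMat m X * toMat m Y - toMat m Y * toMat m X := by
  have : CompleteSpace (slb m 0) := FiniteDimensional.complete ℝ _
  have hd : ∀ X : slAlgebra m, MDifferentiableAt 𝓘(ℝ, slb m 0) 𝓘(ℝ, slb m 0).tangent
      (fun g => (⟨g, mulInvariantVectorField X g⟩ : TangentBundle 𝓘(ℝ, slb m 0) (SL m))) 1 :=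
    fun X => (contMDiffAt_mulInvariantVectorField X).mdifferentiableAt (by simp)
  have hs : ContMDiffAt 𝓘(ℝ, slb m 0) 𝓘(ℝ, A) 2 (SL.val m) 1 :=
    ((SL.isEmbeddedAtlas m).contMDiff 1).of_le ENat.LEInfty.out
  have h1 := mfd_mlieBracket hs (hd X) (hd Y)
  have hv : MDifferentiableAt 𝓘(ℝ, slb m 0) 𝓘(ℝ, A) (SL.val m) 1 :=
    ((SL.isEmbeddedAtlas m).contMDiff 1).mdifferentiableAt (by simp)
  have h2 : ∀ X Y : slAlgebra m, mfd (E := slb m 0) (fun g => mfd (E := slb m 0) (SL.val m) g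
      (mulInvariantVectorField Y g)) (1 : SL m) (mulInvariantVectorField X (1 : SL m)) =
      toMat m X * toMat m Y := by
    intro X Y
    have h3 : (fun g => mfd (E := slb m 0) (SL.val m) g (mulInvariantVectorField Y g)) =
        (fun a => a * toMat m Y) ∘ SL.val m :=
      funext fun g => SL.mfd_val_mulInvariantVectorField m Y g
    have hl : HasFDerivAt (fun a => a * toMat m Y)
        ((ContinuousLinearMap.mul ℝ A).flip (toMat m Y)) (SL.val m 1) :=
      ((ContinuousLinearMap.mul ℝ A).flip (toMat m Y)).hasFDerivAt
    have h4 := (hl.hasMFDerivAt.comp (1 : SL m) hv.hasMFDerivAt).mfderiv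
    rw [h3]
    have h5 := congrArg (fun T : slb m 0 →L[ℝ] A => T (mulInvariantVectorField X (1 : SL m))) h4
    refine h5.trans ?_
    have h6 := SL.mfd_val_mulInvariantVectorField m X 1
    rw [map_one, one_mul] at h6
    exact congrArg (· * toMat m Y) h6
  rw [h2, h2] at h1
  exact (toMat_eq_mfd m _).trans h1

theorem toMat_Ad (g : SL m) (X : slAlgebra m) :
    toMat m (Ad g X) = SL.val m g * toMat m X * SL.val m g⁻¹ := by
  have h1 : (SL.val m) ∘ (fun x => g * x * g⁻¹) =
      (fun a => SL.val m g * a * SL.val m g⁻¹) ∘ SL.val m := by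
    ext x; simp
  have hv : ∀ x, MDifferentiableAt 𝓘(ℝ, slb m 0) 𝓘(ℝ, A) (SL.val m) x := fun x =>
    ((SL.isEmbeddedAtlas m).contMDiff x).mdifferentiableAt (by simp)
  have hm : MDifferentiableAt 𝓘(ℝ, slb m 0) 𝓘(ℝ, slb m 0) (fun x : SL m => g * x * g⁻¹) 1 :=
    (contMDiff_conj g).contMDiffAt.mdifferentiableAt (by simp)
  have h2 := mfderiv_comp (1 : SL m) (hv (g * 1 * g⁻¹)) hm
  let T : A →L[ℝ] A := ((ContinuousLinearMap.mul ℝ A).flip (SL.val m g⁻¹)).comp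
    (ContinuousLinearMap.mul ℝ A (SL.val m g))
  have hl : HasFDerivAt (fun a => SL.val m g * a * SL.val m g⁻¹) T (SL.val m 1) := T.hasFDerivAt
  have h3 := (hl.hasMFDerivAt.comp (1 : SL m) (hv 1).hasMFDerivAt).mfderiv
  rw [← h1, h2] at h3
  have h4 := congrArg (fun T : slb m 0 →L[ℝ] A => T X) h3
  have h5 : ∀ p : SL m, p = 1 → ∀ w : slb m 0,
      (mfd (E := slb m 0) (SL.val m) 1 w : A) = mfderiv 𝓘(ℝ, slb m 0) 𝓘(ℝ, A) (SL.val m) p w := by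
    rintro p rfl w; rfl
  refine (toMat_eq_mfd m _).trans ((h5 (g * 1 * g⁻¹) (by simp) _).trans (h4.trans ?_))
  exact congrArg (SL.val m g * · * SL.val m g⁻¹) (toMat_eq_mfd m X).symm

end MatrixGroups

/-! ### Block gradings of the special linear Lie algebra -/

section SpecialLinearAlgebra

lemma mul_single_one_apply {n : Type*} [Fintype n] [DecidableEq n] (a : Matrix n n ℝ)
    (k l i j : n) : (a * Matrix.single k l 1 : Matrix n n ℝ) i j = if j = l then a i k else 0 := by
  split_ifs with h
  · subst h; rw [Matrix.mul_single_apply_same, mul_one]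
  · exact Matrix.mul_single_apply_of_ne _ _ _ _ _ h _

lemma single_one_mul_apply {n : Type*} [Fintype n] [DecidableEq n] (a : Matrix n n ℝ)
    (k l i j : n) : (Matrix.single k l 1 * a : Matrix n n ℝ) i j = if i = k then a l j else 0 := by
  split_ifs with h
  · subst h; rw [Matrix.single_mul_apply_same, one_mul]
  · exact Matrix.single_mul_apply_of_ne _ _ _ _ _ h _

/-- `c` identifies `𝔤` with the Lie algebra of matrices of trace zero. -/
structure IsSpecialLinear {n : Type*} [Fintype n] {𝔤 : Type*} [LieRing 𝔤] [LieAlgebra ℝ 𝔤]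
    (c : 𝔤 →ₗ[ℝ] Matrix n n ℝ) : Prop where
  injective : Function.Injective c
  mem_range_iff : ∀ a, a ∈ LinearMap.range c ↔ a.trace = 0
  map_lie : ∀ x y, c ⁅x, y⁆ = c x * c y - c y * c x

/-- The matrices of degree `i`, where the matrix unit at `(k, l)` has degree `b l - b k`. -/
def gradingComp {n : Type*} {𝔤 : Type*} [LieRing 𝔤] [LieAlgebra ℝ 𝔤] (b : n → ℤ)
    (c : 𝔤 →ₗ[ℝ] Matrix n n ℝ) (i : ℤ) : Submodule ℝ 𝔤 where
  carrier := {x | ∀ k l, b l - b k ≠ i → c x k l = 0}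
  add_mem' hx hy k l hkl := by rw [map_add, Matrix.add_apply, hx k l hkl, hy k l hkl, add_zero]
  zero_mem' k l _ := by rw [map_zero]; rfl
  smul_mem' r x hx k l hkl := by rw [map_smul, Matrix.smul_apply, hx k l hkl, smul_zero]

namespace IsSpecialLinear

variable {n : Type*} [Fintype n] {𝔤 : Type*} [LieRing 𝔤] [LieAlgebra ℝ 𝔤]
  {c : 𝔤 →ₗ[ℝ] Matrix n n ℝ} (h : IsSpecialLinear c)

/-- The element of `𝔤` with a given matrix. -/
def lift (a : Matrix n n ℝ) (ha : a.trace = 0) : 𝔤 := ((h.mem_range_iff a).2 ha).choose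

lemma map_lift (a : Matrix n n ℝ) (ha : a.trace = 0) : c (h.lift a ha) = a :=
  ((h.mem_range_iff a).2 ha).choose_spec

lemma trace_eq_zero (h : IsSpecialLinear c) (x : 𝔤) : (c x).trace = 0 :=
  (h.mem_range_iff _).1 ⟨x, rfl⟩

variable (b : n → ℤ)

/-- The component of degree `i`. -/
def component (i : ℤ) (x : 𝔤) : 𝔤 :=
  h.lift (Matrix.of fun k l => if b l - b k = i then c x k l else 0) (by
    by_cases hi : i = 0
    · subst hi
      simpa [Matrix.trace] using h.trace_eq_zero x
    · simp [Matrix.trace, Ne.symm hi])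

lemma map_component (i : ℤ) (x : 𝔤) (k l : n) :
    c (h.component b i x) k l = if b l - b k = i then c x k l else 0 := by
  rw [component, h.map_lift]; rfl

/-- A bound for the degrees. -/
def depth : ℕ := ∑ k, ∑ l, (b l - b k).natAbs

lemma abs_le_depth (k l : n) : |b l - b k| ≤ depth b := by
  have h1 : (b l - b k).natAbs ≤ depth b :=
    (Finset.single_le_sum (f := fun l => (b l - b k).natAbs) (fun _ _ => Nat.zero_le _)
      (Finset.mem_univ l)).trans (Finset.single_le_sum (f := fun k => ∑ l, (b l - b k).natAbs)
      (fun _ _ => Nat.zero_le _) (Finset.mem_univ k))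
  rw [Int.abs_eq_natAbs]
  exact_mod_cast h1

lemma sum_component (x : 𝔤) :
    ∑ i ∈ Finset.Icc (-(depth b : ℤ)) (depth b), h.component b i x = x := by
  apply h.injective
  ext k l
  rw [map_sum, Matrix.sum_apply, Finset.sum_congr rfl fun i _ => h.map_component b i x k l,
    Finset.sum_ite_eq, if_pos]
  exact Finset.mem_Icc.2 (abs_le.1 (abs_le_depth b k l))

lemma component_mem (i : ℤ) (x : 𝔤) : h.component b i x ∈ gradingComp b c i :=
  fun k l hkl => by rw [h.map_component, if_neg hkl]

lemma component_eq_zero {i : ℤ} {x : 𝔤} (hx : ∀ k l, b l - b k = i → c x k l = 0) :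
    h.component b i x = 0 := by
  apply h.injective
  ext k l
  rw [h.map_component, map_zero]
  split_ifs with hi
  · exact hx k l hi
  · rfl

variable {b} in
/-- An element lies in the sum of those components in which its entries lie. -/
lemma mem_iSup_gradingComp (h : IsSpecialLinear c) {p : ℤ → Prop} {x : 𝔤}
    (hx : ∀ k l, ¬ p (b l - b k) → c x k l = 0) : x ∈ ⨆ i : ℤ, ⨆ _ : p i, gradingComp b c i := by
  rw [← h.sum_component b x]
  refine Submodule.sum_mem _ fun i _ => ?_
  by_cases hi : p i
  · exact Submodule.mem_iSup_of_mem i (Submodule.mem_iSup_of_mem hi (h.component_mem b i x))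
  · rw [h.component_eq_zero b fun k l hkl => hx k l (by rwa [hkl])]
    exact Submodule.zero_mem _

variable {b} in
lemma mem_iSup_gradingComp_iff (h : IsSpecialLinear c) {p : ℤ → Prop} {x : 𝔤} :
    x ∈ ⨆ i : ℤ, ⨆ _ : p i, gradingComp b c i ↔ ∀ k l, ¬ p (b l - b k) → c x k l = 0 := by
  refine ⟨fun hx k l hkl => ?_, h.mem_iSup_gradingComp⟩
  have hle : ⨆ i : ℤ, ⨆ _ : p i, gradingComp b c i ≤
      LinearMap.ker (Matrix.entryLinearMap ℝ ℝ k l ∘ₗ c) :=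
    iSup₂_le fun i hi y hy => hy k l fun hkl' => hkl (hkl' ▸ hi)
  exact hle hx

lemma isInternal_gradingComp (h : IsSpecialLinear c) : DirectSum.IsInternal (gradingComp b c) := by
  refine DirectSum.isInternal_submodule_of_iSupIndep_of_iSup_eq_top ?_ ?_
  · refine iSupIndep_def.2 fun i => Submodule.disjoint_def.2 fun x hx hx' => ?_
    have h1 := h.mem_iSup_gradingComp_iff.1 hx'
    apply h.injective
    ext k l
    rw [map_zero]
    by_cases hi : b l - b k = i
    · exact h1 k l (not_not.2 hi)
    · exact hx k l hi
  · refine eq_top_iff.2 fun x _ => ?_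
    have := h.mem_iSup_gradingComp (b := b) (p := fun _ => True) (x := x) (by simp)
    simpa using this

lemma lie_mem_gradingComp (h : IsSpecialLinear c) {i j : ℤ} {x y : 𝔤} (hx : x ∈ gradingComp b c i)
    (hy : y ∈ gradingComp b c j) : ⁅x, y⁆ ∈ gradingComp b c (i + j) := by
  intro k l hkl
  have h1 : ∀ {i j : ℤ} {x y : 𝔤}, x ∈ gradingComp b c i → y ∈ gradingComp b c j →
      b l - b k ≠ i + j → (c x * c y) k l = 0 := by
    intro i j x y hx hy hkl
    rw [Matrix.mul_apply]
    refine Finset.sum_eq_zero fun r _ => ?_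
    by_cases hi : b r - b k = i
    · rw [hy r l (by omega), mul_zero]
    · rw [hx k r hi, zero_mul]
  rw [h.map_lie, Matrix.sub_apply, h1 hx hy hkl, h1 hy hx (by omega), sub_zero]

variable [DecidableEq n]

/-- The elementary matrices, as elements of `𝔤`. -/
def elem (k l : n) (hkl : k ≠ l) : 𝔤 :=
  h.lift (Matrix.single k l 1) (Matrix.trace_single_eq_of_ne k l 1 hkl)

lemma map_elem (k l : n) (hkl : k ≠ l) : c (h.elem k l hkl) = Matrix.single k l 1 := h.map_lift _ _

lemma lie_elem (h : IsSpecialLinear c) {k j l : n} (hkj : k ≠ j) (hjl : j ≠ l) (hkl : k ≠ l) :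
    ⁅h.elem k j hkj, h.elem j l hjl⁆ = h.elem k l hkl := by
  apply h.injective
  rw [h.map_lie, h.map_elem, h.map_elem, h.map_elem, Matrix.single_mul_single_same,
    Matrix.single_mul_single_of_ne _ _ _ _ hkl.symm, sub_zero, one_mul]

lemma eq_zero_of_diagonal_eq (h : IsSpecialLinear c) {x : 𝔤}
    (hoff : ∀ k l, k ≠ l → c x k l = 0) (hdiag : ∀ k l, c x k k = c x l l) : x = 0 := by
  apply h.injective
  rw [map_zero]
  ext k l
  by_cases hkl : k = l
  · subst hkl
    have h1 := h.trace_eq_zero x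
    have h2 : (c x).trace = Fintype.card n * c x k k := by
      rw [Matrix.trace, Finset.sum_congr rfl fun i _ => (show (c x).diag i = c x k k from hdiag i k)]
      simp
    rw [h2, mul_eq_zero] at h1
    refine h1.resolve_left ?_
    have : Nonempty n := ⟨k⟩
    exact_mod_cast Fintype.card_ne_zero
  · exact hoff k l hkl

/-- Testing a²y - 2aya + ya² = 0 on off-diagonal matrix units makes a diagonal and then scalar; its
trace is zero. -/
lemma eq_zero_of_lie_lie_eq_zero (h : IsSpecialLinear c) {x : 𝔤}
    (hx : ∀ y : 𝔤, ⁅x, ⁅x, y⁆⁆ = 0) : x = 0 := by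
  set a := c x with ha
  have h1 : ∀ k l, k ≠ l → a * a * Matrix.single k l 1 - 2 * (a * (Matrix.single k l 1 * a)) +
      Matrix.single k l 1 * (a * a) = 0 := by
    intro k l hkl
    have := congrArg c (hx (h.elem k l hkl))
    rw [h.map_lie, h.map_lie, h.map_elem, map_zero, ← ha] at this
    rw [← this]
    noncomm_ring
  have h2 : ∀ k l, k ≠ l → ∀ i j, (if j = l then (a * a) i k else 0) - 2 * (a i k * a l j) +
      (if i = k then (a * a) l j else 0) = 0 := by
    intro k l hkl i j
    have h3 := congrFun (congrFun (h1 k l hkl) i) j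
    have h4 : (a * (Matrix.single k l 1 * a) : Matrix n n ℝ) i j = a i k * a l j := by
      rw [Matrix.mul_apply, Finset.sum_eq_single k]
      · rw [single_one_mul_apply, if_pos rfl]
      · intro r _ hr
        rw [single_one_mul_apply, if_neg hr, mul_zero]
      · simp
    rw [← mul_single_one_apply, ← single_one_mul_apply, ← h4]
    rw [two_mul] at h3 ⊢
    exact h3
  have hoff : ∀ k l, k ≠ l → a k l = 0 := by
    intro k l hkl
    -- For the unit at (l, k), the entry (k, l) contains neither of the terms in a²; what is left is
    -- -2 a_{kl}² = 0.
    have h3 := h2 l k hkl.symm k l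
    rw [if_neg hkl.symm, if_neg hkl] at h3
    nlinarith [mul_self_nonneg (a k l)]
  have hsq : ∀ k, (a * a) k k = a k k * a k k := by
    intro k
    rw [Matrix.mul_apply, Finset.sum_eq_single k]
    · intro r _ hr
      rw [hoff r k hr, mul_zero]
    · simp
  refine h.eq_zero_of_diagonal_eq hoff fun k l => ?_
  by_cases hkl : k = l
  · rw [hkl]
  · have h3 := h2 k l hkl k l
    rw [if_pos rfl, if_pos rfl, hsq, hsq] at h3
    have h4 : (a k k - a l l) * (a k k - a l l) = 0 := by linarith
    exact sub_eq_zero.1 (mul_self_eq_zero.1 h4)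

/-- In an abelian ideal containing x, both x and [x, y] lie in the ideal, so (ad x)² = 0 and x
vanishes. -/
theorem isSemisimple [FiniteDimensional ℝ 𝔤] (h : IsSpecialLinear c) :
    LieAlgebra.IsSemisimple ℝ 𝔤 := by
  have : LieAlgebra.HasTrivialRadical ℝ 𝔤 := by
    rw [LieAlgebra.hasTrivialRadical_iff_no_abelian_ideals]
    intro I hI
    rw [LieSubmodule.eq_bot_iff]
    intro x hx
    refine h.eq_zero_of_lie_lie_eq_zero fun y => ?_
    have h1 : ⁅x, y⁆ ∈ I := lie_mem_left ℝ 𝔤 I x y hx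
    exact congrArg Subtype.val (LieModule.IsTrivial.trivial (⟨x, hx⟩ : I) (⟨⁅x, y⁆, h1⟩ : I))
  infer_instance

lemma elem_mem_gradingComp {k l : n} (hkl : k ≠ l) :
    h.elem k l hkl ∈ gradingComp b c (b l - b k) := by
  intro i j hij
  rw [h.map_elem, Matrix.single_apply_of_ne]
  rintro ⟨rfl, rfl⟩
  exact hij rfl

lemma eq_sum_elem (h : IsSpecialLinear c) {x : 𝔤} (hx : ∀ k, c x k k = 0) :
    x = ∑ k, ∑ l, if hkl : k ≠ l then c x k l • h.elem k l hkl else 0 := by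
  apply h.injective
  conv_lhs => rw [Matrix.matrix_eq_sum_single (c x)]
  rw [map_sum]
  refine Finset.sum_congr rfl fun k _ => ?_
  rw [map_sum]
  refine Finset.sum_congr rfl fun l _ => ?_
  split_ifs with hkl
  · rw [map_smul, h.map_elem, Matrix.smul_single, smul_eq_mul, mul_one]
  · obtain rfl := not_not.1 hkl
    rw [hx, map_zero, Matrix.single_zero]

/-- Because the levels of b have no gaps, a unit of degree below -1 factors as the bracket of one
whose degree is higher by 1 with one of degree -1. -/
lemma elem_mem_lieSpan (hb : ∀ k l, b l + 1 < b k → ∃ j, b j = b l + 1) (d : ℕ) :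
    ∀ (k l : n) (hkl : k ≠ l), b l - b k = -(d + 1 : ℤ) →
      h.elem k l hkl ∈ LieSubalgebra.lieSpan ℝ 𝔤 (gradingComp b c (-1) : Set 𝔤) := by
  induction d with
  | zero =>
    intro k l hkl hd
    refine LieSubalgebra.subset_lieSpan ?_
    have := h.elem_mem_gradingComp b hkl
    rw [hd] at this
    simpa using this
  | succ d ih =>
    intro k l hkl hd
    push_cast at hd
    obtain ⟨j, hj⟩ := hb k l (by omega)
    have hkj : k ≠ j := by rintro rfl; omega
    have hjl : j ≠ l := by rintro rfl; omega
    rw [← h.lie_elem hkj hjl hkl]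
    refine LieSubalgebra.lie_mem _ (ih k j hkj (by omega)) (LieSubalgebra.subset_lieSpan ?_)
    have := h.elem_mem_gradingComp b hjl
    rwa [show b l - b j = -1 by omega] at this

/-- The grading of the special linear algebra in which the matrix unit at `(k, l)` has degree
`b l - b k`. -/
def grading (hb : ∀ k l, b l + 1 < b k → ∃ j, b j = b l + 1) : Grading 𝔤 where
  k := depth b
  comp := gradingComp b c
  isInternal := h.isInternal_gradingComp b
  comp_eq_bot i hi := by
    refine (Submodule.eq_bot_iff _).2 fun x hx => h.injective ?_
    ext k l
    rw [map_zero]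
    refine hx k l fun hkl => ?_
    have := abs_le_depth b k l
    rw [hkl] at this
    exact absurd this (not_le.2 hi)
  lie_mem i j x y hx hy := h.lie_mem_gradingComp b hx hy
  generated := by
    apply le_antisymm
    · let N : LieSubalgebra ℝ 𝔤 :=
        { (⨆ i : ℤ, ⨆ _ : i < 0, gradingComp b c i : Submodule ℝ 𝔤) with
          lie_mem' := by
            intro x y hx hy
            have hx' := h.mem_iSup_gradingComp_iff.1 hx
            have hy' := h.mem_iSup_gradingComp_iff.1 hy
            refine h.mem_iSup_gradingComp fun k l hkl => ?_
            have h1 : ∀ {x y : 𝔤}, (∀ k l, ¬ b l - b k < 0 → c x k l = 0) →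
                (∀ k l, ¬ b l - b k < 0 → c y k l = 0) → (c x * c y) k l = 0 := by
              intro x y hx hy
              rw [Matrix.mul_apply]
              refine Finset.sum_eq_zero fun r _ => ?_
              by_cases hr : b r - b k < 0
              · rw [hy r l (by omega), mul_zero]
              · rw [hx k r hr, zero_mul]
            rw [h.map_lie, Matrix.sub_apply, h1 hx' hy', h1 hy' hx', sub_zero] }
      have hN : LieSubalgebra.lieSpan ℝ 𝔤 (gradingComp b c (-1) : Set 𝔤) ≤ N :=
        LieSubalgebra.lieSpan_le.2 fun x hx =>
          Submodule.mem_iSup_of_mem (-1) (Submodule.mem_iSup_of_mem (by norm_num) hx)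
      exact hN
    · intro x hx
      have hx' := h.mem_iSup_gradingComp_iff.1 hx
      change x ∈ LieSubalgebra.lieSpan ℝ 𝔤 (gradingComp b c (-1) : Set 𝔤)
      rw [h.eq_sum_elem fun k => hx' k k (by simp)]
      refine sum_mem fun k _ => sum_mem fun l _ => ?_
      split_ifs with hkl
      · by_cases hd : b l - b k < 0
        · refine (LieSubalgebra.lieSpan ℝ 𝔤 _).smul_mem _ ?_
          -- The induction parameter d is defined by degree = -(d + 1).
          exact h.elem_mem_lieSpan b hb (b l - b k + 1).natAbs k l hkl (by omega)
        · rw [hx' k l hd, zero_smul]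
          exact zero_mem _
      · exact zero_mem _

variable {b} (hb : ∀ k l, b l + 1 < b k → ∃ j, b j = b l + 1)

lemma mem_filt_grading_iff {i : ℤ} {x : 𝔤} :
    x ∈ (h.grading b hb).filt i ↔ ∀ k l, b l - b k < i → c x k l = 0 := by
  refine (h.mem_iSup_gradingComp_iff (p := fun j => i ≤ j)).trans ?_
  simp only [not_le]

lemma mem_filt_zero_grading_iff {x : 𝔤} :
    x ∈ (h.grading b hb).filt 0 ↔ (c x).BlockTriangular b := by
  rw [mem_filt_grading_iff]
  exact forall₂_congr fun k l => by rw [sub_neg]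

/-- For x in an ideal inside 𝔤₀, the bracket with a unit of nonzero degree lies both in 𝔤₀ and in
that degree, hence vanishes. Commuting with all units between different levels makes x scalar,
provided there are at least two levels. -/
theorem isEffective_grading (hb' : ∀ k, ∃ l, b l ≠ b k) : (h.grading b hb).IsEffective := by
  intro I hI
  rw [LieSubmodule.eq_bot_iff]
  intro x hx
  have h1 : ∀ k l (hkl : k ≠ l), b l ≠ b k → ⁅x, h.elem k l hkl⁆ = 0 := by
    intro k l hkl hbl
    have h2 : ⁅x, h.elem k l hkl⁆ ∈ gradingComp b c 0 :=
      hI _ (lie_mem_left ℝ 𝔤 I x _ hx)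
    have h3 := h.lie_mem_gradingComp b (show x ∈ gradingComp b c 0 from hI x hx)
      (h.elem_mem_gradingComp b hkl)
    apply h.injective
    ext i j
    rw [map_zero]
    by_cases hij : b j - b i = 0
    · exact h3 i j (by omega)
    · exact h2 i j hij
  have h4 : ∀ k l, k ≠ l → b l ≠ b k → ∀ i j,
      (if j = l then c x i k else 0) = if i = k then c x l j else 0 := by
    intro k l hkl hbl i j
    have h5 := congrFun (congrFun (congrArg c (h1 k l hkl hbl)) i) j
    rw [h.map_lie, h.map_elem, map_zero] at h5
    rw [← mul_single_one_apply, ← single_one_mul_apply]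
    exact sub_eq_zero.1 h5
  have hne : ∀ {k l}, b l ≠ b k → k ≠ l := by rintro k _ hbl rfl; exact hbl rfl
  have hdiag : ∀ k l, b l ≠ b k → c x k k = c x l l := fun k l hbl => by
    have := h4 k l (hne hbl) hbl k l
    rwa [if_pos rfl, if_pos rfl] at this
  refine h.eq_zero_of_diagonal_eq (fun i k hik => ?_) fun k k' => ?_
  · obtain ⟨l, hl⟩ := hb' k
    have := h4 k l (hne hl) hl i l
    rwa [if_pos rfl, if_neg hik] at this
  · by_cases hkk : b k' = b k
    · obtain ⟨l, hl⟩ := hb' k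
      rw [hdiag k l hl, hdiag k' l (by rwa [hkk])]
    · exact hdiag k k' hkk

end IsSpecialLinear

end SpecialLinearAlgebra

/-! ### Block triangular matrices as a normalizer -/

section Normalizer

variable {n : Type*} [Fintype n] [DecidableEq n] {b : n → ℤ}

lemma mul_eq_zero_of_conj_blockTriangular [Nonempty n] {g g' : Matrix n n ℝ} (hg : g * g' = 1)
    (h : ∀ a : Matrix n n ℝ, a.trace = 0 → a.BlockTriangular b → (g * a * g').BlockTriangular b)
    {i j k l : n} (hkl : b k ≤ b l) (hij : b j < b i) : g i k * g' l j = 0 := by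
  -- The matrix unit is made traceless by a multiple of 1. Conjugation leaves that multiple
  -- unchanged, and it has no entry at (i, j).
  set r : ℝ := (Matrix.single k l (1 : ℝ)).trace / Fintype.card n with hr
  have hcard : (Fintype.card n : ℝ) ≠ 0 := by exact_mod_cast Fintype.card_ne_zero
  have h1 : (Matrix.single k l (1 : ℝ) - r • 1).trace = 0 := by
    rw [Matrix.trace_sub, Matrix.trace_smul, Matrix.trace_one, hr, smul_eq_mul,
      div_mul_cancel₀ _ hcard, sub_self]
  have h2 : (Matrix.single k l (1 : ℝ) - r • 1).BlockTriangular b := by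
    refine Matrix.BlockTriangular.sub (fun i' j' hij' => ?_) (fun i' j' hij' => ?_)
    · rw [Matrix.single_apply_of_ne]
      rintro ⟨rfl, rfl⟩
      exact absurd hij' (not_lt.2 hkl)
    · rw [Matrix.smul_apply, Matrix.one_apply_ne (by rintro rfl; exact lt_irrefl _ hij'), smul_zero]
  have h3 := h _ h1 h2 hij
  have h4 : (g * (Matrix.single k l (1 : ℝ) - r • 1) * g') =
      g * (Matrix.single k l 1 * g') - r • 1 := by
    rw [mul_sub, sub_mul, mul_assoc, mul_smul_comm, mul_one, smul_mul_assoc, hg]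
  rw [h4, Matrix.sub_apply, Matrix.smul_apply,
    Matrix.one_apply_ne (by rintro rfl; exact lt_irrefl _ hij), smul_zero, sub_zero,
    Matrix.mul_apply, Finset.sum_eq_single k] at h3
  · rwa [single_one_mul_apply, if_pos rfl] at h3
  · intro s _ hs
    rw [single_one_mul_apply, if_neg hs, mul_zero]
  · simp

/-- The normalizer of the algebra of block triangular matrices consists of block triangular
matrices. -/
theorem blockTriangular_of_conj_blockTriangular [Nonempty n] {g g' : Matrix n n ℝ}
    (hg : g * g' = 1)
    (h : ∀ a : Matrix n n ℝ, a.trace = 0 → a.BlockTriangular b → (g * a * g').BlockTriangular b) :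
    g.BlockTriangular b := by
  intro i₀ k₀ hik
  by_contra hne
  have hg' : g' * g = 1 := mul_eq_one_comm.1 hg
  have h0 : ∀ l j, b k₀ ≤ b l → b j < b i₀ → g' l j = 0 := fun l j hl hj =>
    (mul_eq_zero.1 (mul_eq_zero_of_conj_blockTriangular hg h hl hj)).resolve_left hne
  -- A dimension count: by `h0` the rows of g' of level at least b k₀ are supported in the columns
  -- of level at least b i₀, and they are independent as g' is invertible. But there are strictly
  -- fewer such columns, since k₀ is not among them.
  let T : ({l // b k₀ ≤ b l} → ℝ) →ₗ[ℝ] ({j // b i₀ ≤ b j} → ℝ) :=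
    (Matrix.of fun (l : {l // b k₀ ≤ b l}) (j : {j // b i₀ ≤ b j}) => g' l j).vecMulLinear
  have hT : Function.Injective T := by
    rw [← LinearMap.ker_eq_bot, LinearMap.ker_eq_bot']
    intro v hv
    let w : n → ℝ := fun l => if hl : b k₀ ≤ b l then v ⟨l, hl⟩ else 0
    have hsum : ∀ f : n → ℝ, ∑ l, w l * f l = ∑ l : {l // b k₀ ≤ b l}, v l * f l := by
      intro f
      have h2 : ∑ l with b k₀ ≤ b l, w l * f l = ∑ l, w l * f l :=
        Finset.sum_filter_of_ne fun l _ hl => by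
          by_contra hl'
          exact hl (by simp [w, hl'])
      rw [← h2, Finset.sum_subtype _ (p := fun l => b k₀ ≤ b l) (by simp)]
      exact Finset.sum_congr rfl fun l _ => by simp [w, l.2]
    have hw : Matrix.vecMul w g' = 0 := by
      ext j
      change ∑ l, w l * g' l j = 0
      rw [hsum]
      by_cases hj : b i₀ ≤ b j
      · exact congrFun hv ⟨j, hj⟩
      · exact Finset.sum_eq_zero fun l _ => by rw [h0 l j l.2 (not_le.1 hj), mul_zero]
    have hw0 : w = 0 := by
      rw [← Matrix.vecMul_one w, ← hg', ← Matrix.vecMul_vecMul, hw, Matrix.zero_vecMul]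
    ext l
    have := congrFun hw0 l
    simpa [w, l.2] using this
  have h1 := LinearMap.finrank_le_finrank_of_injective hT
  rw [Module.finrank_fintype_fun_eq_card, Module.finrank_fintype_fun_eq_card,
    Fintype.card_subtype, Fintype.card_subtype] at h1
  refine absurd h1 (not_le.2 (Finset.card_lt_card ?_))
  refine Finset.ssubset_iff_subset_ne.2 ⟨fun j hj => ?_, fun heq => ?_⟩
  · simp only [Finset.mem_filter, Finset.mem_univ, true_and] at hj ⊢
    exact hik.le.trans hj
  · have : k₀ ∈ Finset.univ.filter fun l => b i₀ ≤ b l := by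
      rw [heq]; simp
    simp only [Finset.mem_filter, Finset.mem_univ, true_and] at this
    exact absurd this (not_le.2 hik)

end Normalizer

/-! ### Block triangular groups as parabolic subgroups -/

section ParabolicMatrixGroups

variable {n : Type*} [Fintype n] [DecidableEq n] [Nonempty n] {A : Type*} [NormedRing A]
  [NormedAlgebra ℝ A] [CompleteSpace A] [FiniteDimensional ℝ A] (m : A ≃ₐ[ℝ] Matrix n n ℝ)
  (b : n → ℤ)

theorem isSpecialLinear_toMat : IsSpecialLinear (m.toLinearMap ∘ₗ toMat m) where
  injective := m.injective.comp (toMat_injective m)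
  mem_range_iff a := by
    rw [LinearMap.range_comp]
    constructor
    · rintro ⟨x, hx, rfl⟩
      exact (mem_range_toMat m).1 hx
    · intro ha
      exact ⟨m.symm a, (mem_range_toMat m).2 (by simpa using ha), by simp⟩
  map_lie x y := by
    simp only [LinearMap.comp_apply, toMat_lie]
    exact (map_sub m _ _).trans (by rw [map_mul, map_mul]; rfl)

instance : LieAlgebra.IsSemisimple ℝ (slAlgebra m) :=
  have : FiniteDimensional ℝ (slAlgebra m) := inferInstanceAs (FiniteDimensional ℝ (slb m 0))
  (isSpecialLinear_toMat m).isSemisimple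

variable {b} (hb : ∀ k l, b l + 1 < b k → ∃ j, b j = b l + 1)

/-- The grading of the special linear algebra by block degrees. -/
abbrev slGrading : Grading (slAlgebra m) := (isSpecialLinear_toMat m).grading b hb

lemma mem_filt_zero_slGrading_iff {x : slAlgebra m} :
    x ∈ (slGrading m hb).filt 0 ↔ (m (toMat m x)).BlockTriangular b :=
  (isSpecialLinear_toMat m).mem_filt_zero_grading_iff hb

theorem isParabolicSubgroup_blockSubgroup :
    IsParabolicSubgroup (E' := slb m b) (slGrading m hb) (blockSubgroup m b) := by
  refine ⟨fun g => ?_, isSmoothEmbedding_blockSubgroup m b⟩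
  refine Iff.trans ?_ (map_AdE_eq_iff (W := (slGrading m hb).filtE 0)).symm
  have h1 : ∀ x : slAlgebra m, Ad g x ∈ (slGrading m hb).filt 0 ↔
      (m (SL.val m g) * m (toMat m x) * m (SL.val m g⁻¹)).BlockTriangular b := fun x => by
    rw [mem_filt_zero_slGrading_iff, toMat_Ad, map_mul, map_mul]
  constructor
  · intro hg x hx
    refine (h1 x).2 ?_
    have hx' := (mem_filt_zero_slGrading_iff m hb).1 hx
    exact (Matrix.BlockTriangular.mul hg hx').mul (SL.blockTriangular_inv m b hg)
  · intro h
    refine blockTriangular_of_conj_blockTriangular (g' := m (SL.val m g⁻¹))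
      (by rw [← map_mul, SL.val_mul_inv, map_one]) fun a ha hab => ?_
    obtain ⟨x, hx⟩ := (mem_range_toMat m).2 (show (m (m.symm a)).trace = 0 by simpa using ha)
    have hxa : m (toMat m x) = a := by rw [hx]; simp
    have := (h1 x).1 (h x ((mem_filt_zero_slGrading_iff m hb).2 (by rwa [hxa])))
    rwa [hxa] at this

end ParabolicMatrixGroups

/-! ### Vector fields and brackets in ambient coordinates -/

section EmbeddedCalculus

open Filter Set VectorField
open scoped Topology

namespace IsEmbeddedAtlas

variable {E F M : Type*} [NormedAddCommGroup E] [NormedSpace ℝ E]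
  [NormedAddCommGroup F] [NormedSpace ℝ F] [TopologicalSpace M] [ChartedSpace E M] {ι : M → F}

lemma hasMFDerivAt (h : IsEmbeddedAtlas (E := E) ι) (x : M) :
    HasMFDerivAt 𝓘(ℝ, E) 𝓘(ℝ, F) ι x (mfd (E := E) ι x) :=
  ((h.contMDiff x).mdifferentiableAt (by simp)).hasMFDerivAt

lemma mfd_comp (h : IsEmbeddedAtlas (E := E) ι) {F' : Type*} [NormedAddCommGroup F']
    [NormedSpace ℝ F'] {g : F → F'} {x : M} (hg : DifferentiableAt ℝ g (ι x))
    (v : TangentSpace 𝓘(ℝ, E) x) :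
    mfd (E := E) (fun y => g (ι y)) x v = fderiv ℝ g (ι x) (mfd (E := E) ι x v) := by
  have h1 := (HasMFDerivAt.comp x hg.hasFDerivAt.hasMFDerivAt (h.hasMFDerivAt x)).mfderiv
  exact congrArg (fun T : E →L[ℝ] F' => T v) h1

variable [IsManifold 𝓘(ℝ, E) ∞ M]

/-- A vector field is differentiable if its image under `ι` is. -/
lemma mdifferentiableAt_section (h : IsEmbeddedAtlas (E := E) ι)
    {V : ∀ y : M, TangentSpace 𝓘(ℝ, E) y} {x : M}
    (hV : MDifferentiableAt 𝓘(ℝ, E) 𝓘(ℝ, F) (fun y => mfd (E := E) ι y (V y)) x) :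
    MDifferentiableAt 𝓘(ℝ, E) 𝓘(ℝ, E).tangent
      (fun y => (V y : TangentBundle 𝓘(ℝ, E) M)) x := by
  have : IsManifold 𝓘(ℝ, E) 1 M := .of_le (n := ∞) ENat.LEInfty.out
  refine (_root_.mdifferentiableAt_section 𝓘(ℝ, E) V).2 ?_
  obtain ⟨ρ, hρ⟩ := h.exists_retract x
  have hsrc : ∀ᶠ y in 𝓝 x, y ∈ (chartAt E x).source :=
    (chartAt E x).open_source.mem_nhds (mem_chart_source E x)
  -- In the trivialization at x the field is the ambient field followed by the derivative of ρ,
  -- because the chart agrees with ρ ∘ ι on its source.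
  have h1 : MDifferentiableAt 𝓘(ℝ, E) 𝓘(ℝ, E)
      (fun y => fderiv ℝ ρ (ι y) (mfd (E := E) ι y (V y))) x := by
    have h2 : DifferentiableAt ℝ (fderiv ℝ ρ) (ι x) :=
      ((hρ x (mem_chart_source E x)).2.fderiv_right (m := ∞) (by simp)).differentiableAt (by simp)
    have h3 : MDifferentiableAt 𝓘(ℝ, E) 𝓘(ℝ, F →L[ℝ] E) (fun y => fderiv ℝ ρ (ι y)) x :=
      h2.mdifferentiableAt.comp x (h.hasMFDerivAt x).mdifferentiableAt
    exact h3.clm_apply hV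
  refine h1.congr_of_eventuallyEq ?_
  filter_upwards [hsrc] with y hy
  have h4 : (chartAt E x : M → E) =ᶠ[𝓝 y] fun y => ρ (ι y) := by
    filter_upwards [(chartAt E x).open_source.mem_nhds hy] with z hz
    exact (hρ z hz).1
  have hd := (hρ y hy).2.differentiableAt (by simp)
  have hm : MDifferentiableAt 𝓘(ℝ, E) 𝓘(ℝ, E) (chartAt E x : M → E) y :=
    mdifferentiableAt_atlas (ChartedSpace.chart_mem_atlas x) hy
  have h5 : mfd (E := E) (chartAt E x : M → E) y (V y) =
      fderiv ℝ ρ (ι y) (mfd (E := E) ι y (V y)) := by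
    rw [← h.mfd_comp hd]
    exact congrArg (fun T : E →L[ℝ] E => T (V y)) h4.mfderiv_eq
  rw [← h5, mfd_eq_fderiv hm, TangentBundle.trivializationAt_apply, ModelWithCorners.range_eq_univ,
    fderivWithin_univ]
  rfl

/-- The differential of `ι` is a smooth function on the tangent bundle. -/
lemma contMDiff_mfd (h : IsEmbeddedAtlas (E := E) ι) :
    ContMDiff 𝓘(ℝ, E).tangent 𝓘(ℝ, F) ∞
      (fun v : TangentBundle 𝓘(ℝ, E) M => mfd (E := E) ι v.1 v.2) :=
  (contMDiff_snd_tangentBundle_modelSpace F 𝓘(ℝ, F)).comp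
    (h.contMDiff.contMDiff_tangentMap (m := ∞) (by simp))

/-- The bracket of vector fields that are induced by vector fields on the ambient space. -/
theorem mfd_mlieBracket [CompleteSpace E] (h : IsEmbeddedAtlas (E := E) ι)
    {V W : ∀ y : M, TangentSpace 𝓘(ℝ, E) y} {f g : F → F} {x : M}
    (hV : ∀ y, mfd (E := E) ι y (V y) = f (ι y)) (hW : ∀ y, mfd (E := E) ι y (W y) = g (ι y))
    (hf : DifferentiableAt ℝ f (ι x)) (hg : DifferentiableAt ℝ g (ι x)) :
    mfd (E := E) ι x (mlieBracket 𝓘(ℝ, E) V W x) =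
      fderiv ℝ g (ι x) (f (ι x)) - fderiv ℝ f (ι x) (g (ι x)) := by
  have hιd := (h.hasMFDerivAt x).mdifferentiableAt
  have h1 := ParabolicGeometry.mfd_mlieBracket (V := V) (W := W)
    ((h.contMDiff x).of_le (ENat.LEInfty.out : (2 : WithTop ℕ∞) ≤ ∞))
    (h.mdifferentiableAt_section (V := V) (by
      simp only [hV]; exact hf.mdifferentiableAt.comp x hιd))
    (h.mdifferentiableAt_section (V := W) (by
      simp only [hW]; exact hg.mdifferentiableAt.comp x hιd))
  rw [h1]
  simp only [hV, hW]
  rw [h.mfd_comp hg, h.mfd_comp hf, hV, hW]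

end IsEmbeddedAtlas

section Product

variable {V E F M : Type*} [NormedAddCommGroup V] [NormedSpace ℝ V] [NormedAddCommGroup E]
  [NormedSpace ℝ E] [NormedAddCommGroup F] [NormedSpace ℝ F] [TopologicalSpace M]
  [ChartedSpace E M] {ι : M → F}

variable (V E M) in
/-- The product of a vector space and a manifold. -/
abbrev vectorProdChartedSpace : ChartedSpace (V × E) (V × M) :=
  (prodChartedSpace V V E M : ChartedSpace (ModelProd V E) (V × M))

theorem isEmbeddedAtlas_vectorProd (h : IsEmbeddedAtlas (E := E) ι) :
    @IsEmbeddedAtlas (V × E) (V × F) (V × M) _ _ _ _ _ (vectorProdChartedSpace V E M)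
      (Prod.map id ι) := by
  let _ := vectorProdChartedSpace V E M
  have hch : ∀ x : V × M, chartAt (V × E) x =
      (OpenPartialHomeomorph.refl V).prod (chartAt E x.2) := fun x => rfl
  refine ⟨fun x => ?_, fun x => ?_, ?_⟩
  · obtain ⟨ρ, hρ⟩ := h.exists_retract x.2
    refine ⟨fun z => (z.1, ρ z.2), fun y hy => ?_⟩
    rw [hch] at hy ⊢
    have h1 := hρ y.2 hy.2
    refine ⟨Prod.ext rfl h1.1, contDiffAt_fst.prodMk ?_⟩
    exact ContDiffAt.comp (g := ρ) _ h1.2 contDiffAt_snd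
  · rw [hch]
    refine contDiff_fst.contDiffOn.prodMk ?_
    exact (h.smooth_symm x.2).comp contDiff_snd.contDiffOn fun v hv => hv.2
  · rintro _ ⟨e, he, e', he', rfl⟩
    obtain ⟨y, rfl⟩ := h.exists_eq_chartAt e' he'
    refine ⟨(0, y), ?_⟩
    have : e = OpenPartialHomeomorph.refl V := he
    rw [hch, this]

theorem mfd_vectorProd (h : IsEmbeddedAtlas (E := E) ι) (x : V × M) (v : V × E) :
    letI := vectorProdChartedSpace V E M
    (mfd (E := V × E) (Prod.map id ι : V × M → V × F) x v : V × F) =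
      (v.1, mfd (E := E) ι x.2 v.2) := by
  let _ := vectorProdChartedSpace V E M
  refine ((isEmbeddedAtlas_vectorProd h).mfd_eq x v).trans ?_
  have h1 : DifferentiableAt ℝ (fun w => ι ((chartAt E x.2).symm w)) (chartAt E x.2 x.2) :=
    ((h.smooth_symm x.2).contDiffAt ((chartAt E x.2).open_target.mem_nhds
      (mem_chart_target E x.2))).differentiableAt (by simp)
  have h2 : HasFDerivAt (fun w : V × E => (w.1, ι ((chartAt E x.2).symm w.2)))
      ((ContinuousLinearMap.fst ℝ V E).prod
        ((fderiv ℝ (fun w => ι ((chartAt E x.2).symm w)) (chartAt E x.2 x.2)).comp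
          (ContinuousLinearMap.snd ℝ V E))) (x.1, chartAt E x.2 x.2) :=
    hasFDerivAt_fst.prodMk
      (HasFDerivAt.comp (x.1, chartAt E x.2 x.2) (f := fun w : V × E => w.2) h1.hasFDerivAt
        hasFDerivAt_snd)
  have h3 := h.mfd_eq x.2 v.2
  have h4 := congrArg (fun T : V × E →L[ℝ] V × F => T v) h2.fderiv
  refine h4.trans (Prod.ext rfl h3.symm)

end Product

end EmbeddedCalculus

/-! ### A deformation of the flat Cartan geometry on an abelian complement -/

section TwistedGeometry

open Filter Set VectorField
open scoped Topology

variable {n : Type*} [Fintype n] [DecidableEq n] {A : Type*} [NormedRing A]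
  [NormedAlgebra ℝ A] (m : A ≃ₐ[ℝ] Matrix n n ℝ) (b : n → ℤ)

/-- An abelian complement `V` to the algebra of block triangular matrices, with two linear
functionals and an element `z ∈ V`, that define a deformation of the flat Cartan geometry on
`V`. -/
structure FlatTwist where
  /-- the complement -/
  V : Submodule ℝ A
  /-- the projection onto the complement -/
  ν : A →L[ℝ] V
  ν_coe : ∀ v : V, ν (v : A) = v
  ν_eq_zero : ∀ a ∈ slb m b, ν a = 0
  sub_ν_mem : ∀ a, (m a).trace = 0 → a - ν a ∈ slb m b
  trace_coe : ∀ v : V, (m (v : A)).trace = 0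
  coe_mul_coe : ∀ v w : V, (v : A) * (w : A) = 0
  /-- the first functional -/
  μ₁ : A →L[ℝ] ℝ
  /-- the second functional -/
  μ₂ : A →L[ℝ] ℝ
  μ₁_ν : ∀ a, μ₁ (ν a) = μ₁ a
  μ₂_ν : ∀ a, μ₂ (ν a) = μ₂ a
  /-- the direction of the deformation -/
  z : V
  μ₁_z : μ₁ (z : A) = 0
  μ₂_z : μ₂ (z : A) = 0

lemma slb_mul_conj_mem (h : blockSubgroup m b) {a : A} (ha : a ∈ slb m b) :
    blockVal m b h * a * blockVal m b h⁻¹ ∈ slb m b := by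
  refine ⟨?_, ?_⟩
  · rw [map_mul, Matrix.trace_mul_comm, ← map_mul, ← mul_assoc, ← map_mul (blockVal m b),
      inv_mul_cancel, map_one, one_mul]
    exact ha.1
  · rw [map_mul, map_mul]
    exact (Matrix.BlockTriangular.mul h.2 ha.2).mul (h⁻¹).2

lemma trace_conj (h : blockSubgroup m b) (a : A) :
    (m (blockVal m b h * a * blockVal m b h⁻¹)).trace = (m a).trace := by
  rw [map_mul, Matrix.trace_mul_comm, ← map_mul, ← mul_assoc, ← map_mul (blockVal m b),
    inv_mul_cancel, map_one, one_mul]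

variable {b} in
lemma blockVal_inv_mul (h : blockSubgroup m b) : blockVal m b h⁻¹ * blockVal m b h = 1 := by
  rw [← map_mul, inv_mul_cancel, map_one]

variable {b} in
lemma blockVal_mul_inv (h : blockSubgroup m b) : blockVal m b h * blockVal m b h⁻¹ = 1 := by
  rw [← map_mul, mul_inv_cancel, map_one]

variable {b} in
lemma ringInverse_blockVal (h : blockSubgroup m b) :
    Ring.inverse (blockVal m b h) = blockVal m b h⁻¹ :=
  Ring.inverse_unit (⟨blockVal m b h, blockVal m b h⁻¹, blockVal_mul_inv m h,
    blockVal_inv_mul m h⟩ : Aˣ)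

variable {b} in
lemma contDiffAt_ringInverse_blockVal [CompleteSpace A] (h : blockSubgroup m b) :
    ContDiffAt ℝ ∞ Ring.inverse (blockVal m b h) :=
  contDiffAt_ringInverse ℝ (⟨blockVal m b h, blockVal m b h⁻¹, blockVal_mul_inv m h,
    blockVal_inv_mul m h⟩ : Aˣ)

namespace FlatTwist

variable {m b} (T : FlatTwist m b)

/-- The total space of the trivial principal bundle over `V`. -/
abbrev TotalSpace : Type _ := T.V × blockSubgroup m b

/-- The right translations of the trivial principal bundle. -/
def act (u : T.TotalSpace) (h : blockSubgroup m b) : T.TotalSpace := (u.1, u.2 * h)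

/-- The inclusion of the total space in a vector space. -/
def val : T.TotalSpace → T.V × A := Prod.map id (blockVal m b)

/-- The deformation of the identity on tangent vectors to `V`. -/
def twist (x : T.V) (v : T.V) : T.V := v + (T.μ₁ x * T.μ₂ v) • T.z

/-- The perturbation v ↦ μ₁(x) μ₂(v) z has square zero because μ₂(z) = 0, so the inverse is obtained
by changing the sign. -/
lemma twist_sub (x v : T.V) : T.twist x (v - (T.μ₁ x * T.μ₂ v) • T.z) = v := by
  simp [twist, T.μ₂_z]

lemma twist_eq_zero {x v : T.V} (h : T.twist x v = 0) : v = 0 := by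
  have h1 : T.μ₂ v = 0 := by
    have := congrArg (fun w : T.V => T.μ₂ (w : A)) h
    simpa [twist, T.μ₂_z] using this
  simpa [twist, h1] using h

variable [CompleteSpace A] [FiniteDimensional ℝ A] [Nonempty n]

instance : ChartedSpace (T.V × slb m b) T.TotalSpace :=
  vectorProdChartedSpace T.V (slb m b) (blockSubgroup m b)

lemma isEmbeddedAtlas : IsEmbeddedAtlas (E := T.V × slb m b) T.val :=
  isEmbeddedAtlas_vectorProd (isEmbeddedAtlas_blockVal m b)

instance : IsManifold 𝓘(ℝ, T.V × slb m b) ∞ T.TotalSpace := T.isEmbeddedAtlas.isManifold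

lemma mfd_val (u : T.TotalSpace) (w : T.V × slb m b) :
    (mfd (E := T.V × slb m b) T.val u w : T.V × A) = (w.1, blockVal m b u.2 * (w.2 : A)) := by
  refine (mfd_vectorProd (isEmbeddedAtlas_blockVal m b) u w).trans (Prod.ext rfl ?_)
  exact mfd_blockVal m b u.2 w.2

instance : T2Space T.TotalSpace :=
  have : T2Space (blockSubgroup m b) := inferInstance
  inferInstance

instance : SecondCountableTopology T.TotalSpace := by
  have : SecondCountableTopology T.V := by
    have : ProperSpace T.V := FiniteDimensional.proper ℝ _
    infer_instance
  have : SecondCountableTopology (blockSubgroup m b) :=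
    Topology.IsEmbedding.secondCountableTopology
      (f := (Subtype.val : blockSubgroup m b → SL m)) Topology.IsEmbedding.subtypeVal
  infer_instance

lemma contMDiff_val_snd :
    ContMDiff 𝓘(ℝ, T.V × slb m b) 𝓘(ℝ, A) ∞ fun u : T.TotalSpace => blockVal m b u.2 :=
  (contDiff_snd : ContDiff ℝ ∞ (Prod.snd : T.V × A → A)).contMDiff.comp T.isEmbeddedAtlas.contMDiff

lemma contMDiff_base :
    ContMDiff 𝓘(ℝ, T.V × slb m b) 𝓘(ℝ, T.V) ∞ fun u : T.TotalSpace => u.1 :=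
  (contDiff_fst : ContDiff ℝ ∞ (Prod.fst : T.V × A → T.V)).contMDiff.comp
    T.isEmbeddedAtlas.contMDiff

theorem isPrincipalBundle : IsPrincipalBundle (EB := T.V × slb m b) (EM := T.V)
    (EH := slb m b) T.act Prod.fst where
  act_one u := Prod.ext rfl (mul_one _)
  act_mul u a c := Prod.ext rfl (mul_assoc _ _ _)
  smooth_act := by
    refine T.isEmbeddedAtlas.contMDiff_of_comp ?_ ?_
    · exact (continuous_fst.comp continuous_fst).prodMk
        ((continuous_snd.comp continuous_fst).mul continuous_snd)
    · have h1 : ContMDiff (𝓘(ℝ, T.V × slb m b).prod 𝓘(ℝ, slb m b)) 𝓘(ℝ, A) ∞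
          (fun x : T.TotalSpace × blockSubgroup m b => blockVal m b x.1.2 * blockVal m b x.2) :=
        (contDiff_mul (𝕜 := ℝ) (𝔸 := A)).contMDiff.comp
          ((T.contMDiff_val_snd.comp contMDiff_fst).prodMk_space
            ((isEmbeddedAtlas_blockVal m b).contMDiff.comp contMDiff_snd))
      have h2 := (T.contMDiff_base.comp (contMDiff_fst (I := 𝓘(ℝ, T.V × slb m b))
        (J := 𝓘(ℝ, slb m b)) (M := T.TotalSpace) (N := blockSubgroup m b))).prodMk_space h1
      have h3 : (fun x : T.TotalSpace × blockSubgroup m b => T.val (T.act x.1 x.2)) =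
          fun x => (x.1.1, blockVal m b x.1.2 * blockVal m b x.2) :=
        funext fun x => Prod.ext rfl (map_mul (blockVal m b) _ _)
      rw [h3]
      exact h2
  proj_act u h := rfl
  locally_trivial x := by
    refine ⟨Set.univ, (Homeomorph.refl T.TotalSpace).toOpenPartialHomeomorph, isOpen_univ,
      mem_univ _, rfl, univ_prod_univ.symm, ContMDiff.contMDiffOn ?_, ContMDiff.contMDiffOn ?_,
      fun u _ => ⟨rfl, fun h => rfl⟩⟩
    · exact T.contMDiff_base.prodMk ((isEmbeddedAtlas_blockVal m b).contMDiff_of_comp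
        continuous_snd T.contMDiff_val_snd)
    · refine T.isEmbeddedAtlas.contMDiff_of_comp continuous_id ?_
      exact contMDiff_fst.prodMk_space
        ((isEmbeddedAtlas_blockVal m b).contMDiff.comp contMDiff_snd)

/-- The Cartan connection. -/
def form : OneForm (slb m 0) (SL m) (T.V × slb m b) T.TotalSpace := fun u =>
  (linearRetraction (slb m 0)).comp
    (((ContinuousLinearMap.mulLeftRight ℝ A (blockVal m b u.2⁻¹) (blockVal m b u.2)).comp
        (T.V.subtypeL + (T.μ₁ u.1 • T.μ₂.comp T.V.subtypeL).smulRight (T.z : A))).comp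
          (ContinuousLinearMap.fst ℝ T.V (slb m b)) +
      (slb m b).subtypeL.comp (ContinuousLinearMap.snd ℝ T.V (slb m b)))

lemma toMat_form (u : T.TotalSpace) (w : T.V × slb m b) :
    toMat m (T.form u w) =
      blockVal m b u.2⁻¹ * (T.twist u.1 w.1 : A) * blockVal m b u.2 + w.2 := by
  have h1 : T.form u w = linearRetraction (slb m 0)
      (blockVal m b u.2⁻¹ * (T.twist u.1 w.1 : A) * blockVal m b u.2 + w.2) := by
    rfl
  have h2 : blockVal m b u.2⁻¹ * (T.twist u.1 w.1 : A) * blockVal m b u.2 + w.2 ∈ slb m 0 := by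
    refine ⟨?_, fun _ _ hij => absurd hij (lt_irrefl _)⟩
    have h3 := trace_conj m b u.2⁻¹ (T.twist u.1 w.1 : A)
    rw [inv_inv] at h3
    rw [map_add, Matrix.trace_add, h3, T.trace_coe, w.2.2.1, add_zero]
  exact (congrArg (Subtype.val : slb m 0 → A) h1).trans (coe_linearRetraction h2)

/-- This form of the connection refers only to the ambient point and velocity; smoothness,
equivariance and the fundamental fields are all checked from it. -/
lemma toMat_form_eq (u : T.TotalSpace) (w : TangentSpace 𝓘(ℝ, T.V × slb m b) u) :
    toMat m (T.form u w) = blockVal m b u.2⁻¹ *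
      (T.twist u.1 (mfd (E := T.V × slb m b) T.val u w).1 : A) * blockVal m b u.2 +
      blockVal m b u.2⁻¹ * (mfd (E := T.V × slb m b) T.val u w).2 := by
  have h1 := T.mfd_val u w
  rw [h1]
  refine (T.toMat_form u w).trans ?_
  rw [← mul_assoc, blockVal_inv_mul, one_mul]

/-- The inverse of the Cartan connection. -/
def formInv (u : T.TotalSpace) (X : slAlgebra m) : T.V × slb m b :=
  let a := blockVal m b u.2 * toMat m X * blockVal m b u.2⁻¹
  (T.ν a - (T.μ₁ u.1 * T.μ₂ a) • T.z,
    linearRetraction (slb m b) (blockVal m b u.2⁻¹ * (a - T.ν a) * blockVal m b u.2))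

lemma coe_formInv_snd (u : T.TotalSpace) (X : slAlgebra m) :
    ((T.formInv u X).2 : A) = blockVal m b u.2⁻¹ *
      (blockVal m b u.2 * toMat m X * blockVal m b u.2⁻¹ -
        T.ν (blockVal m b u.2 * toMat m X * blockVal m b u.2⁻¹)) * blockVal m b u.2 := by
  refine coe_linearRetraction ?_
  have h1 := slb_mul_conj_mem m b u.2⁻¹ (T.sub_ν_mem
    (blockVal m b u.2 * toMat m X * blockVal m b u.2⁻¹) (by
      rw [trace_conj]; exact (mem_range_toMat m).1 ⟨X, rfl⟩))
  rwa [inv_inv] at h1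

lemma form_formInv (u : T.TotalSpace) (X : slAlgebra m) : T.form u (T.formInv u X) = X := by
  refine toMat_injective m ((T.toMat_form u _).trans ?_)
  rw [coe_formInv_snd, formInv]
  have h1 : T.twist u.1 (T.ν (blockVal m b u.2 * toMat m X * blockVal m b u.2⁻¹) -
      (T.μ₁ u.1 * T.μ₂ (blockVal m b u.2 * toMat m X * blockVal m b u.2⁻¹)) • T.z) =
      T.ν (blockVal m b u.2 * toMat m X * blockVal m b u.2⁻¹) := by
    rw [← T.μ₂_ν, T.twist_sub]
  rw [h1, ← add_mul, ← mul_add, add_sub_cancel, ← mul_assoc, ← mul_assoc, blockVal_inv_mul,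
    one_mul, mul_assoc, blockVal_inv_mul, mul_one]

/-- If the form vanishes on w, the twisted horizontal part is conjugate to a block triangular
matrix; ν kills such matrices and is the identity on V, so both parts vanish. -/
lemma bijective_form (u : T.TotalSpace) : Function.Bijective (T.form u) := by
  refine ⟨?_, fun X => ⟨T.formInv u X, T.form_formInv u X⟩⟩
  refine (injective_iff_map_eq_zero (T.form u)).2 fun w hw => ?_
  have h1 : blockVal m b u.2⁻¹ * (T.twist u.1 w.1 : A) * blockVal m b u.2 + (w.2 : A) = 0 := by
    rw [← T.toMat_form u w, hw, map_zero]
  have h2 : (T.twist u.1 w.1 : A) = -(blockVal m b u.2 * (w.2 : A) * blockVal m b u.2⁻¹) := by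
    have h3 := congrArg (fun a => blockVal m b u.2 * a * blockVal m b u.2⁻¹) h1
    simp only [mul_add, add_mul, mul_zero, zero_mul] at h3
    rw [← mul_assoc, ← mul_assoc, blockVal_mul_inv, one_mul, mul_assoc _ _ (blockVal m b u.2⁻¹),
      blockVal_mul_inv, mul_one] at h3
    exact eq_neg_of_add_eq_zero_left h3
  have h4 : T.twist u.1 w.1 = 0 := by
    rw [← T.ν_coe (T.twist u.1 w.1), h2, map_neg,
      T.ν_eq_zero _ (slb_mul_conj_mem m b u.2 w.2.2), neg_zero]
  rw [h4] at h1
  have h5 : (w.2 : A) = 0 := by simpa using h1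
  exact Prod.ext (T.twist_eq_zero h4) (Subtype.ext h5)

lemma constantField_form (X : slAlgebra m) (u : T.TotalSpace) :
    constantField T.form X u = T.formInv u X := by
  let L : (T.V × slb m b) →L[ℝ] slb m 0 := T.form u
  let e : (T.V × slb m b) ≃L[ℝ] slb m 0 :=
    (LinearEquiv.ofBijective (L : (T.V × slb m b) →ₗ[ℝ] slb m 0)
      (T.bijective_form u)).toContinuousLinearEquiv
  have h2 : constantField T.form X u = e.symm X :=
    congrArg (fun L : slb m 0 →L[ℝ] (T.V × slb m b) => L X) (ContinuousLinearMap.inverse_equiv e)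
  rw [h2]
  exact (e.symm_apply_eq).2 (T.form_formInv u X).symm

lemma contMDiff_form : ContMDiff (M' := slb m 0) 𝓘(ℝ, T.V × slb m b).tangent 𝓘(ℝ, slb m 0) ∞
    (fun v : TangentBundle 𝓘(ℝ, T.V × slb m b) T.TotalSpace => T.form v.1 v.2) := by
  let F : (T.V × A) × (T.V × A) → slb m 0 := fun p => linearRetraction (slb m 0)
    (Ring.inverse p.1.2 * (T.twist p.1.1 p.2.1 : A) * p.1.2 + Ring.inverse p.1.2 * p.2.2)
  have h1 : (fun v : TangentBundle 𝓘(ℝ, T.V × slb m b) T.TotalSpace => T.form v.1 v.2) =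
      fun v => F (T.val v.1, mfd (E := T.V × slb m b) T.val v.1 v.2) := by
    funext v
    have h2 := T.toMat_form_eq v.1 v.2
    have h3 : T.form v.1 v.2 = linearRetraction (slb m 0) (toMat m (T.form v.1 v.2)) :=
      (linearRetraction_coe (S := slb m 0) (T.form v.1 v.2)).symm
    refine h3.trans (congrArg (linearRetraction (slb m 0)) (h2.trans ?_))
    have h4 : Ring.inverse (T.val v.1).2 = blockVal m b v.1.2⁻¹ := ringInverse_blockVal m _
    rw [h4]
    rfl
  have h5 : ContMDiff 𝓘(ℝ, T.V × slb m b).tangent 𝓘(ℝ, (T.V × A) × (T.V × A)) ∞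
      (fun v : TangentBundle 𝓘(ℝ, T.V × slb m b) T.TotalSpace =>
        (T.val v.1, mfd (E := T.V × slb m b) T.val v.1 v.2)) :=
    (T.isEmbeddedAtlas.contMDiff.comp (Bundle.contMDiff_proj _)).prodMk_space
      T.isEmbeddedAtlas.contMDiff_mfd
  intro v
  have h6 : ContDiffAt ℝ ∞ F (T.val v.1, mfd (E := T.V × slb m b) T.val v.1 v.2) := by
    have h7 : ContDiffAt ℝ ∞ (fun p : (T.V × A) × (T.V × A) => Ring.inverse p.1.2)
        (T.val v.1, mfd (E := T.V × slb m b) T.val v.1 v.2) :=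
      ContDiffAt.comp (g := Ring.inverse)
        (T.val v.1, mfd (E := T.V × slb m b) T.val v.1 v.2)
        (contDiffAt_ringInverse_blockVal m v.1.2) (by fun_prop)
    have h8 : ContDiff ℝ ∞ (fun p : (T.V × A) × (T.V × A) => (T.twist p.1.1 p.2.1 : A)) := by
      have : ∀ p : (T.V × A) × (T.V × A), (T.twist p.1.1 p.2.1 : A) =
        T.V.subtypeL p.2.1 + (T.μ₁ (T.V.subtypeL p.1.1) * T.μ₂ (T.V.subtypeL p.2.1)) • (T.z : A) :=
          fun p => rfl
      simp only [this]
      fun_prop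
    refine (linearRetraction (slb m 0)).contDiff.contDiffAt.comp _ ?_
    exact ((h7.mul h8.contDiffAt).mul (by fun_prop)).add (h7.mul (by fun_prop))
  rw [h1]
  exact ContMDiffAt.comp (g := F) v h6.contMDiffAt (h5 v)

/-- Right translation by h is, in ambient coordinates, the restriction of the linear map (v, a) ↦
(v, a h). -/
lemma equivariant_form (h : blockSubgroup m b) (u : T.TotalSpace)
    (ξ : TangentSpace 𝓘(ℝ, T.V × slb m b) u) :
    T.form (T.act u h) (mfderiv 𝓘(ℝ, T.V × slb m b) 𝓘(ℝ, T.V × slb m b)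
      (fun v => T.act v h) u ξ) = Ad ((h : SL m)⁻¹) (T.form u ξ) := by
  let R : T.V × A →L[ℝ] T.V × A := (ContinuousLinearMap.fst ℝ T.V A).prod
    (((ContinuousLinearMap.mul ℝ A).flip (blockVal m b h)).comp (ContinuousLinearMap.snd ℝ T.V A))
  have hsm : ContMDiff 𝓘(ℝ, T.V × slb m b) 𝓘(ℝ, T.V × slb m b) ∞ fun v => T.act v h :=
    T.isPrincipalBundle.smooth_act.comp (contMDiff_id.prodMk contMDiff_const)
  have h1 : (fun v => T.val (T.act v h)) = fun v => R (T.val v) :=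
    funext fun v => Prod.ext rfl (map_mul (blockVal m b) _ _)
  have h2 : mfd (E := T.V × slb m b) T.val (T.act u h)
      (mfderiv 𝓘(ℝ, T.V × slb m b) 𝓘(ℝ, T.V × slb m b) (fun v => T.act v h) u ξ) =
      R (mfd (E := T.V × slb m b) T.val u ξ) := by
    have h3 := T.isEmbeddedAtlas.mfd_comp (g := R) (x := u) R.differentiableAt ξ
    have h4 := mfderiv_comp u (T.isEmbeddedAtlas.hasMFDerivAt (T.act u h)).mdifferentiableAt
      ((hsm u).mdifferentiableAt (by simp))
    have h5 := congrArg (fun L : T.V × slb m b →L[ℝ] T.V × A => L ξ) h4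
    rw [← h1, R.fderiv] at h3
    exact h5.symm.trans h3
  refine toMat_injective m ((T.toMat_form_eq _ _).trans ?_)
  rw [h2, toMat_Ad, T.toMat_form_eq]
  have h6 : blockVal m b (T.act u h).2 = blockVal m b u.2 * blockVal m b h := map_mul _ _ _
  have h7 : blockVal m b (T.act u h).2⁻¹ = blockVal m b h⁻¹ * blockVal m b u.2⁻¹ := by
    rw [← map_mul, ← mul_inv_rev]; rfl
  have h8 : SL.val m ((h : SL m)⁻¹)⁻¹ = blockVal m b h := by rw [inv_inv]; rfl
  have h9 : SL.val m (h : SL m)⁻¹ = blockVal m b h⁻¹ := rfl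
  rw [h6, h7, h8, h9]
  simp only [R, ContinuousLinearMap.prod_apply, ContinuousLinearMap.comp_apply,
    ContinuousLinearMap.flip_apply, ContinuousLinearMap.mul_apply',
    ContinuousLinearMap.coe_fst', ContinuousLinearMap.coe_snd']
  simp only [mul_add, add_mul, mul_assoc]
  rfl

lemma form_fundamental (u : T.TotalSpace) (X : slb m b) :
    T.form (T.act u 1) (mfderiv 𝓘(ℝ, slb m b) 𝓘(ℝ, T.V × slb m b)
      (fun h : blockSubgroup m b => T.act u h) 1 X) =
      mfderiv 𝓘(ℝ, slb m b) 𝓘(ℝ, slb m 0)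
        (Subtype.val : blockSubgroup m b → SL m) 1 X := by
  have hsm : ContMDiff 𝓘(ℝ, slb m b) 𝓘(ℝ, T.V × slb m b) ∞ fun h => T.act u h :=
    T.isPrincipalBundle.smooth_act.comp (contMDiff_const.prodMk contMDiff_id)
  let R : A →L[ℝ] T.V × A := (ContinuousLinearMap.inr ℝ T.V A).comp
    (ContinuousLinearMap.mul ℝ A (blockVal m b u.2))
  have h2 : mfd (E := T.V × slb m b) T.val (T.act u 1)
      (mfderiv 𝓘(ℝ, slb m b) 𝓘(ℝ, T.V × slb m b) (fun h => T.act u h) 1 X) =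
      (0, blockVal m b u.2 * (X : A)) := by
    have h1 : (fun h => T.val (T.act u h)) = fun h => (fun a => (u.1, (0 : A)) + R a)
        (blockVal m b h) :=
      funext fun v => Prod.ext (add_zero _).symm
        ((map_mul (blockVal m b) _ _).trans (zero_add _).symm)
    have hd : HasFDerivAt (fun a => (u.1, (0 : A)) + R a) R (blockVal m b 1) :=
      R.hasFDerivAt.const_add _
    have h3 := (isEmbeddedAtlas_blockVal m b).mfd_comp (x := 1) hd.differentiableAt X
    have h4 := mfderiv_comp (1 : blockSubgroup m b)
      (T.isEmbeddedAtlas.hasMFDerivAt (T.act u 1)).mdifferentiableAt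
      ((hsm 1).mdifferentiableAt (by simp))
    have h5 := congrArg (fun L : slb m b →L[ℝ] T.V × A => L X) h4
    rw [← h1, hd.fderiv] at h3
    refine h5.symm.trans (h3.trans ?_)
    have h6 := mfd_blockVal m b 1 X
    rw [map_one, one_mul] at h6
    exact congrArg R h6
  have h7 : toMat m (mfderiv 𝓘(ℝ, slb m b) 𝓘(ℝ, slb m 0)
      (Subtype.val : blockSubgroup m b → SL m) 1 X) = (X : A) := by
    have hv : ContMDiff 𝓘(ℝ, slb m b) 𝓘(ℝ, slb m 0) ∞ (Subtype.val : blockSubgroup m b → SL m) :=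
      (SL.isEmbeddedAtlas m).contMDiff_of_comp continuous_subtype_val
        (isEmbeddedAtlas_blockVal m b).contMDiff
    have h4 := mfderiv_comp (1 : blockSubgroup m b)
      ((SL.isEmbeddedAtlas m).hasMFDerivAt (1 : SL m)).mdifferentiableAt
      ((hv 1).mdifferentiableAt (by simp))
    have h5 := congrArg (fun L : slb m b →L[ℝ] A => L X) h4
    have h6 := mfd_blockVal m b 1 X
    rw [map_one, one_mul] at h6
    exact (toMat_eq_mfd m _).trans (h5.symm.trans h6)
  refine toMat_injective m ((T.toMat_form_eq _ _).trans (Eq.trans ?_ h7.symm))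
  rw [h2]
  have h8 : T.act u 1 = u := T.isPrincipalBundle.act_one u
  rw [h8, ← mul_assoc, blockVal_inv_mul]
  simp [twist]

theorem isCartanGeometry : IsCartanGeometry (EM := T.V) (EH := slb m b) T.act Prod.fst T.form where
  isPrincipalBundle := T.isPrincipalBundle
  smooth_form := T.contMDiff_form
  equivariant := T.equivariant_form
  fundamental := T.form_fundamental
  isIso := T.bijective_form

end FlatTwist

end TwistedGeometry

/-! ### Decomposable two-forms in the kernel of the codifferential -/

section DecomposableForms

variable {𝔤 : Type*} [LieRing 𝔤] [LieAlgebra ℝ 𝔤] [FiniteDimensional ℝ 𝔤]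
  [LieAlgebra.IsSemisimple ℝ 𝔤]

/-- The Killing form represents every functional, and annihilating 𝔭 is the criterion for the
representing element to lie in 𝔭₊. -/
lemma Grading.exists_killingForm_eq (gr : Grading 𝔤) (l : Module.Dual ℝ 𝔤)
    (hl : ∀ x ∈ gr.filt 0, l x = 0) : ∃ α : gr.pPlus, ∀ x, killingForm ℝ 𝔤 α x = l x := by
  have hnd : (killingForm ℝ 𝔤).Nondegenerate :=
    LieAlgebra.IsKilling.killingForm_nondegenerate ℝ 𝔤
  have h1 : ∀ x, killingForm ℝ 𝔤 ((LinearMap.BilinForm.toDual _ hnd).symm l) x = l x := fun x =>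
    LinearMap.BilinForm.apply_toDual_symm_apply l x
  exact ⟨⟨_, gr.mem_filt_one_iff.2 fun y hy => (h1 y).trans (hl y hy)⟩, h1⟩

/-- Invariance gives B([α, s], y) = B(α, [s, y]), and the form is nondegenerate. A commutation
relation for α becomes a condition on the functional it represents. -/
lemma lie_eq_zero_of_killingForm {α s : 𝔤} (h : ∀ y, killingForm ℝ 𝔤 α ⁅s, y⁆ = 0) :
    ⁅α, s⁆ = 0 :=
  (LieAlgebra.IsKilling.killingForm_nondegenerate ℝ 𝔤).1 _ fun y =>
    (LieModule.traceForm_apply_lie_apply ℝ 𝔤 𝔤 α s y).trans (h y)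

/-- Decomposable two-forms whose factors annihilate the bracket with the value are in the kernel of
the codifferential of an abelian nilradical. -/
lemma Grading.exists_codiff_eq_zero (gr : Grading 𝔤) (h2 : gr.filt 2 = ⊥)
    {l₁ l₂ : Module.Dual ℝ 𝔤} (hl₁ : ∀ x ∈ gr.filt 0, l₁ x = 0) (hl₂ : ∀ x ∈ gr.filt 0, l₂ x = 0)
    {s : 𝔤} (hs₁ : ∀ y, l₁ ⁅s, y⁆ = 0) (hs₂ : ∀ y, l₂ ⁅s, y⁆ = 0) :
    ∃ τ : (⋀[ℝ]^2 gr.pPlus) ⊗[ℝ] 𝔤,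
      (∀ X Y, (l₁ X * l₂ Y - l₁ Y * l₂ X) • s = toTwoForm gr.pPlus τ X Y) ∧
        codiff gr.pPlus τ = 0 := by
  obtain ⟨α, hα⟩ := gr.exists_killingForm_eq l₁ hl₁
  obtain ⟨β, hβ⟩ := gr.exists_killingForm_eq l₂ hl₂
  refine ⟨exteriorPower.ιMulti ℝ 2 ![α, β] ⊗ₜ[ℝ] s, fun X Y => ?_, ?_⟩
  · rw [toTwoForm_apply, hα, hα, hβ, hβ]
  -- The nilradical is abelian because [𝔤¹, 𝔤¹] ⊆ 𝔤² = 0.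
  · have h3 : ⁅α, β⁆ = 0 := by
      refine Subtype.ext ?_
      have : ⁅(α : 𝔤), (β : 𝔤)⁆ ∈ gr.filt 2 := gr.lie_mem_filt (i := 1) (j := 1) α.2 β.2
      rw [h2] at this
      exact this
    rw [codiff_apply, lie_eq_zero_of_killingForm fun y => by rw [hα, hs₁],
      lie_eq_zero_of_killingForm fun y => by rw [hβ, hs₂], h3]
    simp

end DecomposableForms

section

variable {n : Type*} [Fintype n] [DecidableEq n] {𝔤 : Type*} [LieRing 𝔤] [LieAlgebra ℝ 𝔤]
  {c : 𝔤 →ₗ[ℝ] Matrix n n ℝ} {b : n → ℤ}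

lemma IsSpecialLinear.filt_two_grading_eq_bot [Nonempty n] (h : IsSpecialLinear c)
    (hb : ∀ k l, b l + 1 < b k → ∃ j, b j = b l + 1) (hb' : ∀ k l, b l ≤ b k + 1) :
    (h.grading b hb).filt 2 = ⊥ := by
  refine (Submodule.eq_bot_iff _).2 fun x hx => h.injective ?_
  rw [map_zero]
  ext k l
  exact (h.mem_filt_grading_iff hb).1 hx k l (by have := hb' k l; omega)

end

/-! ### Curvature, normality and regularity of the deformed geometry -/

section TwistedGeometry

open Filter Set VectorField
open scoped Topology

namespace FlatTwist

variable {n : Type*} [Fintype n] [DecidableEq n] {A : Type*} [NormedRing A]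
  [NormedAlgebra ℝ A] {m : A ≃ₐ[ℝ] Matrix n n ℝ} {b : n → ℤ} (T : FlatTwist m b)

/-- The vector field on the ambient space that induces the inverse image of `X`. -/
def ambientField (Y : A) (p : T.V × A) : T.V × A :=
  (T.ν (p.2 * Y * Ring.inverse p.2) - (T.μ₁ p.1 * T.μ₂ (p.2 * Y * Ring.inverse p.2)) • T.z,
    (p.2 * Y * Ring.inverse p.2 - T.ν (p.2 * Y * Ring.inverse p.2)) * p.2)

lemma hasFDerivAt_conj [CompleteSpace A] (h : blockSubgroup m b) (Y : A) :
    ∃ L : A →L[ℝ] A, HasFDerivAt (fun a => a * Y * Ring.inverse a) L (blockVal m b h) ∧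
      ∀ k, L k = k * Y * blockVal m b h⁻¹ -
        blockVal m b h * Y * blockVal m b h⁻¹ * k * blockVal m b h⁻¹ := by
  have h1 := (hasFDerivAt_id (𝕜 := ℝ) (blockVal m b h)).mul_const' Y
  have h2 := hasFDerivAt_ringInverse (𝕜 := ℝ) (⟨blockVal m b h, blockVal m b h⁻¹,
    blockVal_mul_inv m h, blockVal_inv_mul m h⟩ : Aˣ)
  refine ⟨_, h1.mul' h2, fun k => ?_⟩
  rw [ringInverse_blockVal]
  simp [mul_assoc, sub_eq_neg_add, ContinuousLinearMap.mulLeftRight_apply]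

/-- The letters a and d stand for the conjugate of Y and its derivative in the direction w; leaving
them free lets them be replaced by simplified expressions in the curvature computation. -/
lemma hasFDerivAt_ambientField [CompleteSpace A] (x : T.V) (h : blockSubgroup m b) (Y : A) :
    ∃ L : T.V × A →L[ℝ] T.V × A, HasFDerivAt (T.ambientField Y) L (x, blockVal m b h) ∧
      ∀ w : T.V × A, ∀ a d : A, a = blockVal m b h * Y * blockVal m b h⁻¹ →
        d = w.2 * Y * blockVal m b h⁻¹ - a * w.2 * blockVal m b h⁻¹ →
        L w = (T.ν d - (T.μ₁ w.1 * T.μ₂ a + T.μ₁ x * T.μ₂ d) • T.z,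
          (d - T.ν d) * blockVal m b h + (a - T.ν a) * w.2) := by
  obtain ⟨L, hL, hL'⟩ := hasFDerivAt_conj h Y
  have h1 : HasFDerivAt (fun p : T.V × A => p.2 * Y * Ring.inverse p.2)
      (L.comp (ContinuousLinearMap.snd ℝ T.V A)) (x, blockVal m b h) :=
    HasFDerivAt.comp (x, blockVal m b h) (f := fun p : T.V × A => p.2) hL hasFDerivAt_snd
  have h2 := T.ν.hasFDerivAt.comp (x, blockVal m b h) h1
  have h3 := T.μ₂.hasFDerivAt.comp (x, blockVal m b h) h1
  have h4 : HasFDerivAt (fun p : T.V × A => T.μ₁ p.1)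
      ((T.μ₁.comp T.V.subtypeL).comp (ContinuousLinearMap.fst ℝ T.V A)) (x, blockVal m b h) :=
    ((T.μ₁.comp T.V.subtypeL).comp (ContinuousLinearMap.fst ℝ T.V A)).hasFDerivAt
  have h5 := h2.sub ((h4.mul h3).smul_const T.z)
  have h6 := T.V.subtypeL.hasFDerivAt.comp (x, blockVal m b h) h2
  have h7 := (h1.sub h6).mul' (hasFDerivAt_snd (𝕜 := ℝ) (E := T.V) (F := A) (p := (x, blockVal m b h)))
  refine ⟨_, h5.prodMk h7, ?_⟩
  rintro w a d rfl rfl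
  rw [← hL']
  refine Prod.ext ?_ ?_
  · change T.ν (L w.2) - (T.μ₁ x * T.μ₂ (L w.2) +
      T.μ₂ (blockVal m b h * Y * Ring.inverse (blockVal m b h)) * T.μ₁ w.1) • T.z = _
    rw [ringInverse_blockVal, add_comm, mul_comm (T.μ₂ _)]
  · change (blockVal m b h * Y * Ring.inverse (blockVal m b h) -
      T.ν (blockVal m b h * Y * Ring.inverse (blockVal m b h))) * w.2 +
        (L w.2 - T.ν (L w.2)) * blockVal m b h = _
    rw [ringInverse_blockVal, add_comm]

variable [CompleteSpace A] [FiniteDimensional ℝ A] [Nonempty n]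

lemma mfd_constantField (X : slAlgebra m) (u : T.TotalSpace) :
    mfd (E := T.V × slb m b) T.val u (constantField T.form X u) =
      T.ambientField (toMat m X) (T.val u) := by
  rw [T.constantField_form]
  refine (T.mfd_val u (T.formInv u X)).trans ?_
  rw [coe_formInv_snd, formInv, ambientField]
  have h1 : (T.val u).2 = blockVal m b u.2 := rfl
  rw [h1, ringInverse_blockVal]
  refine Prod.ext rfl ?_
  dsimp only
  rw [← mul_assoc, ← mul_assoc, blockVal_mul_inv, one_mul]

/-- The conjugation by an element of the structure group. -/
def conj (h : blockSubgroup m b) : slAlgebra m →ₗ[ℝ] A :=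
  (LinearMap.mulLeftRight ℝ (blockVal m b h, blockVal m b h⁻¹)).comp (toMat m)

lemma conj_apply (h : blockSubgroup m b) (X : slAlgebra m) :
    conj h X = blockVal m b h * toMat m X * blockVal m b h⁻¹ := rfl

/-- The bracket of the fields ω⁻¹(X) and ω⁻¹(Y) is computed in the ambient space. All terms of the
flat connection cancel; only the derivative of the coefficient μ₁(x) survives, and it contributes μ₁
∧ μ₂ ⊗ z, conjugated by the fibre coordinate. -/
theorem toMat_curvatureFunction (u : T.TotalSpace) (X Y : slAlgebra m) :
    toMat m (curvatureFunction T.form u X Y) =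
      (T.μ₁ (conj u.2 X) * T.μ₂ (conj u.2 Y) - T.μ₁ (conj u.2 Y) * T.μ₂ (conj u.2 X)) •
        (blockVal m b u.2⁻¹ * (T.z : A) * blockVal m b u.2) := by
  have : CompleteSpace (T.V × slb m b) := FiniteDimensional.complete ℝ _
  have hconst : ∀ (X Y : slAlgebra m) , dirDeriv (fun v => T.form v (constantField T.form Y v)) u
      (constantField T.form X u) = 0 := by
    intro X Y
    have h1 : (fun v => T.form v (constantField T.form Y v)) = fun _ => Y :=
      funext fun v => by rw [T.constantField_form, T.form_formInv]
    rw [h1, dirDeriv]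
    exact congrArg (fun L : T.V × slb m b →L[ℝ] slb m 0 => L (constantField T.form X u))
      (mfderiv_const (M' := slb m 0) (I := 𝓘(ℝ, T.V × slb m b)) (I' := 𝓘(ℝ, slb m 0)) (c := Y)
        (x := u))
  -- The form is constant on the fields ω⁻¹(X), so dω reduces to its bracket term.
  have hk : curvatureFunction T.form u X Y =
      ⁅X, Y⁆ - T.form u (mlieBracket 𝓘(ℝ, T.V × slb m b) (constantField T.form X)
        (constantField T.form Y) u) := by
    rw [curvatureFunction, curvature, extDeriv, hconst, hconst, T.constantField_form X,
      T.constantField_form Y, T.form_formInv, T.form_formInv, sub_zero, zero_sub,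
      neg_add_eq_sub]
  obtain ⟨LX, hLX, hLX'⟩ := T.hasFDerivAt_ambientField u.1 u.2 (toMat m X)
  obtain ⟨LY, hLY, hLY'⟩ := T.hasFDerivAt_ambientField u.1 u.2 (toMat m Y)
  have hbr := T.isEmbeddedAtlas.mfd_mlieBracket (x := u) (T.mfd_constantField X)
    (T.mfd_constantField Y) hLX.differentiableAt hLY.differentiableAt
  have hfX : fderiv ℝ (T.ambientField (toMat m X)) (T.val u) = LX := hLX.fderiv
  have hfY : fderiv ℝ (T.ambientField (toMat m Y)) (T.val u) = LY := hLY.fderiv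
  have hf : ∀ X : slAlgebra m, T.ambientField (toMat m X) (T.val u) =
      (T.ν (conj u.2 X) - (T.μ₁ u.1 * T.μ₂ (conj u.2 X)) • T.z,
        (conj u.2 X - T.ν (conj u.2 X)) * blockVal m b u.2) := by
    intro X
    have h1 : (T.val u).2 = blockVal m b u.2 := rfl
    rw [ambientField, h1, ringInverse_blockVal]
    rfl
  rw [hfX, hfY, hf, hf] at hbr
  set g := blockVal m b u.2 with hg
  set gi := blockVal m b u.2⁻¹ with hgi
  have hgg : g * gi = 1 := blockVal_mul_inv m u.2
  have hgg' : gi * g = 1 := blockVal_inv_mul m u.2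
  set aX := conj u.2 X with haX
  set aY := conj u.2 Y with haY
  have hX : toMat m X = gi * aX * g := by
    rw [haX, conj_apply, ← hg, ← hgi, ← mul_assoc, ← mul_assoc, hgg', one_mul, mul_assoc, hgg',
      mul_one]
  have hY : toMat m Y = gi * aY * g := by
    rw [haY, conj_apply, ← hg, ← hgi, ← mul_assoc, ← mul_assoc, hgg', one_mul, mul_assoc, hgg',
      mul_one]
  have cancel : ∀ a c : A, a * g * (gi * c) = a * c := fun a c => by
    rw [mul_assoc, ← mul_assoc g, hgg, one_mul]
  have hd : ∀ p a : A, p * g * (gi * a * g) * gi - a * (p * g) * gi = p * a - a * p := by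
    intro p a
    rw [mul_assoc gi, cancel, mul_assoc, mul_assoc a, hgg, mul_one, mul_assoc a, mul_assoc p, hgg,
      mul_one]
  rw [hLY' _ aY ((aX - T.ν aX) * aY - aY * (aX - T.ν aX)) rfl (by rw [hY]; exact (hd _ _).symm),
    hLX' _ aX ((aY - T.ν aY) * aX - aX * (aY - T.ν aY)) rfl (by rw [hX]; exact (hd _ _).symm)]
    at hbr
  set dY := (aX - T.ν aX) * aY - aY * (aX - T.ν aX) with hdY
  set dX := (aY - T.ν aY) * aX - aX * (aY - T.ν aY) with hdX
  rw [hk, map_sub, toMat_lie, T.toMat_form_eq, hbr, ← hgi, ← hg]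
  -- The twist absorbs the coefficients μ₁(x) μ₂(d) z. The terms with the derivative of μ₁(x) have
  -- no counterpart in it and remain.
  have htw : T.twist u.1 (T.ν dY - (T.μ₁ ((T.ν aX - (T.μ₁ u.1 * T.μ₂ aX) • T.z : T.V) : A) * T.μ₂ aY +
        T.μ₁ u.1 * T.μ₂ dY) • T.z -
      (T.ν dX - (T.μ₁ ((T.ν aY - (T.μ₁ u.1 * T.μ₂ aY) • T.z : T.V) : A) * T.μ₂ aX +
        T.μ₁ u.1 * T.μ₂ dX) • T.z)) =
      T.ν dY - T.ν dX - (T.μ₁ aX * T.μ₂ aY - T.μ₁ aY * T.μ₂ aX) • T.z := by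
    simp only [twist, Submodule.coe_sub, Submodule.coe_smul, map_sub, map_smul, T.μ₁_z, T.μ₂_z,
      T.μ₁_ν, T.μ₂_ν, smul_zero, sub_zero]
    module
  simp only [Prod.mk_sub_mk]
  rw [htw]
  have hνν := T.coe_mul_coe (T.ν aX) (T.ν aY)
  have hνν' := T.coe_mul_coe (T.ν aY) (T.ν aX)
  -- The products of two elements of V drop out; this is the place where the complement being
  -- abelian makes the untwisted connection flat.
  have hlie : aX * aY - aY * aX = dY - dX + ((aY - T.ν aY) * (aX - T.ν aX) -
      (aX - T.ν aX) * (aY - T.ν aY)) := by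
    rw [hdY, hdX]
    simp only [mul_sub, sub_mul, hνν, hνν']
    abel
  have hXY : toMat m X * toMat m Y - toMat m Y * toMat m X = gi * (aX * aY - aY * aX) * g := by
    have c1 : ∀ c : A, g * (gi * c) = c := fun c => by rw [← mul_assoc, hgg, one_mul]
    rw [hX, hY]
    simp only [mul_sub, sub_mul, mul_assoc, c1]
  rw [hXY, hlie]
  simp only [Submodule.coe_sub, Submodule.coe_smul, mul_sub, sub_mul, mul_add, add_mul,
    mul_smul_comm, smul_mul_assoc, mul_assoc, sub_smul]
  abel

lemma conj_mem_slb {hb : ∀ k l, b l + 1 < b k → ∃ j, b j = b l + 1} (h : blockSubgroup m b)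
    {X : slAlgebra m} (hX : X ∈ (slGrading m hb).filt 0) : conj h X ∈ slb m b :=
  slb_mul_conj_mem m b h
    ⟨(mem_range_toMat m).1 ⟨X, rfl⟩, (mem_filt_zero_slGrading_iff m hb).1 hX⟩

lemma conj_lie (h : blockSubgroup m b) (X Y : slAlgebra m) :
    conj h ⁅X, Y⁆ = conj h X * conj h Y - conj h Y * conj h X := by
  have c1 : ∀ c : A, blockVal m b h⁻¹ * (blockVal m b h * c) = c := fun c => by
    rw [← mul_assoc, blockVal_inv_mul, one_mul]
  simp only [conj_apply, toMat_lie, mul_sub, sub_mul, mul_assoc, c1]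

lemma exists_conj_eq (h : blockSubgroup m b) (v : T.V) : ∃ s : slAlgebra m,
    toMat m s = blockVal m b h⁻¹ * (v : A) * blockVal m b h ∧ conj h s = v := by
  have hs := trace_conj m b h⁻¹ (v : A)
  rw [inv_inv, T.trace_coe] at hs
  refine ((mem_range_toMat m).2 hs).imp fun s hs => ⟨hs, ?_⟩
  rw [conj_apply, hs, ← mul_assoc, ← mul_assoc, blockVal_mul_inv, one_mul, mul_assoc,
    blockVal_mul_inv, mul_one]

lemma exists_codiff_eq_zero (hb : ∀ k l, b l + 1 < b k → ∃ j, b j = b l + 1)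
    (hb' : ∀ k l, b l ≤ b k + 1) (hz₁ : ∀ a : A, T.μ₁ ((T.z : A) * a - a * (T.z : A)) = 0)
    (hz₂ : ∀ a : A, T.μ₂ ((T.z : A) * a - a * (T.z : A)) = 0) (h : blockSubgroup m b)
    {s : slAlgebra m} (hs : toMat m s = blockVal m b h⁻¹ * (T.z : A) * blockVal m b h)
    (hcs : conj h s = T.z) :
    ∃ τ : (⋀[ℝ]^2 (slGrading m hb).pPlus) ⊗[ℝ] slAlgebra m,
      (∀ X Y, toMat m (toTwoForm (slGrading m hb).pPlus τ X Y) =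
        (T.μ₁ (conj h X) * T.μ₂ (conj h Y) - T.μ₁ (conj h Y) * T.μ₂ (conj h X)) •
          (blockVal m b h⁻¹ * (T.z : A) * blockVal m b h)) ∧
      codiff (slGrading m hb).pPlus τ = 0 := by
  have : FiniteDimensional ℝ (slAlgebra m) := inferInstanceAs (FiniteDimensional ℝ (slb m 0))
  have hν : ∀ x ∈ (slGrading m hb).filt 0, T.ν (conj h x) = 0 := fun x hx =>
    T.ν_eq_zero _ (conj_mem_slb h hx)
  refine ((slGrading m hb).exists_codiff_eq_zero
    ((isSpecialLinear_toMat m).filt_two_grading_eq_bot hb hb')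
    (l₁ := T.μ₁.toLinearMap ∘ₗ conj h) (l₂ := T.μ₂.toLinearMap ∘ₗ conj h) (s := s)
    (fun x hx => ?_) (fun x hx => ?_) (fun y => ?_) (fun y => ?_)).imp fun τ hτ => ⟨fun X Y => ?_, hτ.2⟩
  · change T.μ₁ (conj h x) = 0
    rw [← T.μ₁_ν, hν x hx, Submodule.coe_zero, map_zero]
  · change T.μ₂ (conj h x) = 0
    rw [← T.μ₂_ν, hν x hx, Submodule.coe_zero, map_zero]
  · change T.μ₁ (conj h ⁅s, y⁆) = 0
    rw [conj_lie, hcs, hz₁]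
  · change T.μ₂ (conj h ⁅s, y⁆) = 0
    rw [conj_lie, hcs, hz₂]
  · rw [← hτ.1, map_smul, hs]
    rfl

/-- The hypotheses say that both functionals vanish on all brackets with z, so by invariance of the
Killing form their dual elements commute with z. Conjugation by the fibre coordinate carries this
over to every point. -/
theorem isNormal (hb : ∀ k l, b l + 1 < b k → ∃ j, b j = b l + 1)
    (hb' : ∀ k l, b l ≤ b k + 1) (hz₁ : ∀ a : A, T.μ₁ ((T.z : A) * a - a * (T.z : A)) = 0)
    (hz₂ : ∀ a : A, T.μ₂ ((T.z : A) * a - a * (T.z : A)) = 0) :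
    IsNormal (slGrading m hb) T.form := fun u =>
  (T.exists_conj_eq u.2 T.z).elim fun _ hs =>
    (T.exists_codiff_eq_zero hb hb' hz₁ hz₂ u.2 hs.1 hs.2).imp fun _ hτ => ⟨fun X Y => toMat_injective m ((T.toMat_curvatureFunction u X Y).trans (hτ.1 X Y).symm), hτ.2⟩

/-- For i, j ≤ -1 the required filtration index is at most -1, and with a grading of depth at most
one that component is all of 𝔤. -/
theorem isRegular (hb : ∀ k l, b l + 1 < b k → ∃ j, b j = b l + 1) (hb' : ∀ k l, b l ≤ b k + 1) :
    IsRegular (slGrading m hb) T.form := by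
  intro u i j hi hj X _ Y _
  refine ((isSpecialLinear_toMat m).mem_filt_grading_iff hb).2 fun k l hkl => ?_
  have := hb' l k
  omega

theorem isParabolicGeometry (hb : ∀ k l, b l + 1 < b k → ∃ j, b j = b l + 1) :
    IsParabolicGeometry (EP := slb m b) (EM := T.V) (slGrading m hb) T.act Prod.fst T.form :=
  ⟨isParabolicSubgroup_blockSubgroup m hb, T.isCartanGeometry⟩

end FlatTwist

end TwistedGeometry

/-! ### The deformation given by matrix entries and a matrix unit -/

section EntryTwist

variable {n : Type*} [Fintype n] [DecidableEq n] {A : Type*} [NormedRing A]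
  [NormedAlgebra ℝ A] (m : A ≃ₐ[ℝ] Matrix n n ℝ)

/-- The strictly lower block triangular matrices. -/
def lowerSubmodule (b : n → ℤ) : Submodule ℝ A where
  carrier := {a | ∀ k l, b k ≤ b l → m a k l = 0}
  add_mem' hx hy k l hkl := by rw [map_add, Matrix.add_apply, hx k l hkl, hy k l hkl, add_zero]
  zero_mem' k l _ := by rw [map_zero]; rfl
  smul_mem' r x hx k l hkl := by rw [map_smul, Matrix.smul_apply, hx k l hkl, smul_zero]

/-- The strictly lower block triangular part of a matrix. -/
def lowerPart (b : n → ℤ) : A →ₗ[ℝ] lowerSubmodule m b where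
  toFun a := ⟨m.symm (Matrix.of fun k l => if b l < b k then m a k l else 0), fun k l hkl => by
    rw [AlgEquiv.apply_symm_apply, Matrix.of_apply, if_neg (not_lt.2 hkl)]⟩
  map_add' a a' := by
    refine Subtype.ext (m.injective ?_)
    ext k l
    simp only [AlgEquiv.apply_symm_apply, Submodule.coe_add, map_add, Matrix.of_apply,
      Matrix.add_apply]
    split_ifs <;> simp
  map_smul' r a := by
    refine Subtype.ext (m.injective ?_)
    ext k l
    simp only [AlgEquiv.apply_symm_apply, Submodule.coe_smul, map_smul, Matrix.of_apply,
      Matrix.smul_apply, RingHom.id_apply]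
    split_ifs <;> simp

lemma map_lowerPart (b : n → ℤ) (a : A) (k l : n) :
    m (lowerPart m b a : A) k l = if b l < b k then m a k l else 0 := by
  change m (m.symm (Matrix.of fun k l => if b l < b k then m a k l else 0)) k l = _
  rw [AlgEquiv.apply_symm_apply, Matrix.of_apply]

/-- A matrix entry as a linear functional. -/
def entry (i j : n) : A →ₗ[ℝ] ℝ where
  toFun a := m a i j
  map_add' a a' := by rw [map_add, Matrix.add_apply]
  map_smul' r a := by rw [map_smul, Matrix.smul_apply]; rfl

/-- Left multiplication by the unit at (p, q) fills only row p, right multiplication only column q;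
the entry (i, j) avoids both. -/
lemma entry_single_mul_sub {i j p q : n} (hip : i ≠ p) (hjq : j ≠ q) (a : A) :
    entry m i j (m.symm (Matrix.single p q 1) * a - a * m.symm (Matrix.single p q 1)) = 0 := by
  change (m (_ - _) : Matrix n n ℝ) i j = 0
  rw [map_sub, map_mul, map_mul, AlgEquiv.apply_symm_apply, Matrix.sub_apply,
    Matrix.single_mul_apply_of_ne _ _ _ _ _ hip, Matrix.mul_single_apply_of_ne _ _ _ _ _ hjq,
    sub_zero]

variable [FiniteDimensional ℝ A]

/-- The deformation that is defined by two matrix entries in the same column and by a matrix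
unit. -/
def entryTwist {b : n → ℤ} (hb : ∀ k l, b l ≤ b k + 1) {i₁ i₂ j p q : n} (h₁ : b j < b i₁)
    (h₂ : b j < b i₂) (hpq : b q < b p) (hjq : j ≠ q) : FlatTwist m b where
  V := lowerSubmodule m b
  ν := LinearMap.toContinuousLinearMap (lowerPart m b)
  ν_coe v := by
    refine Subtype.ext (m.injective ?_)
    ext k l
    refine (map_lowerPart m b _ k l).trans ?_
    split_ifs with hkl
    · rfl
    · exact (v.2 k l (not_lt.1 hkl)).symm
  ν_eq_zero a ha := by
    refine Subtype.ext (m.injective ?_)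
    ext k l
    refine (map_lowerPart m b _ k l).trans ?_
    rw [Submodule.coe_zero, map_zero, Matrix.zero_apply]
    split_ifs with hkl
    · exact ha.2 hkl
    · rfl
  sub_ν_mem a ha := by
    have h3 : ∀ k l, (m (a - (lowerPart m b a : A)) : Matrix n n ℝ) k l =
        if b l < b k then 0 else m a k l := by
      intro k l
      rw [map_sub, Matrix.sub_apply, map_lowerPart]
      split_ifs <;> simp
    refine ⟨?_, fun k l hkl => (h3 k l).trans (if_pos hkl)⟩
    rw [← ha]
    exact Finset.sum_congr rfl fun k _ => (h3 k k).trans (if_neg (lt_irrefl _))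
  trace_coe v := Finset.sum_eq_zero fun k _ => v.2 k k le_rfl
  coe_mul_coe v w := by
    refine m.injective ?_
    ext k l
    rw [map_mul, map_zero, Matrix.mul_apply]
    refine Finset.sum_eq_zero fun s _ => ?_
    by_cases h3 : b k ≤ b s
    · rw [v.2 k s h3, zero_mul]
    · rw [w.2 s l (by have := hb l k; omega), mul_zero]
  μ₁ := LinearMap.toContinuousLinearMap (entry m i₁ j)
  μ₂ := LinearMap.toContinuousLinearMap (entry m i₂ j)
  μ₁_ν a := (map_lowerPart m b a i₁ j).trans (if_pos h₁)
  μ₂_ν a := (map_lowerPart m b a i₂ j).trans (if_pos h₂)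
  z := ⟨m.symm (Matrix.single p q 1), fun k l hkl => by
    rw [AlgEquiv.apply_symm_apply, Matrix.single_apply_of_ne]
    rintro ⟨rfl, rfl⟩
    exact absurd hkl (not_le.2 hpq)⟩
  μ₁_z := by
    change m (m.symm (Matrix.single p q 1)) i₁ j = 0
    rw [AlgEquiv.apply_symm_apply, Matrix.single_apply_of_ne]
    exact fun h => hjq h.2.symm
  μ₂_z := by
    change m (m.symm (Matrix.single p q 1)) i₂ j = 0
    rw [AlgEquiv.apply_symm_apply, Matrix.single_apply_of_ne]
    exact fun h => hjq h.2.symm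

variable [CompleteSpace A] [Nonempty n] {b b' : n → ℤ} (hb : ∀ k l, b l ≤ b k + 1)
  {i₁ i₂ j p q : n} (h₁ : b j < b i₁) (h₂ : b j < b i₂) (hpq : b q < b p) (hjq : j ≠ q)

/-- The curvature sends the units at (i₁, j) and (i₂, j), of degree at least -1 for b', to the unit
at (p, q), of degree below -1. Regularity would require a value in the filtration component of index
-1 - 1 + 1 = -1. -/
theorem not_isRegular_entryTwist (hb' : ∀ k l, b' l + 1 < b' k → ∃ j, b' j = b' l + 1)
    (hi : i₁ ≠ i₂) (h₁' : b' i₁ ≤ b' j + 1) (h₂' : b' i₂ ≤ b' j + 1) (hpq' : b' q + 1 < b' p) :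
    ¬ IsRegular (slGrading m hb') (entryTwist m hb h₁ h₂ hpq hjq).form := by
  intro hreg
  have hX : ∀ i, b j < b i → ∃ X : slAlgebra m, m (toMat m X) = Matrix.single i j 1 := by
    intro i hij
    obtain ⟨X, hX⟩ := (mem_range_toMat m (a := m.symm (Matrix.single i j 1))).2 (by
      rw [AlgEquiv.apply_symm_apply, Matrix.trace_single_eq_of_ne]
      rintro rfl
      exact lt_irrefl _ hij)
    exact ⟨X, by rw [hX, AlgEquiv.apply_symm_apply]⟩
  obtain ⟨X, hX₁⟩ := hX i₁ h₁
  obtain ⟨Y, hY₁⟩ := hX i₂ h₂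
  have hfilt : ∀ (i : n) (X : slAlgebra m), b' i ≤ b' j + 1 →
      m (toMat m X) = Matrix.single i j 1 → X ∈ (slGrading m hb').filt (-1) := by
    intro i X hi hX
    refine ((isSpecialLinear_toMat m).mem_filt_grading_iff hb').2 fun k l hkl => ?_
    change (m (toMat m X) : Matrix n n ℝ) k l = 0
    rw [hX, Matrix.single_apply_of_ne]
    rintro ⟨rfl, rfl⟩
    omega
  have h3 := hreg (0, 1) (-1) (-1) (by norm_num) (by norm_num) X (hfilt i₁ X h₁' hX₁) Y
    (hfilt i₂ Y h₂' hY₁)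
  have h4 := ((isSpecialLinear_toMat m).mem_filt_grading_iff hb').1 h3 p q (by omega)
  have h5 : m (toMat m (curvatureFunction (entryTwist m hb h₁ h₂ hpq hjq).form (0, 1) X Y)) p q
      = 0 := h4
  have h6 : ∀ X : slAlgebra m, FlatTwist.conj (1 : blockSubgroup m b) X = toMat m X := fun X => by
    rw [FlatTwist.conj_apply, inv_one, map_one, one_mul, mul_one]
  have h7 : ∀ (i k : n), (Matrix.single i j (1 : ℝ) : Matrix n n ℝ) k j = if i = k then 1 else 0 := by
    intro i k
    rw [Matrix.single_apply]
    simp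
  have h8 : (m (toMat m X) : Matrix n n ℝ) i₁ j * (m (toMat m Y) : Matrix n n ℝ) i₂ j -
      (m (toMat m Y) : Matrix n n ℝ) i₁ j * (m (toMat m X) : Matrix n n ℝ) i₂ j = 1 := by
    rw [hX₁, hY₁, h7, h7, h7, h7, if_pos rfl, if_pos rfl, if_neg hi.symm]
    norm_num
  rw [FlatTwist.toMat_curvatureFunction] at h5
  dsimp only at h5
  rw [h6, h6, inv_one, map_one, one_mul, mul_one] at h5
  have h9 : (m ((((m (toMat m X) : Matrix n n ℝ) i₁ j * (m (toMat m Y) : Matrix n n ℝ) i₂ j -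
      (m (toMat m Y) : Matrix n n ℝ) i₁ j * (m (toMat m X) : Matrix n n ℝ) i₂ j)) •
      m.symm (Matrix.single p q 1)) : Matrix n n ℝ) p q = 0 := h5
  rw [h8, one_smul, AlgEquiv.apply_symm_apply, Matrix.single_apply_same] at h9
  exact one_ne_zero h9

theorem isNormal_entryTwist (hb₁ : ∀ k l, b l + 1 < b k → ∃ j, b j = b l + 1) (hi₁ : i₁ ≠ p)
    (hi₂ : i₂ ≠ p) : IsNormal (slGrading m hb₁) (entryTwist m hb h₁ h₂ hpq hjq).form :=
  (entryTwist m hb h₁ h₂ hpq hjq).isNormal hb₁ hb (entry_single_mul_sub m hi₁ hjq)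
    (entry_single_mul_sub m hi₂ hjq)

end EntryTwist

end

end ParabolicGeometry

theorem proposition3p1 :
    -- the correspondence space of a normal parabolic geometry is a normal parabolic geometry
    (∀ {EG EP EQ EB EN : Type*}
      [NormedAddCommGroup EG] [NormedSpace ℝ EG] [FiniteDimensional ℝ EG]
      [NormedAddCommGroup EP] [NormedSpace ℝ EP] [FiniteDimensional ℝ EP]
      [NormedAddCommGroup EQ] [NormedSpace ℝ EQ] [FiniteDimensional ℝ EQ]
      [NormedAddCommGroup EB] [NormedSpace ℝ EB] [FiniteDimensional ℝ EB]
      [NormedAddCommGroup EN] [NormedSpace ℝ EN] [FiniteDimensional ℝ EN]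
      -- a semisimple Lie group `G`
      {G : Type*} [TopologicalSpace G] [ChartedSpace EG G] [Group G] [LieGroup 𝓘(ℝ, EG) ∞ G]
      [T2Space G] [SecondCountableTopology G]
      [LieAlgebra.IsSemisimple ℝ (GroupLieAlgebra 𝓘(ℝ, EG) G)]
      -- nested parabolic subgroups `Q ≤ P`, with their structures as Lie subgroups
      (grP grQ : ParabolicGeometry.Grading (GroupLieAlgebra 𝓘(ℝ, EG) G))
      {P Q : Subgroup G}
      [ChartedSpace EP P] [LieGroup 𝓘(ℝ, EP) ∞ P] [ChartedSpace EQ Q] [LieGroup 𝓘(ℝ, EQ) ∞ Q]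
      (_ : ParabolicGeometry.IsParabolicSubgroup (E' := EQ) grQ Q) (hQP : Q ≤ P)
      -- the total space `B` and the base `N`
      {B : Type*} [TopologicalSpace B] [ChartedSpace EB B] [IsManifold 𝓘(ℝ, EB) ∞ B]
      [T2Space B] [SecondCountableTopology B]
      {N : Type*} [TopologicalSpace N] [ChartedSpace EN N] [IsManifold 𝓘(ℝ, EN) ∞ N]
      [T2Space N] [SecondCountableTopology N]
      (act : B → P → B) (p : B → N) (θ : ParabolicGeometry.OneForm EG G EB B),
      ParabolicGeometry.IsParabolicGeometry (EP := EP) (EM := EN) grP act p θ →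
      ParabolicGeometry.IsNormal grP θ →
      (∃ (n : ℕ) (_ : ChartedSpace (EuclideanSpace ℝ (Fin n))
          (ParabolicGeometry.CorrespondenceSpace act hQP)),
        IsManifold 𝓘(ℝ, EuclideanSpace ℝ (Fin n)) ∞
          (ParabolicGeometry.CorrespondenceSpace act hQP) ∧
        T2Space (ParabolicGeometry.CorrespondenceSpace act hQP) ∧
        SecondCountableTopology (ParabolicGeometry.CorrespondenceSpace act hQP) ∧
        ParabolicGeometry.IsParabolicGeometry (EP := EQ) (EM := EuclideanSpace ℝ (Fin n)) grQ
          (ParabolicGeometry.restrictAct act hQP)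
          (ParabolicGeometry.toCorrespondenceSpace act hQP) θ) ∧
      ParabolicGeometry.IsNormal grQ θ) ∧
    -- regularity is not preserved in general, not even for normal geometries
    (¬ ∀ {EG EP EQ EB EN : Type}
      [NormedAddCommGroup EG] [NormedSpace ℝ EG] [FiniteDimensional ℝ EG]
      [NormedAddCommGroup EP] [NormedSpace ℝ EP] [FiniteDimensional ℝ EP]
      [NormedAddCommGroup EQ] [NormedSpace ℝ EQ] [FiniteDimensional ℝ EQ]
      [NormedAddCommGroup EB] [NormedSpace ℝ EB] [FiniteDimensional ℝ EB]
      [NormedAddCommGroup EN] [NormedSpace ℝ EN] [FiniteDimensional ℝ EN]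
      {G : Type} [TopologicalSpace G] [ChartedSpace EG G] [Group G] [LieGroup 𝓘(ℝ, EG) ∞ G]
      [T2Space G] [SecondCountableTopology G]
      [LieAlgebra.IsSemisimple ℝ (GroupLieAlgebra 𝓘(ℝ, EG) G)]
      (grP grQ : ParabolicGeometry.Grading (GroupLieAlgebra 𝓘(ℝ, EG) G))
      {P Q : Subgroup G}
      [ChartedSpace EP P] [LieGroup 𝓘(ℝ, EP) ∞ P] [ChartedSpace EQ Q] [LieGroup 𝓘(ℝ, EQ) ∞ Q]
      (_ : ParabolicGeometry.IsParabolicSubgroup (E' := EQ) grQ Q) (_ : Q ≤ P)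
      {B : Type} [TopologicalSpace B] [ChartedSpace EB B] [IsManifold 𝓘(ℝ, EB) ∞ B]
      [T2Space B] [SecondCountableTopology B]
      {N : Type} [TopologicalSpace N] [ChartedSpace EN N] [IsManifold 𝓘(ℝ, EN) ∞ N]
      [T2Space N] [SecondCountableTopology N]
      (act : B → P → B) (p : B → N) (θ : ParabolicGeometry.OneForm EG G EB B),
      grP.IsEffective →
      ParabolicGeometry.IsParabolicGeometry (EP := EP) (EM := EN) grP act p θ →
      ParabolicGeometry.IsNormal grP θ →
      ParabolicGeometry.IsRegular grP θ →
      ParabolicGeometry.IsRegular grQ θ) := by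
  refine ⟨?_, ?_⟩
  · intro EG EP EQ EB EN _ _ _ _ _ _ _ _ _ _ _ _ _ _ _ G _ _ _ _ _ _ _ grP grQ P Q _ _ _ _ hQ hQP
      B _ _ _ _ _ N _ _ _ _ _ act p θ hg hn
    exact ⟨ParabolicGeometry.exists_isParabolicGeometry_correspondenceSpace hQ hQP hg,
      hn.of_subgroup_le hg.isParabolicSubgroup hQ hQP⟩
  · intro H
    -- The matrix algebra is realized by continuous endomorphisms of ℝ⁵, which carry the operator
    -- norm needed for calculus.
    let m := (Module.End.toContinuousLinearMap (𝕜 := ℝ) (Fin 5 → ℝ)).symm.trans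
      (LinearMap.toMatrixAlgEquiv' (R := ℝ) (n := Fin 5))
    have : CompleteSpace ((Fin 5 → ℝ) →L[ℝ] (Fin 5 → ℝ)) := FiniteDimensional.complete ℝ _
    -- The block type of P is 2 + 3, of depth one. Splitting the first block puts index 1 between 0
    -- and the last three indices, so that only the unit at (4, 0) is pushed to degree -2 among
    -- those used.
    let b : Fin 5 → ℤ := ![0, 0, 1, 1, 1]
    let b' : Fin 5 → ℤ := ![0, 1, 2, 2, 2]
    have hb : ∀ k l, b l + 1 < b k → ∃ j, b j = b l + 1 := by decide
    have hb' : ∀ k l, b' l + 1 < b' k → ∃ j, b' j = b' l + 1 := by decide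
    -- Three indices in the second block are needed: rows 2 and 3 for the functionals, and row 4,
    -- distinct from both, for z. Column 0 of z differs from column 1 of the functionals, so that z
    -- commutes with their duals.
    let T := ParabolicGeometry.entryTwist m (b := b) (by decide) (i₁ := 2) (i₂ := 3) (j := 1)
      (p := 4) (q := 0) (by decide) (by decide) (by decide) (by decide)
    refine ParabolicGeometry.not_isRegular_entryTwist m (b := b) _ _ _ _ _ hb' (by decide)
      (by decide) (by decide) (by decide) (H (ParabolicGeometry.slGrading m hb)
        (ParabolicGeometry.slGrading m hb')
        (ParabolicGeometry.isParabolicSubgroup_blockSubgroup m hb')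
        (ParabolicGeometry.blockSubgroup_le m (b := b) (by decide)) T.act Prod.fst T.form
        (ParabolicGeometry.IsSpecialLinear.isEffective_grading _ hb (by decide))
        (T.isParabolicGeometry hb)
        (ParabolicGeometry.isNormal_entryTwist m _ _ _ _ _ hb (by decide) (by decide))
        (T.isRegular hb (by decide)))
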